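/- **Setting.** $\lambda$ is the security parameter. Adversaries are probabilistic polynomial-time in the non-uniform sense (families of probabilistic programs of cost polynomial in $\lambda$); they may evaluate all public algorithms below, including the public map $H$. A function of $\lambda$ is negligible if it decays faster than the inverse of every polynomial. *TPF.* $\mathbb G_\lambda$ is a finite cyclic group of order $q$ whose elements have encodings of polynomial length, and $H:\{0,1\}^*\to\mathbb G_\lambda$ is a public map determined by public parameters sampled at setup. Keys are uniform in $\mathbb Z_q^{*}$ (units modulo $q$); $\mathsf{TPF.Rnd}(k,m)=H(m)^k$, $\mathsf{TPF.ReEnc}(s,\rho)=s^{\rho}$, and the re-encryption key from $k_1$ to $k_2$ is $k_2/k_1$. *F.* $F:\{0,1\}^\lambda\times\{0,1\}^*\to\{0,1\}^\lambda$ is a keyed function, written $F_\kappa(x)$ with key $\kappa$. *TUR.* This is Paillier encryption with $N=pq$, where $(p,q)$ is a uniform pair of distinct $\lambda$-bit primes with $\gcd(pq,(p-1)(q-1))=1$: $\mathsf{TUR.Enc}(m)=(1+N)^m\rho^N \bmod N^2$ with $\rho$ uniform in $\mathbb Z_N^*$, and $\mathsf{TUR.ReEnc}(C)=C\cdot\mathsf{TUR.Enc}(0)\bmod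 N^2$. Some two-step decryption procedure is fixed that derives from $(p,q)$ two partial decryption keys $pdk_1,pdk_2$ of polynomial length such that partial decryption with one key followed by decryption with the other returns the plaintext. *Indexes.* A plaintext prefix index and a plaintext keyword index of polynomial size are given; all prefixes and keywords are pairwise distinct strings, and each word $x$ has one bitmap share $B^s_x$ for each cloud server $CS_s$, $s\in\{1,2\}$. With secret keys $k_M$ (for TPF) and $k_T$ (for $F$), the initial entry of $x$ stored at $CS_s$ is $(\mathsf{TPF.Rnd}(k_M,x),\ \mathsf{TUR.Enc}(B^s_x),\ F_{k_T}(s,x))$. Server $CS_s$ has a secret shuffle parameter $r_s=(\rho_s,\kappa_s)$ consisting of an independent uniform exponent $\rho_s\in\mathbb Z_q^*$ and tag key $\kappa_s\in\{0,1\}^\lambda$, the same in all rounds. To *refresh* an entry $(x,ID,tag)$, $CS_s$ replaces it by $(\mathsf{TPF.ReEnc}(x,\rho_s),\ \mathsf{TUR.ReEnc}(ID),\ F_{\kappa_s}(tag))$. In a shuffle round, for each $s$ and each of the two indexes, the list stored at $CS_s$ is sent to the other server, which refreshes all entries and applies a uniformly random permutation; $CS_s$ then does the same with the resulting list. *Shuffle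 experiment.* Fix a corrupted server $CS_c$, a share $o\in\{1,2\}$, one of the two indexes, two of its entries $e_0,e_1$, and a polynomially bounded number of previous shuffle rounds. After these rounds one more round is carried out. A uniform bit $b$ is chosen, and $e^\star$ is the entry of the final list at $CS_o$ that originates from $e_b$. The adversary receives the view of $CS_c$ in this round: $N$, $pdk_c$, $r_c$, the authorization key $k_M/k_u$ of a client with uniform key $k_u$, the coins of $CS_c$ in this round and, for both shares and both indexes, the list before the round (in the order of the plaintext index), the intermediate list and the final permuted list; in addition it receives $e_0$, $e_1$, $e^\star$ and the position of $e^\star$. It outputs a bit $b'$. **Theorem.** Suppose that 1. $\mathsf{TPF.Rnd}$ is a secure pseudorandom function: no adversary with oracle access distinguishes $\mathsf{TPF.Rnd}(k,\cdot)$, for uniform $k$, from a uniformly random function to $\mathbb G_\lambda$ with non-negligible advantage; 2. $F$ is a secure pseudorandom function in the same sense; 3. $\mathsf{TUR.ReEnc}$ is computationally unlinkable for each server: for $c\in\{1,2\}$ and all plaintext families $m_0,m_1$ of polynomial length, every adversary that is given $N$, $pdk_c$, $C_0=\mathsf{TUR.Enc}(m_0)$, $C_1=\mathsf{TUR.Enc}(m_1)$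 and $\mathsf{TUR.ReEnc}(C_b)$ for a uniform bit $b$ guesses $b$ with probability at most $\tfrac12+\mathsf{negl}(\lambda)$. Then shuffle indistinguishability holds: for every family of indexes, every choice of $c$, $o$, index, $e_0,e_1$ and number of previous rounds as above, and every adversary, in the shuffle experiment $$\Pr[b'=b]\le \tfrac12+\mathsf{negl}(\lambda).$$ -/

import Mathlib

/-! ## Asymptotics -/

namespace Brasp

/-- A function of the security parameter is negligible. -/
def Negligible (f : ℕ → ℝ) : Prop :=
  Asymptotics.SuperpolynomialDecay Filter.atTop (fun n : ℕ => (n : ℝ)) f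

/-- A quantity is bounded by a polynomial in the security parameter. -/
def PolyBounded (f : ℕ → ℕ) : Prop :=
  ∃ P : Polynomial ℕ, ∀ n, f n ≤ P.eval n

/-- The uniform distribution on a nonempty finite type. -/
noncomputable def unif (α : Type) [Finite α] [Nonempty α] : PMF α :=
  letI := Fintype.ofFinite α
  PMF.uniformOfFintype α

/-- The probability of the outcome `true`. -/
noncomputable def prob (d : PMF Bool) : ℝ := (d true).toReal

/-! ## Adversaries

A probabilistic polynomial-time adversary is a family, indexed by the security parameter, of
probabilistic straight-line programs of polynomial cost (the non-uniform model).
Bit strings are identified with natural numbers.  A program works on a list of registers: it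
starts with its input, and every instruction appends one register.
An instruction of width `w` returns its result modulo `2 ^ w` and costs `1 + w`; all the
arithmetic and sampling instructions are feasible in time polynomial in the length of their
operands.  The public algorithms of the scheme (group operations, the public map into the group,
the function `F`) may be called as instructions, and in an oracle experiment so may the
challenge oracle. -/

/-- The basic arithmetic instructions (subtraction is truncated). -/
inductive Arith
  | add | sub | mul | div | mod

def Arith.eval : Arith → ℕ → ℕ → ℕ
  | .add, x, y => x + y
  | .sub, x, y => x - y
  | .mul, x, y => x * y
  | .div, x, y => x / y
  | .mod, x, y => x % y

/-- The procedures that a program can call: the description of the public parameters, the public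
map into the group, multiplication and exponentiation in the group, the function `F` with an
explicitly given key, and the challenge oracle of the experiment. -/
inductive Proc
  | param | hash | gmul | gpow | prf | chal

inductive Instr
  /-- the constant `c` -/
  | const (c : ℕ)
  /-- an arithmetic operation on registers `i` and `j` -/
  | arith (op : Arith) (w i j : ℕ)
  /-- modular exponentiation, register `i` to the power register `j` modulo register `k` -/
  | powMod (w i j k : ℕ)
  /-- a uniform number below the content of register `i` -/
  | sample (w i : ℕ)
  /-- a uniform invertible residue modulo the content of register `i` -/
  | sampleUnit (w i : ℕ)
  /-- a procedure call with arguments in registers `i` and `j` -/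
  | call (p : Proc) (w i j : ℕ)

def Instr.cost : Instr → ℕ
  | .const c => 1 + c.size
  | .arith _ w _ _ => 1 + w
  | .powMod w _ _ _ => 1 + w
  | .sample w _ => 1 + w
  | .sampleUnit w _ => 1 + w
  | .call _ w _ _ => 1 + w

/-- What each procedure returns on a pair of arguments. -/
abbrev Env := Proc → ℕ → ℕ → ℕ

/-- The content of a register (unwritten registers contain `0`). -/
def reg (regs : List ℕ) (i : ℕ) : ℕ := regs.getD i 0

noncomputable def Instr.eval (env : Env) (regs : List ℕ) : Instr → PMF ℕ
  | .const c => PMF.pure c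
  | .arith op w i j => PMF.pure (op.eval (reg regs i) (reg regs j) % 2 ^ w)
  | .powMod w i j k => PMF.pure (reg regs i ^ reg regs j % reg regs k % 2 ^ w)
  | .sample w i => (unif (Fin (reg regs i - 1 + 1))).map fun x => x.val % 2 ^ w
  | .sampleUnit w i => (unif (ZMod (reg regs i))ˣ).map fun x => x.val.val % 2 ^ w
  | .call p w i j => PMF.pure (env p (reg regs i) (reg regs j) % 2 ^ w)

abbrev Program := List Instr

/-- The cost of a program. -/
def Program.cost (A : Program) : ℕ := (A.map Instr.cost).sum

/-- The final registers of a run. -/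
noncomputable def Program.run (env : Env) : Program → List ℕ → PMF (List ℕ)
  | [], regs => PMF.pure regs
  | i :: A, regs => (i.eval env regs).bind fun v => Program.run env A (regs ++ [v])

/-- The output bit: whether the last register contains `1`. -/
noncomputable def Program.out (A : Program) (env : Env) (input : List ℕ) : PMF Bool :=
  (A.run env input).map fun regs => decide (regs.getLast? = some 1)

/-- An adversary: a program of polynomial cost for every security parameter. -/
structure Adversary where
  prog : ℕ → Program
  poly : PolyBounded fun n => (prog n).cost

/-! ## The tailored proxy pseudorandom function -/

/-- The data of the tailored proxy pseudorandom function: for every security parameter a finite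
cyclic group whose elements are written as strings of polynomial length, and a public map from
strings to the group, which is determined by public parameters sampled at setup (`descr` is the
part of the public parameters that is published as a string). -/
structure TPF where
  G : ℕ → Type
  [group : ∀ n, CommGroup (G n)]
  [fintype : ∀ n, Fintype (G n)]
  [cyclic : ∀ n, IsCyclic (G n)]
  enc : ∀ n, G n → ℕ
  enc_injective : ∀ n, Function.Injective (enc n)
  len : ℕ → ℕ
  len_poly : PolyBounded len
  enc_size : ∀ n g, (enc n g).size ≤ len n
  Param : ℕ → Type
  setup : ∀ n, PMF (Param n)
  descr : ∀ n, Param n → ℕ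
  hash : ∀ n, Param n → ℕ → G n

attribute [instance] TPF.group TPF.fintype TPF.cyclic

namespace TPF

variable (T : TPF)

/-- Keys are the exponents that are invertible modulo the order of the group. -/
abbrev Key (n : ℕ) : Type := (ZMod (Fintype.card (T.G n)))ˣ

noncomputable def keyGen (n : ℕ) : PMF (T.Key n) := unif (T.Key n)

def reEnc {n : ℕ} (s : T.G n) (rk : T.Key n) : T.G n := s ^ rk.val.val

def rnd {n : ℕ} (pp : T.Param n) (k : T.Key n) (m : ℕ) : T.G n := (T.hash n pp m) ^ k.val.val

/-- The re-encryption key from `k₁` to `k₂`. -/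
def recKeyGen {n : ℕ} (k₁ k₂ : T.Key n) : T.Key n := k₂ / k₁

/-- Re-encryption turns a value under `k₁` into the value under `k₂`. -/
theorem reEnc_rnd {n : ℕ} (pp : T.Param n) (k₁ k₂ : T.Key n) (m : ℕ) :
    T.reEnc (T.rnd pp k₁ m) (T.recKeyGen k₁ k₂) = T.rnd pp k₂ m := by
  unfold reEnc rnd recKeyGen
  rw [← pow_mul, ← pow_mod_card, ← ZMod.val_mul, ← Units.val_mul]
  congr 3
  simp

open Classical in
/-- Exponentiation on encoded elements (`0` if the argument encodes no group element). -/
noncomputable def encPow (n : ℕ) (x e : ℕ) : ℕ :=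
  if h : ∃ g, T.enc n g = x then T.enc n (h.choose ^ e) else 0

open Classical in
/-- Multiplication on encoded elements (`0` if an argument encodes no group element). -/
noncomputable def encMul (n : ℕ) (x y : ℕ) : ℕ :=
  if h : (∃ g, T.enc n g = x) ∧ ∃ g, T.enc n g = y then
    T.enc n (h.1.choose * h.2.choose) else 0

end TPF

/-! ## The pseudorandom function `F`, and pseudorandomness -/

/-- A keyed function `{0,1}ⁿ × {0,1}* → {0,1}ⁿ`; the key comes first. -/
abbrev KeyedFun := ∀ n : ℕ, Fin (2 ^ n) → ℕ → Fin (2 ^ n)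

/-- The procedures available to a program, for given public parameters and challenge oracle. -/
noncomputable def env (T : TPF) (F : KeyedFun) (n : ℕ) (pp : T.Param n) (chal : ℕ → ℕ) : Env
  | .param, _, _ => T.descr n pp
  | .hash, x, _ => T.enc n (T.hash n pp x)
  | .gmul, x, y => T.encMul n x y
  | .gpow, x, e => T.encPow n x e
  | .prf, k, x => if h : k < 2 ^ n then (F n ⟨k, h⟩ x).val else 0
  | .chal, x, _ => chal x

/-- The experiment in which a program queries `f k` for a uniform key `k`. -/
noncomputable def prfReal (T : TPF) (F : KeyedFun) (n : ℕ) {K R : Type} [Finite K] [Nonempty K]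
    (encR : R → ℕ) (f : T.Param n → K → ℕ → R) (A : Program) : PMF Bool := do
  let pp ← T.setup n
  let k ← unif K
  A.out (env T F n pp fun x => encR (f pp k x)) []

/-- The experiment in which a program queries a uniformly random function.  As a program of cost
`c` can only form queries below `2 ^ c`, the random function is sampled on these. -/
noncomputable def prfIdeal (T : TPF) (F : KeyedFun) (n : ℕ) {R : Type} [Finite R] [Nonempty R]
    (encR : R → ℕ) (A : Program) : PMF Bool := do
  let pp ← T.setup n
  let g ← unif (Fin (2 ^ A.cost) → R)
  A.out (env T F n pp fun x => if h : x < 2 ^ A.cost then encR (g ⟨x, h⟩) else 0) []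

/-- `TPF.Rnd` is a secure pseudorandom function. -/
def TPFSecure (T : TPF) (F : KeyedFun) : Prop :=
  ∀ A : Adversary, Negligible fun n =>
    |prob (prfReal T F n (T.enc n) (fun pp (k : T.Key n) => T.rnd pp k) (A.prog n)) -
      prob (prfIdeal T F n (T.enc n) (A.prog n))|

/-- `F` is a secure pseudorandom function. -/
def FSecure (T : TPF) (F : KeyedFun) : Prop :=
  ∀ A : Adversary, Negligible fun n =>
    |prob (prfReal T F n Fin.val (fun _ k => F n k) (A.prog n)) -
      prob (prfIdeal T F n (Fin.val : Fin (2 ^ n) → ℕ) (A.prog n))|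

/-! ## Tailored universal re-encryption from Paillier -/

/-- The two cloud servers. -/
inductive Server
  | cs1 | cs2
  deriving DecidableEq

instance : Fintype Server := ⟨{.cs1, .cs2}, fun s => by cases s <;> simp⟩

namespace Server

def other : Server → Server
  | cs1 => cs2
  | cs2 => cs1

def num : Server → ℕ
  | cs1 => 1
  | cs2 => 2

end Server

/-- Prime pairs admissible for Paillier. -/
def PaillierPrimes (p q : ℕ) : Prop :=
  p.Prime ∧ q.Prime ∧ p ≠ q ∧ Nat.Coprime (p * q) ((p - 1) * (q - 1))

open Classical in
/-- Pairs of admissible primes of exactly `n` bits. -/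
noncomputable def primePairs (n : ℕ) : Finset (ℕ × ℕ) :=
  (Finset.range (2 ^ n) ×ˢ Finset.range (2 ^ n)).filter fun x =>
    x.1.size = n ∧ x.2.size = n ∧ PaillierPrimes x.1 x.2

open Classical in
/-- Key generation: a uniform pair of admissible `n`-bit primes (the master secret key); the
public key is the product.  The default is only used for the few small `n` without such a pair. -/
noncomputable def turSetup (n : ℕ) : PMF (ℕ × ℕ) :=
  if h : (primePairs n).Nonempty then PMF.uniformOfFinset (primePairs n) h else PMF.pure (5, 7)

/-- Paillier encryption of `m` under the public key `N` with randomizer `r`. -/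
def turEnc (N m : ℕ) (r : (ZMod N)ˣ) : ℕ := (1 + N) ^ m * r.val.val ^ N % N ^ 2

/-- Re-encryption: multiplication by an encryption of `0`. -/
def turReEnc (N C : ℕ) (r : (ZMod N)ˣ) : ℕ := C * turEnc N 0 r % N ^ 2

/-- A two-step decryption procedure for Paillier: a randomized derivation of two partial
decryption keys of polynomial length from the master secret key, partial decryption, and final
decryption with the complementary key. -/
structure KeySplit where
  keyGen : ∀ _n _p _q : ℕ, PMF (Server → ℕ)
  pDec : ∀ _N _C _pdk : ℕ, ℕ
  dec : ∀ _N _C _pdk : ℕ, ℕ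
  len : ℕ → ℕ
  len_poly : PolyBounded len
  pdk_size : ∀ n, ∀ x ∈ (turSetup n).support, ∀ d ∈ (keyGen n x.1 x.2).support,
    ∀ s, (d s).size ≤ len n
  correct : ∀ n, ∀ x ∈ (turSetup n).support, ∀ d ∈ (keyGen n x.1 x.2).support,
    ∀ s : Server, ∀ m < x.1 * x.2, ∀ r : (ZMod (x.1 * x.2))ˣ,
      dec (x.1 * x.2) (pDec (x.1 * x.2) (turEnc (x.1 * x.2) m r) (d s)) (d s.other) = m

/-- The linking experiment against the server `c`, who holds the public key and its own partial
decryption key: given encryptions of `m₀` and `m₁` and a re-encryption of one of them, guess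
which one. The outcome is whether the guess is right. -/
noncomputable def linkExp (T : TPF) (F : KeyedFun) (S : KeySplit) (n : ℕ) (c : Server)
    (m₀ m₁ : ℕ) (A : Program) : PMF Bool := do
  let pp ← T.setup n
  let pq ← turSetup n
  let pdk ← S.keyGen n pq.1 pq.2
  let N := pq.1 * pq.2
  let r₀ ← unif (ZMod N)ˣ
  let r₁ ← unif (ZMod N)ˣ
  let r ← unif (ZMod N)ˣ
  let b ← unif Bool
  let C₀ := turEnc N m₀ r₀
  let C₁ := turEnc N m₁ r₁
  let C := turReEnc N (if b then C₁ else C₀) r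
  let b' ← A.out (env T F n pp fun _ => 0) [N, pdk c, C₀, C₁, C]
  return b' == b

/-- Re-encrypted ciphertexts are computationally unlinkable to their original form. -/
def TURUnlinkable (T : TPF) (F : KeyedFun) (S : KeySplit) : Prop :=
  ∀ (c : Server) (m₀ m₁ : ℕ → ℕ), PolyBounded (fun n => (m₀ n).size) →
    PolyBounded (fun n => (m₁ n).size) → ∀ A : Adversary,
      ∃ ε : ℕ → ℝ, Negligible ε ∧
        ∀ n, prob (linkExp T F S n c (m₀ n) (m₁ n) (A.prog n)) ≤ 1 / 2 + ε n

/-! ## Indexes and the shuffle -/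

/-- The two inverted indexes. -/
inductive Kind
  | pref | keyword
  deriving DecidableEq

instance : Fintype Kind := ⟨{.pref, .keyword}, fun k => by cases k <;> simp⟩

/-- The plaintext prefix and keyword indexes, with the bitmaps split into one share per server.
All prefixes and keywords are written as distinct strings. -/
structure PlainIndex where
  objects : ℕ
  size : Kind → ℕ
  word : ∀ k, Fin (size k) → ℕ
  word_injective : Function.Injective fun x : (Σ k, Fin (size k)) => word x.1 x.2
  bitmap : Server → ∀ k, Fin (size k) → Fin objects → Bool

/-- A family of indexes of polynomial size. -/
structure IndexFamily where
  index : ℕ → PlainIndex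
  objects_poly : PolyBounded fun n => (index n).objects
  size_poly : ∀ k, PolyBounded fun n => (index n).size k
  wordLen : ℕ → ℕ
  wordLen_poly : PolyBounded wordLen
  word_size : ∀ n k i, ((index n).word k i).size ≤ wordLen n

/-- An encrypted index entry: label, encrypted bitmap share, tag. -/
structure Entry (T : TPF) (n : ℕ) where
  label : T.G n
  id : ℕ
  tag : Fin (2 ^ n)

def Entry.toList {T : TPF} {n : ℕ} (e : Entry T n) : List ℕ := [T.enc n e.label, e.id, e.tag.val]

/-- The secret shuffle parameter of a server: an exponent for the labels and a key for the
tags. -/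
abbrev ShuffleParam (T : TPF) (n : ℕ) : Type := T.Key n × Fin (2 ^ n)

/-- A server with shuffle parameter `r` refreshes one entry, with randomizer `ρ`. -/
def refresh {T : TPF} (F : KeyedFun) {n : ℕ} (N : ℕ) (r : ShuffleParam T n) (e : Entry T n)
    (ρ : (ZMod N)ˣ) : Entry T n where
  label := T.reEnc e.label r.1
  id := turReEnc N e.id ρ
  tag := F n r.2 e.tag.val

/-- The entry of the freshly built index for the word `x` at server `s`. -/
def buildEntry {T : TPF} (F : KeyedFun) {n : ℕ} (pp : T.Param n) (N : ℕ) (kM : T.Key n)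
    (kT : Fin (2 ^ n)) (s : Server) (x m : ℕ) (ρ : (ZMod N)ˣ) : Entry T n where
  label := T.rnd pp kM x
  id := turEnc N m ρ
  tag := F n kT (Nat.pair s.num x)

/-- The randomness of one entry up to the round under consideration: the encryption, and the
randomizers of both servers in each of the `u` previous shuffle rounds. -/
abbrev History (N u : ℕ) : Type := (ZMod N)ˣ × (Fin u → Server → (ZMod N)ˣ)

/-- The entry stored at `o` after the previous rounds: in each of them, the other server
refreshes it first and `o` second. -/
def currentEntry {T : TPF} (F : KeyedFun) {n : ℕ} (pp : T.Param n) (N : ℕ) (kM : T.Key n)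
    (kT : Fin (2 ^ n)) (r : Server → ShuffleParam T n) (o : Server) (x m : ℕ) {u : ℕ}
    (h : History N u) : Entry T n :=
  (List.ofFn h.2).foldl
    (fun e ρ => refresh F N (r o) (refresh F N (r o.other) e (ρ o.other)) (ρ o))
    (buildEntry F pp N kM kT o x m h.1)

/-- The coins of a server for processing a list: one randomizer per entry and a permutation. -/
abbrev Coins (N l : ℕ) : Type := (Fin l → (ZMod N)ˣ) × Equiv.Perm (Fin l)

/-- A server refreshes all entries of a list and permutes them; position `j` of the result comes
from position `π j`. -/
def pass {T : TPF} (F : KeyedFun) {n : ℕ} (N : ℕ) (r : ShuffleParam T n) {l : ℕ}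
    (w : Coins N l) (L : Fin l → Entry T n) : Fin l → Entry T n :=
  fun j => refresh F N r (L (w.2 j)) (w.1 (w.2 j))

def listEntries {T : TPF} {n l : ℕ} (L : Fin l → Entry T n) : List ℕ :=
  (List.ofFn fun j => (L j).toList).flatten

def listCoins {N l : ℕ} (w : Coins N l) : List ℕ :=
  List.ofFn (fun j => (w.1 j).val.val) ++ List.ofFn fun j => (w.2 j).val

/-- The shuffle experiment against the server `c` on an index that went through `u` shuffle
rounds before.  In the challenge round both servers shuffle the two indexes of both shares.  The
server `c` is given all its keys and coins, and for each share and index the entries before the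
round, the intermediate list, and the final list; the entries before the round are listed in the
order of the plaintext index.
The challenge is about the share stored at `o` and the index `k`: a random one of the entries at
`i₀`, `i₁` is chosen and its final form is shown.  The outcome is whether the program guesses
right. -/
noncomputable def shuffleExp (T : TPF) (F : KeyedFun) (S : KeySplit) (n : ℕ) (I : PlainIndex)
    (u : ℕ) (c o : Server) (k : Kind) (i₀ i₁ : Fin (I.size k)) (A : Program) : PMF Bool := do
  let pp ← T.setup n
  let kM ← T.keyGen n
  let kU ← T.keyGen n
  let pq ← turSetup n
  let pdk ← S.keyGen n pq.1 pq.2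
  let N := pq.1 * pq.2
  let r ← unif (Server → ShuffleParam T n)
  let kT ← unif (Fin (2 ^ n))
  let hist ← unif (Server → ∀ k, Fin (I.size k) → History N u)
  -- `coins s t k`: the coins of server `t` on index `k` of the share of server `s`
  let coins ← unif (Server → Server → ∀ k, Coins N (I.size k))
  let b ← unif Bool
  let pre : Server → ∀ k, Fin (I.size k) → Entry T n := fun s k i =>
    currentEntry F pp N kM kT r s (I.word k i) (Nat.ofBits (I.bitmap s k i)) (hist s k i)
  let mid : Server → ∀ k, Fin (I.size k) → Entry T n := fun s k =>
    pass F N (r s.other) (coins s s.other k) (pre s k)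
  let post : Server → ∀ k, Fin (I.size k) → Entry T n := fun s k =>
    pass F N (r s) (coins s s k) (mid s k)
  let part : Server → Kind → List ℕ := fun s k =>
    listEntries (pre s k) ++ listEntries (mid s k) ++ listEntries (post s k) ++
      listCoins (coins s c k)
  -- the final position of the challenge entry
  let j := (coins o o k).2.symm ((coins o o.other k).2.symm (if b then i₁ else i₀))
  let view : List ℕ :=
    [N, pdk c, (r c).1.val.val, (r c).2.val, (T.recKeyGen kU kM).val.val] ++
      part .cs1 .pref ++ part .cs1 .keyword ++ part .cs2 .pref ++ part .cs2 .keyword ++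
      (pre o k i₀).toList ++ (pre o k i₁).toList ++ (post o k j).toList ++ [j.val]
  let b' ← A.out (env T F n pp fun _ => 0) view
  return b' == b

/-- Shuffle indistinguishability: for either server, every index family, every number of previous
rounds and every pair of entries, no adversary recognizes the origin of the challenge entry
noticeably better than by guessing. -/
def ShuffleIndistinguishable (T : TPF) (F : KeyedFun) (S : KeySplit) : Prop :=
  ∀ (I : IndexFamily) (u : ℕ → ℕ), PolyBounded u →
    ∀ (c o : Server) (k : Kind) (i₀ i₁ : ∀ n, Fin ((I.index n).size k)) (A : Adversary),
      ∃ ε : ℕ → ℝ, Negligible ε ∧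
        ∀ n, prob (shuffleExp T F S n (I.index n) (u n) c o k (i₀ n) (i₁ n) (A.prog n)) ≤
          1 / 2 + ε n

end Brasp

/-!
All entries of a word carry the label `H w ^ k` for a few exponents `k`, so the view of the
corrupted server depends only on the labels before and after the refresh by the honest server,
and by security of the pseudorandom function these are two independent families of random group
elements. The tags of an entry form a chain of values of the tag function of the honest server,
interleaved with that of the corrupted server; since the former is pseudorandom, all values in the
chains are fresh and uniform unless two of its arguments collide, and a collision under the tag
function of the corrupted server would itself contradict pseudorandomness. Unlinkability allows
replacing, for each share, the plaintext of one challenge entry after the refresh by the honest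
server, so that both challenge entries get the same plaintext. In the resulting game exchanging the
two challenge entries is a symmetry of the data after the refresh by the honest server, which its
uniform permutation absorbs. Hence the view is independent of the challenge bit.
-/

namespace Brasp

/-! ## Negligible and polynomially bounded functions -/

theorem Negligible.add {f g : ℕ → ℝ} (hf : Negligible f) (hg : Negligible g) :
    Negligible fun n => f n + g n :=
  Asymptotics.SuperpolynomialDecay.add hf hg

theorem Negligible.mono {f g : ℕ → ℝ} (hg : Negligible g) (h0 : ∀ n, 0 ≤ f n)
    (h : ∀ n, f n ≤ g n) : Negligible f :=
  Asymptotics.SuperpolynomialDecay.trans_abs_le hg fun n => by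
    simpa only [abs_of_nonneg (h0 n)] using (h n).trans (le_abs_self _)

theorem Negligible.abs {f : ℕ → ℝ} (hf : Negligible f) : Negligible fun n => |f n| :=
  Asymptotics.SuperpolynomialDecay.trans_abs_le hf fun n => (abs_abs (f n)).le

theorem Negligible.const_mul {f : ℕ → ℝ} (hf : Negligible f) (c : ℝ) :
    Negligible fun n => c * f n :=
  Asymptotics.SuperpolynomialDecay.const_mul hf c

theorem Negligible.poly_mul {f : ℕ → ℝ} {p : ℕ → ℕ} (hf : Negligible f) (hp : PolyBounded p) :
    Negligible fun n => (p n : ℝ) * f n := by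
  obtain ⟨P, hP⟩ := hp
  have eval_cast : ∀ n : ℕ, (P.map (Nat.castRingHom ℝ)).eval (n : ℝ) = (P.eval n : ℕ) :=
    fun n => by rw [Polynomial.eval_natCast_map]; rfl
  refine Asymptotics.SuperpolynomialDecay.trans_abs_le
    (Asymptotics.SuperpolynomialDecay.polynomial_mul hf (P.map (Nat.castRingHom ℝ))) fun n => ?_
  simp only [abs_mul, Nat.abs_cast, eval_cast]
  gcongr
  exact hP n

theorem negligible_two_pow_inv : Negligible fun n => ((2 : ℝ) ^ n)⁻¹ := fun k => by
  simpa [div_eq_mul_inv] using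
    tendsto_pow_const_div_const_pow_of_one_lt k (one_lt_two : (1 : ℝ) < 2)

theorem PolyBounded.mono {f g : ℕ → ℕ} (hg : PolyBounded g) (h : ∀ n, f n ≤ g n) :
    PolyBounded f :=
  hg.imp fun _ hP n => (h n).trans (hP n)

theorem polyBounded_const (c : ℕ) : PolyBounded fun _ => c :=
  ⟨Polynomial.C c, fun n => by simp⟩

theorem polyBounded_id : PolyBounded fun n => n :=
  ⟨Polynomial.X, fun n => by simp⟩

theorem PolyBounded.add {f g : ℕ → ℕ} (hf : PolyBounded f) (hg : PolyBounded g) :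
    PolyBounded fun n => f n + g n := by
  obtain ⟨P, hP⟩ := hf
  obtain ⟨Q, hQ⟩ := hg
  exact ⟨P + Q, fun n => by simpa using add_le_add (hP n) (hQ n)⟩

theorem PolyBounded.mul {f g : ℕ → ℕ} (hf : PolyBounded f) (hg : PolyBounded g) :
    PolyBounded fun n => f n * g n := by
  obtain ⟨P, hP⟩ := hf
  obtain ⟨Q, hQ⟩ := hg
  exact ⟨P * Q, fun n => by simpa using Nat.mul_le_mul (hP n) (hQ n)⟩

/-! ## Probabilities -/

section Prob

variable {α β ι : Type*}

theorem bind_congr_of_mem_support (p : PMF α) {f g : α → PMF β}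
    (h : ∀ a ∈ p.support, f a = g a) : p.bind f = p.bind g := by
  ext b
  rw [PMF.bind_apply, PMF.bind_apply]
  refine tsum_congr fun a => ?_
  by_cases ha : a ∈ p.support
  · rw [h a ha]
  · simp [(PMF.apply_eq_zero_iff p a).2 ha]

theorem map_congr_of_mem_support (p : PMF α) {f g : α → β} (h : ∀ a ∈ p.support, f a = g a) :
    p.map f = p.map g :=
  bind_congr_of_mem_support p fun a ha => congrArg PMF.pure (h a ha)

theorem prob_nonneg (d : PMF Bool) : 0 ≤ prob d := ENNReal.toReal_nonneg

theorem prob_le_one (d : PMF Bool) : prob d ≤ 1 :=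
  ENNReal.toReal_le_of_le_ofReal zero_le_one (by simpa using d.coe_le_one true)

theorem abs_prob_sub_le_one (d e : PMF Bool) : |prob d - prob e| ≤ 1 :=
  abs_sub_le_iff.2 ⟨by linarith [prob_le_one d, prob_nonneg e],
    by linarith [prob_le_one e, prob_nonneg d]⟩

theorem prob_le_add_iff {d e : PMF Bool} {η : ℝ} (hη : 0 ≤ η) :
    prob d ≤ prob e + η ↔ d true ≤ e true + ENNReal.ofReal η := by
  rw [prob, prob, ← ENNReal.toReal_ofReal hη, ← ENNReal.toReal_add (e.apply_ne_top _)
    ENNReal.ofReal_ne_top, ENNReal.toReal_le_toReal (d.apply_ne_top _) (by simp [e.apply_ne_top]),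
    ENNReal.toReal_ofReal hη]

theorem prob_le_prob_add_prob_iff {d e e' : PMF Bool} :
    prob d ≤ prob e + prob e' ↔ d true ≤ e true + e' true := by
  rw [prob_le_add_iff (prob_nonneg e'), prob, ENNReal.ofReal_toReal (e'.apply_ne_top _)]

theorem prob_map_eq_toOuterMeasure (p : PMF α) (B : α → Bool) :
    prob (p.map B) = (p.toOuterMeasure {a | B a = true}).toReal := by
  rw [prob, ← PMF.toOuterMeasure_apply_singleton, PMF.toOuterMeasure_map_apply]
  rfl

theorem prob_map_not (d : PMF Bool) : prob (d.map not) = 1 - prob d := by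
  have total : (d true).toReal + (d false).toReal = 1 := by
    rw [← ENNReal.toReal_add (d.apply_ne_top _) (d.apply_ne_top _), ← Fintype.sum_bool d,
      ← tsum_fintype (L := .unconditional _), d.tsum_coe, ENNReal.toReal_one]
  have : (d.map not) true = d false := by simp [PMF.map_apply, tsum_fintype]
  rw [prob, prob, this]
  linarith

theorem abs_prob_map_beq_sub (d e : PMF Bool) (b : Bool) :
    |prob (d.map (· == b)) - prob (e.map (· == b))| = |prob d - prob e| := by
  cases b
  · have : (· == false) = not := by decide
    rw [this, prob_map_not, prob_map_not, sub_sub_sub_cancel_left, abs_sub_comm]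
  · have : (· == true) = (id : Bool → Bool) := by decide
    rw [this, PMF.map_id, PMF.map_id]

theorem prob_bind (p : PMF α) (f : α → PMF Bool) :
    prob (p.bind f) = ∑' a, (p a).toReal * prob (f a) := by
  rw [prob, PMF.bind_apply, ENNReal.tsum_toReal_eq fun a =>
    ENNReal.mul_ne_top (p.apply_ne_top a) ((f a).apply_ne_top true)]
  simp only [ENNReal.toReal_mul, prob]

theorem prob_bind_le_add (p : PMF α) (f g : α → PMF Bool) {η : ℝ} (hη : 0 ≤ η)
    (h : ∀ a, prob (f a) ≤ prob (g a) + η) : prob (p.bind f) ≤ prob (p.bind g) + η := by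
  simp only [prob_le_add_iff hη, PMF.bind_apply] at h ⊢
  calc ∑' a, p a * f a true ≤ ∑' a, p a * (g a true + ENNReal.ofReal η) := by gcongr; exact h _
    _ = _ := by simp only [mul_add, ENNReal.tsum_add, ENNReal.tsum_mul_right, p.tsum_coe, one_mul]

theorem prob_bind_le_prob_bind_add (p : PMF α) (f g h : α → PMF Bool)
    (H : ∀ a, prob (f a) ≤ prob (g a) + prob (h a)) :
    prob (p.bind f) ≤ prob (p.bind g) + prob (p.bind h) := by
  simp only [prob_le_prob_add_prob_iff, PMF.bind_apply, ← ENNReal.tsum_add, ← mul_add] at H ⊢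
  gcongr
  exact H _

theorem abs_prob_bind_sub_le (p : PMF α) (f g h : α → PMF Bool)
    (H : ∀ a, |prob (f a) - prob (g a)| ≤ prob (h a)) :
    |prob (p.bind f) - prob (p.bind g)| ≤ prob (p.bind h) := by
  simp only [abs_sub_le_iff, sub_le_iff_le_add'] at H ⊢
  exact ⟨prob_bind_le_prob_bind_add p f g h fun a => (H a).1,
    prob_bind_le_prob_bind_add p g f h fun a => (H a).2⟩

theorem prob_pure_eq_one : prob (PMF.pure true) = 1 := by simp [prob]

theorem prob_bind_le_prob_map_add (p : PMF α) (f : α → PMF Bool) (B : α → Bool) {η : ℝ}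
    (hη : 0 ≤ η) (h : ∀ a, B a = false → prob (f a) ≤ η) :
    prob (p.bind f) ≤ prob (p.map B) + η := by
  rw [← PMF.bind_pure_comp]
  refine prob_bind_le_add p f _ hη fun a => ?_
  cases hB : B a with
  | false => exact (h a hB).trans (le_add_of_nonneg_left (prob_nonneg _))
  | true =>
    rw [Function.comp_apply, hB, prob_pure_eq_one]
    linarith [prob_le_one (f a)]

theorem prob_bind_le (p : PMF α) (f : α → PMF Bool) {η : ℝ} (h : ∀ a, prob (f a) ≤ η) :
    prob (p.bind f) ≤ η := by
  obtain ⟨a₀, -⟩ := p.support_nonempty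
  have never : prob (p.map fun _ => false) = 0 := by simp [prob]
  simpa only [never, zero_add] using prob_bind_le_prob_map_add p f (fun _ => false)
    ((prob_nonneg _).trans (h a₀)) fun a _ => h a

theorem prob_map_exists_le [Fintype ι] (p : PMF α) (B : α → Bool) (E : ι → α → Bool)
    (h : ∀ a, B a = true → ∃ i, E i a = true) :
    prob (p.map B) ≤ ∑ i, prob (p.map (E i)) := by
  have ne_top : ∀ s, p.toOuterMeasure s ≠ ⊤ := fun s =>
    ne_top_of_le_ne_top ENNReal.one_ne_top (p.toOuterMeasure_apply s ▸
      (ENNReal.tsum_le_tsum (Set.indicator_le_self s p)).trans_eq p.tsum_coe)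
  simp only [prob_map_eq_toOuterMeasure]
  rw [← ENNReal.toReal_sum fun i _ => ne_top _]
  refine ENNReal.toReal_mono (ENNReal.sum_ne_top.2 fun i _ => ne_top _)
    ((MeasureTheory.measure_mono fun a ha => ?_).trans
      (MeasureTheory.measure_iUnion_fintype_le p.toOuterMeasure fun i => {a | E i a = true}))
  simpa using h a ha

theorem prob_bind_le_prob_bind_add_of_eq_off {p q : PMF α} {B : α → Bool}
    (h : ∀ a, B a = false → p a = q a) (f : α → PMF Bool) :
    prob (p.bind f) ≤ prob (q.bind f) + prob (p.map B) := by
  rw [prob_le_prob_add_prob_iff, ← PMF.bind_pure_comp]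
  simp only [PMF.bind_apply, ← ENNReal.tsum_add]
  refine ENNReal.tsum_le_tsum fun a => ?_
  cases hB : B a with
  | false => exact h a hB ▸ le_self_add
  | true =>
    simp only [Function.comp_apply, hB, PMF.pure_apply, if_true]
    exact (mul_le_mul_right ((f a).coe_le_one true) _).trans le_add_self

theorem prob_map_eq_of_eq_off {p q : PMF α} {B : α → Bool} (h : ∀ a, B a = false → p a = q a) :
    prob (p.map B) = prob (q.map B) := by
  have : (p.map B) false = (q.map B) false := by
    simp only [PMF.map_apply]
    refine tsum_congr fun a => ?_
    split_ifs with hB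
    exacts [h a hB.symm, rfl]
  have : prob ((p.map B).map not) = prob ((q.map B).map not) := by
    rw [prob, prob, PMF.map_apply, PMF.map_apply, tsum_fintype, tsum_fintype]
    simp only [Fintype.sum_bool, Bool.not_true, Bool.not_false, this, reduceCtorEq, if_false]
  linarith [prob_map_not (p.map B), prob_map_not (q.map B)]

theorem abs_prob_bind_sub_le_of_eq_off {p q : PMF α} {B : α → Bool}
    (h : ∀ a, B a = false → p a = q a) (f : α → PMF Bool) :
    |prob (p.bind f) - prob (q.bind f)| ≤ prob (q.map B) := by
  rw [abs_sub_le_iff, sub_le_iff_le_add', sub_le_iff_le_add']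
  exact ⟨prob_map_eq_of_eq_off h ▸ prob_bind_le_prob_bind_add_of_eq_off h f,
    prob_bind_le_prob_bind_add_of_eq_off (fun a ha => (h a ha).symm) f⟩

theorem summable_toReal_mul (p : PMF α) (u : α → ℝ) (h : ∀ a, |u a| ≤ 1) :
    Summable fun a => (p a).toReal * u a :=
  .of_norm_bounded (ENNReal.summable_toReal p.tsum_coe_ne_top) fun a => by
    rw [norm_mul, Real.norm_of_nonneg ENNReal.toReal_nonneg]
    exact mul_le_of_le_one_right ENNReal.toReal_nonneg (h a)

theorem abs_prob_bind_sub_le_tsum (p : PMF α) (f g : α → PMF Bool) :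
    |prob (p.bind f) - prob (p.bind g)| ≤ ∑' a, (p a).toReal * |prob (f a) - prob (g a)| := by
  have summable (f : α → PMF Bool) : Summable fun a => (p a).toReal * prob (f a) :=
    summable_toReal_mul p _ fun a => by
      simpa only [abs_of_nonneg (prob_nonneg _)] using prob_le_one (f a)
  have abs_term (a : α) : ‖(p a).toReal * (prob (f a) - prob (g a))‖ =
      (p a).toReal * |prob (f a) - prob (g a)| := by
    rw [norm_mul, Real.norm_of_nonneg ENNReal.toReal_nonneg, Real.norm_eq_abs]
  rw [prob_bind, prob_bind, ← (summable f).tsum_sub (summable g)]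
  simp only [← mul_sub, ← abs_term]
  exact norm_tsum_le_tsum_norm ((summable_toReal_mul p _ fun _ => by
    simpa only [abs_abs] using abs_prob_sub_le_one _ _).congr fun a => (abs_term a).symm)

theorem exists_mem_support_abs_prob_sub_le (p : PMF α) (f g : α → PMF Bool) :
    ∃ a ∈ p.support, |prob (p.bind f) - prob (p.bind g)| ≤ |prob (f a) - prob (g a)| := by
  by_contra! H
  set D := |prob (p.bind f) - prob (p.bind g)|
  obtain ⟨a₀, ha₀⟩ := p.support_nonempty
  have average : ∑' a, (p a).toReal * |prob (f a) - prob (g a)| < ∑' a, (p a).toReal * D := by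
    refine Summable.tsum_lt_tsum (i := a₀) (fun a => ?_)
      (mul_lt_mul_of_pos_left (H a₀ ha₀) (ENNReal.toReal_pos ha₀ (p.apply_ne_top a₀)))
      (summable_toReal_mul p _ fun _ => by simpa only [abs_abs] using abs_prob_sub_le_one _ _)
      (summable_toReal_mul p _ fun _ => by simpa only [D, abs_abs] using abs_prob_sub_le_one _ _)
    by_cases ha : a ∈ p.support
    · exact mul_le_mul_of_nonneg_left (H a ha).le ENNReal.toReal_nonneg
    · simp [(PMF.apply_eq_zero_iff p a).2 ha]
  rw [tsum_mul_right, ← ENNReal.tsum_toReal_eq p.apply_ne_top, p.tsum_coe, ENNReal.toReal_one,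
    one_mul] at average
  exact absurd (abs_prob_bind_sub_le_tsum p f g) (not_le.2 average)

end Prob

/-- Two families of experiments are indistinguishable if their probabilities of success differ
negligibly. -/
def Indist (d e : ℕ → PMF Bool) : Prop := Negligible fun n => |prob (d n) - prob (e n)|

theorem Indist.trans {d e f : ℕ → PMF Bool} (h : Indist d e) (h' : Indist e f) : Indist d f :=
  (Negligible.add h h').mono (fun _ => abs_nonneg _) fun _ => abs_sub_le _ _ _

/-! ## Uniform distributions -/

section Unif

variable {α β ι R : Type} {γ : Type*} [Finite α] [Nonempty α] [Finite β] [Nonempty β] [Finite ι]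
  [Finite R] [Nonempty R]

theorem unif_apply (a : α) : unif α a = (Nat.card α : ENNReal)⁻¹ := by
  let := Fintype.ofFinite α
  rw [unif, PMF.uniformOfFintype_apply, Nat.card_eq_fintype_card]

theorem eq_unif_of_const (p : PMF α) (h : ∀ a b, p a = p b) : p = unif α := by
  let := Fintype.ofFinite α
  ext a
  have total := p.tsum_coe
  rw [tsum_fintype, Finset.sum_congr rfl fun b _ => h b a, Finset.sum_const, nsmul_eq_mul,
    Finset.card_univ] at total
  rw [unif_apply, Nat.card_eq_fintype_card]
  exact ENNReal.eq_inv_of_mul_eq_one_left (by rwa [mul_comm])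

theorem unif_map_of_transitive (f : α → β)
    (h : ∀ b b', ∃ E : Equiv.Perm α, ∀ a, f (E a) = b' ↔ f a = b) :
    (unif α).map f = unif β := by
  classical
  refine eq_unif_of_const _ fun b b' => ?_
  obtain ⟨E, hE⟩ := h b b'
  rw [PMF.map_apply, PMF.map_apply, ← E.tsum_eq (fun a => if b' = f a then unif α a else 0)]
  simp only [unif_apply, eq_comm (a := b), eq_comm (a := b'), hE]

theorem unif_map_equiv (e : α ≃ β) : (unif α).map e = unif β := by
  classical
  refine unif_map_of_transitive _ fun b b' => ⟨Equiv.swap (e.symm b) (e.symm b'), fun a => ?_⟩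
  rw [← Equiv.eq_symm_apply, ← Equiv.eq_symm_apply, Equiv.symm_swap, Equiv.swap_apply_right,
    ← Equiv.eq_symm_apply]

theorem unif_map_hom {G H : Type} [Group G] [Group H] [Finite G] [Finite H] (f : G →* H)
    (hf : Function.Surjective f) : (unif G).map f = unif H := by
  refine unif_map_of_transitive _ fun b b' => ?_
  obtain ⟨g, hg⟩ := hf (b' * b⁻¹)
  refine ⟨Equiv.mulLeft g, fun a => ?_⟩
  rw [Equiv.coe_mulLeft, map_mul, hg, mul_assoc, mul_eq_left, inv_mul_eq_one, eq_comm]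

theorem unif_map_comp {D : Type} [Finite D] (i : ι → D) (hi : Function.Injective i) :
    (unif (D → R)).map (fun g q => g (i q)) = unif (ι → R) := by
  classical
  refine unif_map_of_transitive _ fun b b' => ?_
  let τ : D → Equiv.Perm R := Function.extend i (fun q => Equiv.swap (b q) (b' q)) 1
  refine ⟨Equiv.piCongrRight τ, fun a => ?_⟩
  rw [funext_iff, funext_iff]
  refine forall_congr' fun q => ?_
  change τ (i q) (a (i q)) = b' q ↔ _
  rw [show τ (i q) = _ from hi.extend_apply _ _ q, ← Equiv.eq_symm_apply, Equiv.symm_swap,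
    Equiv.swap_apply_right]

theorem unif_bind_of_map {g : α → β} (h : (unif α).map g = unif β) (f : β → PMF γ) :
    ((unif α).bind fun a => f (g a)) = (unif β).bind f := by
  rw [← h, PMF.bind_map]; rfl

theorem unif_bind_equiv (e : α ≃ β) (f : β → PMF γ) :
    ((unif α).bind fun a => f (e a)) = (unif β).bind f :=
  unif_bind_of_map (unif_map_equiv e) f

theorem unif_prod (α β : Type) [Finite α] [Nonempty α] [Finite β] [Nonempty β] :
    unif (α × β) = (unif α).bind fun a => (unif β).map (Prod.mk a) := by
  have joint : ∀ x : α × β, ((unif α).bind fun a => (unif β).map (Prod.mk a)) x =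
      (Nat.card α : ENNReal)⁻¹ * (Nat.card β : ENNReal)⁻¹ := by
    rintro ⟨a, b⟩
    rw [PMF.bind_apply, tsum_eq_single a, PMF.map_apply, tsum_eq_single b]
    · simp [unif_apply]
    · intro b' hb'; simp [hb'.symm]
    · intro a' ha'
      rw [PMF.map_apply]
      simp [ha'.symm]
  exact (eq_unif_of_const _ fun x y => by rw [joint, joint]).symm

theorem unif_prod_bind (f : α × β → PMF γ) :
    (unif (α × β)).bind f = (unif α).bind fun a => (unif β).bind fun b => f (a, b) := by
  simp only [unif_prod, PMF.bind_bind, PMF.bind_map]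
  rfl

theorem unif_prod_map {γ : Type} (f : α × β → γ) :
    (unif (α × β)).map f = (unif α).bind fun a => (unif β).map fun b => f (a, b) :=
  unif_prod_bind _

theorem unif_map_pair {i j : ι} (hij : i ≠ j) :
    (unif (ι → R)).map (fun g => (g i, g j)) = unif (R × R) := by
  let pair : Bool → ι := fun b => if b then j else i
  have pair_injective : Function.Injective pair := by
    intro b b' h
    cases b <;> cases b' <;> simp_all [pair, eq_comm]
  rw [← unif_map_equiv (Equiv.boolArrowEquivProd R), ← unif_map_comp pair pair_injective,
    PMF.map_comp]
  rfl

theorem unif_bind_update [DecidableEq ι] (i : ι) (f : (ι → R) → PMF γ) :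
    ((unif R).bind fun r => (unif (ι → R)).bind fun g => f (Function.update g i r)) =
      (unif (ι → R)).bind f := by
  rw [← unif_prod_bind (fun x : R × (ι → R) => f (Function.update x.2 i x.1))]
  refine unif_bind_of_map (g := fun x : R × (ι → R) => Function.update x.2 i x.1) ?_ f
  classical
  refine unif_map_of_transitive _ fun b b' => ⟨(Equiv.swap (b i) (b' i)).prodCongr
    (Equiv.piCongrRight fun j => Equiv.swap (b j) (b' j)), fun a => ?_⟩
  rw [funext_iff, funext_iff]
  refine forall_congr' fun j => ?_
  obtain rfl | hj := eq_or_ne j i <;>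
    simp [← Equiv.eq_symm_apply, *]

theorem prob_unif_bool_bind (f : Bool → PMF Bool) :
    prob ((unif Bool).bind f) = (prob (f true) + prob (f false)) / 2 := by
  simp only [prob_bind, tsum_fintype, Fintype.sum_bool, unif_apply, ENNReal.toReal_inv]
  norm_num
  ring

theorem prob_unif_bool_bind_map_beq (f : Bool → PMF Bool) :
    prob ((unif Bool).bind fun b => (f b).map (· == b)) =
      (prob (f true) + (1 - prob (f false))) / 2 := by
  have beq_true : (fun x : Bool => x == true) = id := by funext x; cases x <;> rfl
  have beq_false : (fun x : Bool => x == false) = not := by funext x; cases x <;> rfl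
  rw [prob_unif_bool_bind, beq_true, beq_false, prob_map_not, PMF.map_id]

theorem prob_unif_map_eq [DecidableEq α] (d : α) :
    prob ((unif α).map fun a => decide (a = d)) = (Nat.card α : ℝ)⁻¹ := by
  rw [prob_map_eq_toOuterMeasure]
  simp [unif_apply, PMF.toOuterMeasure_apply_singleton]

end Unif

/-! ## Runs and costs of programs -/

theorem Program.run_append (E : Env) (A B : Program) (regs : List ℕ) :
    Program.run E (A ++ B) regs = (Program.run E A regs).bind (Program.run E B) := by
  induction A generalizing regs with
  | nil => simp [Program.run]
  | cons i A ih => simp [Program.run, ih, PMF.bind_bind]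

theorem Program.run_singleton (E : Env) (i : Instr) (regs : List ℕ) :
    Program.run E [i] regs = (i.eval E regs).bind fun v => PMF.pure (regs ++ [v]) := rfl

theorem Program.cost_append (A B : Program) :
    Program.cost (A ++ B) = Program.cost A + Program.cost B := by
  simp [Program.cost]

theorem Program.cost_singleton (i : Instr) : Program.cost [i] = i.cost := by
  simp [Program.cost]

theorem reg_append_left {l l' : List ℕ} {i : ℕ} (h : i < l.length) :
    reg (l ++ l') i = reg l i := by
  simp [reg, List.getElem?_append_left h]

theorem reg_append_right (l l' : List ℕ) (i : ℕ) : reg (l ++ l') (l.length + i) = reg l' i := by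
  simp [reg, List.getElem?_append_right]

theorem reg_of_length_le {l : List ℕ} {i : ℕ} (h : l.length ≤ i) : reg l i = 0 := by
  simp [reg, h]

theorem ne_nil_of_mem_support_run (E : Env) (A : Program) {regs : List ℕ} (h : regs ≠ [])
    {l : List ℕ} (hl : l ∈ (Program.run E A regs).support) : l ≠ [] := by
  induction A generalizing regs with
  | nil =>
    rw [Program.run, PMF.mem_support_pure_iff] at hl
    exact hl ▸ h
  | cons i A ih =>
    rw [Program.run, PMF.mem_support_bind_iff] at hl
    obtain ⟨v, -, hv⟩ := hl
    exact ih (by simp) hv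

/-! ## Programs that evaluate expressions -/

/-- Arithmetic expressions in the registers, from which programs are assembled. -/
inductive Expr
  | const (c : ℕ)
  | reg (i : ℕ)
  | arith (op : Arith) (a b : Expr)
  | powMod (a b m : Expr)
  | call (p : Proc) (a b : Expr)

namespace Expr

/-- The value of an expression computed with instructions of width `W`. -/
def eval (W : ℕ) (E : Env) (regs : List ℕ) : Expr → ℕ
  | const c => c
  | reg i => Brasp.reg regs i % 2 ^ W
  | arith op a b => op.eval (a.eval W E regs) (b.eval W E regs) % 2 ^ W
  | powMod a b m => a.eval W E regs ^ b.eval W E regs % m.eval W E regs % 2 ^ W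
  | call p a b => E p (a.eval W E regs) (b.eval W E regs) % 2 ^ W

/-- The values of all subexpressions in postorder: these are the registers that the compiled
expression writes. -/
def trace (W : ℕ) (E : Env) (regs : List ℕ) : Expr → List ℕ
  | const c => [c]
  | reg i => [(reg i).eval W E regs]
  | arith op a b => a.trace W E regs ++ b.trace W E regs ++ [(arith op a b).eval W E regs]
  | powMod a b m => a.trace W E regs ++ b.trace W E regs ++ m.trace W E regs ++
      [(powMod a b m).eval W E regs]
  | call p a b => a.trace W E regs ++ b.trace W E regs ++ [(call p a b).eval W E regs]

/-- The number of instructions of the compiled expression. -/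
def len : Expr → ℕ
  | const _ => 1
  | reg _ => 1
  | arith _ a b => a.len + b.len + 1
  | powMod a b m => a.len + b.len + m.len + 1
  | call _ a b => a.len + b.len + 1

/-- The cost of the compiled expression. -/
def cost (W : ℕ) : Expr → ℕ
  | const c => 1 + c.size
  | reg _ => 1 + W
  | arith _ a b => a.cost W + b.cost W + (1 + W)
  | powMod a b m => a.cost W + b.cost W + m.cost W + (1 + W)
  | call _ a b => a.cost W + b.cost W + (1 + W)

/-- All registers of the expression are among the first `B`. -/
def Fits (B : ℕ) : Expr → Prop
  | const _ => True
  | reg i => i < B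
  | arith _ a b => a.Fits B ∧ b.Fits B
  | powMod a b m => a.Fits B ∧ b.Fits B ∧ m.Fits B
  | call _ a b => a.Fits B ∧ b.Fits B

/-- The compiled expression, when `t` registers are already in use; the value is put into the
last register.  A register is copied by adding to it the register `t`, which is still unwritten
and therefore contains `0`. -/
def compile (W : ℕ) : Expr → ℕ → Program
  | const c, _ => [.const c]
  | reg i, t => [.arith .add W i t]
  | arith op a b, t => a.compile W t ++ b.compile W (t + a.len) ++
      [.arith op W (t + a.len - 1) (t + a.len + b.len - 1)]
  | powMod a b m, t => a.compile W t ++ b.compile W (t + a.len) ++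
      m.compile W (t + a.len + b.len) ++
      [.powMod W (t + a.len - 1) (t + a.len + b.len - 1) (t + a.len + b.len + m.len - 1)]
  | call p a b, t => a.compile W t ++ b.compile W (t + a.len) ++
      [.call p W (t + a.len - 1) (t + a.len + b.len - 1)]

variable (W : ℕ) (E : Env) (base : List ℕ)

theorem len_pos (e : Expr) : 0 < e.len := by cases e <;> simp [len]

theorem length_trace (e : Expr) : (e.trace W E base).length = e.len := by
  induction e <;> simp [trace, len, *] <;> omega

theorem exists_trace_eq (e : Expr) : ∃ l, e.trace W E base = l ++ [e.eval W E base] := by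
  cases e with
  | const | reg => exact ⟨[], rfl⟩
  | _ => exact ⟨_, rfl⟩

theorem reg_append_trace (e : Expr) {l l' : List ℕ} {i : ℕ} (hi : i + 1 = l.length + e.len) :
    Brasp.reg (l ++ (e.trace W E base ++ l')) i = e.eval W E base := by
  obtain ⟨t, ht⟩ := e.exists_trace_eq W E base
  have hlen := e.length_trace W E base
  rw [ht, List.length_append, List.length_singleton] at hlen
  obtain rfl : i = (l ++ t).length + 0 := by
    rw [List.length_append]
    omega
  rw [ht, List.append_assoc, ← List.append_assoc, reg_append_right]
  rfl

theorem reg_append_trace_append_trace (a b : Expr) {s : List ℕ} {t : ℕ}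
    (ht : t = base.length + s.length) :
    Brasp.reg (base ++ (s ++ (a.trace W E base ++ b.trace W E base))) (t + a.len - 1) =
        a.eval W E base ∧
      Brasp.reg (base ++ (s ++ (a.trace W E base ++ b.trace W E base))) (t + a.len + b.len - 1) =
        b.eval W E base := by
  have ha := reg_append_trace W E base a (l := base ++ s) (l' := b.trace W E base)
    (i := t + a.len - 1) (by have := a.len_pos; simp; omega)
  have hb := reg_append_trace W E base b (l := base ++ (s ++ a.trace W E base)) (l' := [])
    (i := t + a.len + b.len - 1) (by have := b.len_pos; simp [length_trace]; omega)
  simp only [List.append_assoc, List.append_nil] at ha hb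
  exact ⟨ha, hb⟩

theorem run_compile {e : Expr} (he : e.Fits base.length) {s : List ℕ} {t : ℕ}
    (ht : t = base.length + s.length) :
    Program.run E (e.compile W t) (base ++ s) = PMF.pure (base ++ (s ++ e.trace W E base)) := by
  induction e generalizing s t with
  | const c => simp [compile, Program.run, Instr.eval, trace]
  | reg i =>
    have hs : Brasp.reg (base ++ s) t = 0 := reg_of_length_le (by simp [ht])
    simp [compile, Program.run, Instr.eval, trace, eval, Arith.eval, hs,
      reg_append_left (show i < base.length from he)]
  | arith op a b iha ihb =>
    rw [compile, Program.run_append, Program.run_append, iha he.1 ht, PMF.pure_bind,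
      ihb he.2 (by simp [length_trace]; omega), PMF.pure_bind, Program.run_singleton]
    obtain ⟨ha, hb⟩ := reg_append_trace_append_trace W E base a b ht
    simp [Instr.eval, trace, eval, ha, hb]
  | powMod a b m iha ihb ihm =>
    rw [compile, Program.run_append, Program.run_append, Program.run_append, iha he.1 ht,
      PMF.pure_bind, ihb he.2.1 (by simp [length_trace]; omega), PMF.pure_bind,
      ihm he.2.2 (by simp [length_trace]; omega), PMF.pure_bind, Program.run_singleton]
    have ha := reg_append_trace W E base a (l := base ++ s)
      (l' := b.trace W E base ++ m.trace W E base) (i := t + a.len - 1)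
      (by have := a.len_pos; simp; omega)
    have hb := reg_append_trace W E base b (l := base ++ (s ++ a.trace W E base))
      (l' := m.trace W E base) (i := t + a.len + b.len - 1)
      (by have := b.len_pos; simp [length_trace]; omega)
    have hm := reg_append_trace W E base m
      (l := base ++ (s ++ (a.trace W E base ++ b.trace W E base))) (l' := [])
      (i := t + a.len + b.len + m.len - 1) (by have := m.len_pos; simp [length_trace]; omega)
    simp only [List.append_assoc, List.append_nil] at ha hb hm
    simp [Instr.eval, trace, eval, ha, hb, hm]
  | call p a b iha ihb =>
    rw [compile, Program.run_append, Program.run_append, iha he.1 ht, PMF.pure_bind,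
      ihb he.2 (by simp [length_trace]; omega), PMF.pure_bind, Program.run_singleton]
    obtain ⟨ha, hb⟩ := reg_append_trace_append_trace W E base a b ht
    simp [Instr.eval, trace, eval, ha, hb]

theorem cost_compile (e : Expr) (t : ℕ) : (e.compile W t).cost = e.cost W := by
  induction e generalizing t with
  | const | reg => simp [compile, cost, Program.cost, Instr.cost]
  | _ => simp [compile, cost, Program.cost_append, Program.cost_singleton, Instr.cost, add_assoc, *]

end Expr

/-- The program that evaluates a list of expressions, when `t` registers are already in use. -/
def compileList (W : ℕ) : List Expr → ℕ → Program
  | [], _ => []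
  | e :: es, t => e.compile W t ++ compileList W es (t + e.len)

/-- The registers into which `compileList` puts the values of the expressions. -/
def places : List Expr → ℕ → List ℕ
  | [], _ => []
  | e :: es, t => (t + e.len - 1) :: places es (t + e.len)

/-- The number of instructions of `compileList`. -/
def lenList (es : List Expr) : ℕ := (es.map Expr.len).sum

/-- The program that copies the given registers to the end, when `t` registers are in use. -/
def copies (W : ℕ) : List ℕ → ℕ → Program
  | [], _ => []
  | p :: ps, t => .arith .add W p t :: copies W ps (t + 1)

section compileList

variable (W : ℕ) (E : Env) {base : List ℕ}

theorem length_places (es : List Expr) (t : ℕ) : (places es t).length = es.length := by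
  induction es generalizing t <;> simp [places, *]

theorem lt_of_mem_places {es : List Expr} {t p : ℕ} (h : p ∈ places es t) :
    p < t + lenList es := by
  induction es generalizing t with
  | nil => cases h
  | cons e es ih =>
    have := e.len_pos
    rw [lenList, List.map_cons, List.sum_cons]
    rcases List.mem_cons.1 h with rfl | h
    · omega
    · have := ih h
      rw [lenList] at this
      omega

theorem run_compileList {es : List Expr} (hes : ∀ e ∈ es, e.Fits base.length) {s : List ℕ}
    {t : ℕ} (ht : t = base.length + s.length) :
    Program.run E (compileList W es t) (base ++ s) =
      PMF.pure (base ++ (s ++ es.flatMap (Expr.trace W E base))) := by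
  induction es generalizing s t with
  | nil => simp [compileList, Program.run]
  | cons e es ih =>
    rw [compileList, Program.run_append, Expr.run_compile W E base (hes e (by simp)) ht,
      PMF.pure_bind, ih (fun e he => hes e (by simp [he]))
        (by rw [List.length_append, Expr.length_trace]; omega),
      List.flatMap_cons, List.append_assoc]

theorem map_reg_places (es : List Expr) (l : List ℕ) :
    (places es l.length).map (reg (l ++ es.flatMap (Expr.trace W E base))) =
      es.map (Expr.eval W E base) := by
  induction es generalizing l with
  | nil => rfl
  | cons e es ih =>
    have tail := ih (l ++ e.trace W E base)
    rw [List.length_append, Expr.length_trace, List.append_assoc] at tail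
    rw [places, List.map_cons, List.map_cons, List.flatMap_cons, tail, Expr.reg_append_trace]
    have := e.len_pos
    omega

theorem run_copies {ps regs : List ℕ} (hps : ∀ p ∈ ps, p < regs.length) {s : List ℕ} {t : ℕ}
    (ht : t = regs.length + s.length) :
    Program.run E (copies W ps t) (regs ++ s) =
      PMF.pure (regs ++ (s ++ ps.map fun p => reg regs p % 2 ^ W)) := by
  induction ps generalizing s t with
  | nil => simp [copies, Program.run]
  | cons p ps ih =>
    simp only [copies, Program.run, Instr.eval, PMF.pure_bind, Arith.eval]
    rw [reg_append_left (hps p (by simp)), reg_of_length_le (l := regs ++ s) (by simp [ht]),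
      add_zero, List.append_assoc, ih (fun p hp => hps p (by simp [hp]))
        (by rw [List.length_append, List.length_singleton]; omega)]
    simp only [List.append_assoc, List.map_cons, List.singleton_append]

theorem cost_compileList (es : List Expr) (t : ℕ) :
    (compileList W es t).cost = (es.map (Expr.cost W)).sum := by
  induction es generalizing t with
  | nil => rfl
  | cons e es ih => simp [compileList, Program.cost_append, ih, Expr.cost_compile]

theorem cost_copies (ps : List ℕ) (t : ℕ) : (copies W ps t).cost = ps.length * (1 + W) := by
  induction ps generalizing t with
  | nil => simp [copies, Program.cost]
  | cons p ps ih =>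
    have step : (copies W (p :: ps) t).cost = (1 + W) + (copies W ps (t + 1)).cost := rfl
    rw [step, ih, List.length_cons]
    ring

end compileList

/-! ## Running a program on the values of expressions -/

/-- Move the registers of an instruction by `d`, and replace calls of the challenge oracle by the
constant `0`. -/
def Instr.shift (d : ℕ) : Instr → Instr
  | .const c => .const c
  | .arith op w i j => .arith op w (d + i) (d + j)
  | .powMod w i j k => .powMod w (d + i) (d + j) (d + k)
  | .sample w i => .sample w (d + i)
  | .sampleUnit w i => .sampleUnit w (d + i)
  | .call .chal _ _ _ => .const 0
  | .call p w i j => .call p w (d + i) (d + j)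

/-- The environment in which the challenge oracle always answers `0`. -/
def silence (E : Env) : Env
  | .chal, _, _ => 0
  | p, x, y => E p x y

theorem silence_env (T : TPF) (F : KeyedFun) (n : ℕ) (pp : T.Param n) (chal : ℕ → ℕ) :
    silence (env T F n pp chal) = env T F n pp fun _ => 0 := by
  funext p x y
  cases p <;> rfl

theorem Instr.eval_shift (E : Env) (s regs : List ℕ) (i : Instr) :
    (i.shift s.length).eval E (s ++ regs) = i.eval (silence E) regs := by
  cases i with
  | const c => rfl
  | arith op w i j => simp only [Instr.shift, Instr.eval, reg_append_right]
  | powMod w i j k => simp only [Instr.shift, Instr.eval, reg_append_right]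
  | sample w i =>
    exact congrArg (fun x => (unif (Fin (x - 1 + 1))).map fun z => z.val % 2 ^ w)
      (reg_append_right s regs i)
  | sampleUnit w i =>
    exact congrArg (fun x => (unif (ZMod x)ˣ).map fun z => z.val.val % 2 ^ w)
      (reg_append_right s regs i)
  | call p w i j =>
    cases p <;> simp only [Instr.shift, Instr.eval, reg_append_right, silence, Nat.zero_mod]

theorem Instr.cost_shift_le (d : ℕ) (i : Instr) : (i.shift d).cost ≤ i.cost := by
  cases i with
  | call p w i j => cases p <;> simp [Instr.shift, Instr.cost]
  | _ => simp [Instr.shift, Instr.cost]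

theorem run_map_shift (E : Env) (A : Program) (s regs : List ℕ) :
    Program.run E (A.map (Instr.shift s.length)) (s ++ regs) =
      (Program.run (silence E) A regs).map (s ++ ·) := by
  induction A generalizing regs with
  | nil => simp [Program.run, PMF.pure_map]
  | cons i A ih =>
    simp only [List.map_cons, Program.run, Instr.eval_shift, PMF.map_bind, List.append_assoc, ih]

theorem cost_map_shift_le (A : Program) (d : ℕ) :
    Program.cost (A.map (Instr.shift d)) ≤ A.cost := by
  rw [Program.cost, Program.cost, List.map_map]
  exact List.sum_le_sum fun i _ => i.cost_shift_le d

/-- The program that evaluates expressions in the first `t` registers and runs `A` on the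
values. -/
def simProg (W t : ℕ) (es : List Expr) (A : Program) : Program :=
  compileList W es t ++ copies W (places es t) (t + lenList es) ++
    A.map (Instr.shift (t + lenList es))

theorem out_simProg (W : ℕ) (E : Env) {base : List ℕ} {es : List Expr} (A : Program)
    (hes : ∀ e ∈ es, e.Fits base.length) (hne : es ≠ []) :
    (simProg W base.length es A).out E base =
      A.out (silence E) (es.map fun e => e.eval W E base % 2 ^ W) := by
  set regs := base ++ es.flatMap (Expr.trace W E base) with hregs
  have length_regs : regs.length = base.length + lenList es := by
    simp [hregs, lenList, Expr.length_trace]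
  have values : (places es base.length).map (fun p => reg regs p % 2 ^ W) =
      es.map fun e => e.eval W E base % 2 ^ W := by
    have := congrArg (List.map (· % 2 ^ W)) (map_reg_places W E (base := base) es base)
    rwa [List.map_map, List.map_map] at this
  have evaluate := run_compileList W E hes (s := []) rfl
  have copy := run_copies W E (regs := regs) (s := [])
    (fun p hp => length_regs ▸ lt_of_mem_places hp) rfl
  simp only [List.append_nil, List.nil_append, List.length_nil, add_zero] at evaluate copy
  rw [Program.out, Program.out, simProg, Program.run_append, Program.run_append, evaluate,
    PMF.pure_bind, ← length_regs, copy, PMF.pure_bind, values, run_map_shift, PMF.map_comp]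
  refine map_congr_of_mem_support _ fun l hl => ?_
  have := ne_nil_of_mem_support_run _ _ (by simpa using hne) hl
  simp [List.getLast?_append_of_ne_nil _ this]

theorem cost_simProg_le (W t : ℕ) (es : List Expr) (A : Program) (B : ℕ)
    (h : ∀ e ∈ es, e.cost W ≤ B) :
    (simProg W t es A).cost ≤ es.length * (B + (1 + W)) + A.cost := by
  have evaluate : (es.map (Expr.cost W)).sum ≤ es.length * B := by
    simpa using List.sum_le_card_nsmul (es.map (Expr.cost W)) B (by simpa using h)
  rw [simProg, Program.cost_append, Program.cost_append, cost_compileList, cost_copies,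
    length_places, mul_add _ B]
  exact add_le_add (add_le_add_left evaluate _) (cost_map_shift_le _ _)

theorem le_cost_simProg (W t : ℕ) {es : List Expr} (A : Program) (hne : es ≠ []) :
    W ≤ (simProg W t es A).cost := by
  rw [simProg, Program.cost_append, Program.cost_append, cost_copies, length_places]
  have := List.length_pos_of_ne_nil hne
  nlinarith

/-! ## The shape of the view of the corrupted server -/

/-- An index entry with components in `X`. -/
structure Triple (X : Type) where
  lab : X
  id : X
  tag : X

namespace Triple

variable {X Y : Type}

/-- The components of an entry, in the order of `Entry.toList`. -/
def toList (t : Triple X) : List X := [t.lab, t.id, t.tag]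

/-- The componentwise relation on entries. -/
structure Rel (R : X → Y → Prop) (t : Triple X) (t' : Triple Y) : Prop where
  lab : R t.lab t'.lab
  id : R t.id t'.id
  tag : R t.tag t'.tag

variable {R R' : X → Y → Prop} {t : Triple X} {t' : Triple Y}

theorem Rel.toList (h : t.Rel R t') : List.Forall₂ R t.toList t'.toList :=
  .cons h.lab (.cons h.id (.cons h.tag .nil))

theorem Rel.mono (h : t.Rel R t') (hR : ∀ x y, R x y → R' x y) : t.Rel R' t' :=
  ⟨hR _ _ h.lab, hR _ _ h.id, hR _ _ h.tag⟩

end Triple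

/-- The words of both indexes. -/
abbrev Word (sz : Kind → ℕ) : Type := Σ k, Fin (sz k)

/-- The permutations that one server applies to the lists of a round. -/
abbrev Perms (sz : Kind → ℕ) : Type := Server → ∀ k, Equiv.Perm (Fin (sz k))

/-- The data from which the view is computed: the keys of the corrupted server, the entries
before the round, the entries after the refresh by the honest server (both in the order of the
plaintext index), and the randomizers of the corrupted server. -/
structure Leaves (X : Type) (sz : Kind → ℕ) where
  N : X
  pdk : X
  rho : X
  kap : X
  auth : X
  pre : Server → Word sz → Triple X
  hon : Server → Word sz → Triple X
  coin : Server → Word sz → X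

/-- The componentwise relation on leaves. -/
structure Leaves.Rel {X Y : Type} {sz : Kind → ℕ} (R : X → Y → Prop) (V : Leaves X sz)
    (V' : Leaves Y sz) : Prop where
  N : R V.N V'.N
  pdk : R V.pdk V'.pdk
  rho : R V.rho V'.rho
  kap : R V.kap V'.kap
  auth : R V.auth V'.auth
  pre : ∀ s w, (V.pre s w).Rel R (V'.pre s w)
  hon : ∀ s w, (V.hon s w).Rel R (V'.hon s w)
  coin : ∀ s w, R (V.coin s w) (V'.coin s w)

/-- The part of the leaves that the reductions replace: the public key, the partial decryption
key, the labels, tags and ciphertexts before the round (`lab₁`, `tag₁`, `ct₁`) and after the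
refresh by the honest server (`lab₂`, `tag₂`, `ct₂`), and the randomizers of the corrupted server.
The labels do not depend on the share, so `lab₂` is the refreshed label of an entry that the
corrupted server has not refreshed yet. -/
structure Inputs (X : Type) (sz : Kind → ℕ) where
  N : X
  pdk : X
  lab₁ : Word sz → X
  lab₂ : Word sz → X
  tag₁ : Server → Word sz → X
  tag₂ : Server → Word sz → X
  ct₁ : Server → Word sz → X
  ct₂ : Server → Word sz → X
  coin : Server → Word sz → X

namespace Inputs

variable {X Y : Type} {sz : Kind → ℕ}

/-- The componentwise relation on inputs. -/
structure Rel (R : X → Y → Prop) (V : Inputs X sz) (V' : Inputs Y sz) : Prop where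
  N : R V.N V'.N
  pdk : R V.pdk V'.pdk
  lab₁ : ∀ w, R (V.lab₁ w) (V'.lab₁ w)
  lab₂ : ∀ w, R (V.lab₂ w) (V'.lab₂ w)
  tag₁ : ∀ s w, R (V.tag₁ s w) (V'.tag₁ s w)
  tag₂ : ∀ s w, R (V.tag₂ s w) (V'.tag₂ s w)
  ct₁ : ∀ s w, R (V.ct₁ s w) (V'.ct₁ s w)
  ct₂ : ∀ s w, R (V.ct₂ s w) (V'.ct₂ s w)
  coin : ∀ s w, R (V.coin s w) (V'.coin s w)

/-- The leaves of the view, where `pow` is exponentiation.  The honest server is the second one to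
refresh an entry of its own share, so there the corrupted server has already raised the label to
its exponent `rho`. -/
def leaves (c : Server) (pow : X → X → X) (rho kap auth : X) (V : Inputs X sz) :
    Leaves X sz where
  N := V.N
  pdk := V.pdk
  rho := rho
  kap := kap
  auth := auth
  pre s w := ⟨V.lab₁ w, V.ct₁ s w, V.tag₁ s w⟩
  hon s w := ⟨if s = c then V.lab₂ w else pow (V.lab₂ w) rho, V.ct₂ s w, V.tag₂ s w⟩
  coin := V.coin

theorem Rel.leaves {R R' : X → Y → Prop} {V : Inputs X sz} {V' : Inputs Y sz} (h : V.Rel R V')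
    (hR : ∀ x y, R x y → R' x y) (c : Server) {pow : X → X → X} {pow' : Y → Y → Y}
    {rho kap auth : X} {rho' kap' auth' : Y} (hrho : R' rho rho') (hkap : R' kap kap')
    (hauth : R' auth auth') (hpow : ∀ w, R' (pow (V.lab₂ w) rho) (pow' (V'.lab₂ w) rho')) :
    (V.leaves c pow rho kap auth).Rel R' (V'.leaves c pow' rho' kap' auth') where
  N := hR _ _ h.N
  pdk := hR _ _ h.pdk
  rho := hrho
  kap := hkap
  auth := hauth
  pre s w := ⟨hR _ _ (h.lab₁ w), hR _ _ (h.ct₁ s w), hR _ _ (h.tag₁ s w)⟩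
  hon s w := by
    refine ⟨?_, hR _ _ (h.ct₂ s w), hR _ _ (h.tag₂ s w)⟩
    simp only [Inputs.leaves]
    split_ifs
    exacts [hR _ _ (h.lab₂ w), hpow w]
  coin s w := hR _ _ (h.coin s w)

end Inputs

/-- The share, the index and the two entries the challenge is about. -/
structure Target (sz : Kind → ℕ) where
  o : Server
  k : Kind
  i₀ : Fin (sz k)
  i₁ : Fin (sz k)

section View

variable {X : Type} {sz : Kind → ℕ} (c : Server) (cref : Triple X → X → Triple X) (lit : ℕ → X)
  (V : Leaves X sz) (πc πd : Perms sz)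

/-- The intermediate list of the share of `s`, where `cref` is the refresh by the corrupted server
and `πc`, `πd` are the permutations of the corrupted and of the honest server. -/
def midList (s : Server) (k : Kind) (j : Fin (sz k)) : Triple X :=
  if s = c then V.hon s ⟨k, πd s k j⟩
  else cref (V.pre s ⟨k, πc s k j⟩) (V.coin s ⟨k, πc s k j⟩)

/-- The final list of the share of `s`.  As the refreshes commute with the permutations, all
refreshed entries are taken from the leaves in the order of the plaintext index. -/
def postList (s : Server) (k : Kind) (j : Fin (sz k)) : Triple X :=
  if s = c then cref (V.hon s ⟨k, πd s k (πc s k j)⟩) (V.coin s ⟨k, πc s k j⟩)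
  else V.hon s ⟨k, πc s k (πd s k j)⟩

/-- The components of a list of entries, in the order of `listEntries`. -/
def flatTriples {l : ℕ} (L : Fin l → Triple X) : List X :=
  (List.ofFn fun j => (L j).toList).flatten

/-- The part of the view about the index `k` of the share of `s`. -/
def viewPart (s : Server) (k : Kind) : List X :=
  flatTriples (fun i => V.pre s ⟨k, i⟩) ++ flatTriples (midList c cref V πc πd s k) ++
    flatTriples (postList c cref V πc πd s k) ++
    (List.ofFn (fun j => V.coin s ⟨k, j⟩) ++ List.ofFn fun j => lit (πc s k j).val)

/-- The final position of the challenge entry. -/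
def Target.pos (tg : Target sz) (b : Bool) : Fin (sz tg.k) :=
  if tg.o = c then
    (πc tg.o tg.k).symm ((πd tg.o tg.k).symm (if b then tg.i₁ else tg.i₀))
  else (πd tg.o tg.k).symm ((πc tg.o tg.k).symm (if b then tg.i₁ else tg.i₀))

/-- The view of the corrupted server when the challenge bit is `b`. -/
def viewOf (tg : Target sz) (b : Bool) : List X :=
  [V.N, V.pdk, V.rho, V.kap, V.auth] ++
    viewPart c cref lit V πc πd .cs1 .pref ++ viewPart c cref lit V πc πd .cs1 .keyword ++
    viewPart c cref lit V πc πd .cs2 .pref ++ viewPart c cref lit V πc πd .cs2 .keyword ++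
    (V.pre tg.o ⟨tg.k, tg.i₀⟩).toList ++ (V.pre tg.o ⟨tg.k, tg.i₁⟩).toList ++
    (postList c cref V πc πd tg.o tg.k (tg.pos c πc πd b)).toList ++
    [lit (tg.pos c πc πd b).val]

theorem length_flatTriples {l : ℕ} (L : Fin l → Triple X) : (flatTriples L).length = 3 * l := by
  simp [flatTriples, Triple.toList, Function.comp_def, mul_comm]

theorem length_viewOf (tg : Target sz) (b : Bool) :
    (viewOf c cref lit V πc πd tg b).length = 15 + 22 * (sz .pref + sz .keyword) := by
  simp only [viewOf, viewPart, length_flatTriples, Triple.toList, List.length_append,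
    List.length_cons, List.length_nil, List.length_ofFn]
  ring

theorem viewOf_ne_nil (tg : Target sz) (b : Bool) : viewOf c cref lit V πc πd tg b ≠ [] := by
  simp [viewOf]

end View

section ViewRel

variable {X Y : Type} {R R' : X → Y → Prop}

theorem forall₂_ofFn {l : ℕ} {f : Fin l → X} {g : Fin l → Y} (h : ∀ i, R (f i) (g i)) :
    List.Forall₂ R (List.ofFn f) (List.ofFn g) :=
  List.forall₂_iff_get.2 ⟨by simp, fun i _ _ => by simpa using h _⟩

theorem exists_of_mem_forall₂ {l : List X} {l' : List Y} (h : List.Forall₂ R l l') {x : X}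
    (hx : x ∈ l) : ∃ y, R x y := by
  induction h with
  | nil => simp at hx
  | cons h _ ih =>
    rcases List.mem_cons.1 hx with rfl | hx
    · exact ⟨_, h⟩
    · exact ih hx

theorem forall₂_flatTriples {l : ℕ} {L : Fin l → Triple X} {L' : Fin l → Triple Y}
    (h : ∀ i, (L i).Rel R (L' i)) : List.Forall₂ R (flatTriples L) (flatTriples L') :=
  List.rel_flatten (forall₂_ofFn fun i => (h i).toList)

variable {sz : Kind → ℕ} (c : Server) {cref : Triple X → X → Triple X}
  {cref' : Triple Y → Y → Triple Y} {lit : ℕ → X} {lit' : ℕ → Y} {V : Leaves X sz}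
  {V' : Leaves Y sz} (πc πd : Perms sz)

theorem midList_rel (hV : V.Rel R V') (hR : ∀ x y, R x y → R' x y)
    (hpre : ∀ s w w', (cref (V.pre s w) (V.coin s w')).Rel R' (cref' (V'.pre s w) (V'.coin s w')))
    (s : Server) (k : Kind) (j : Fin (sz k)) :
    (midList c cref V πc πd s k j).Rel R' (midList c cref' V' πc πd s k j) := by
  unfold midList
  split_ifs
  · exact (hV.hon _ _).mono hR
  · exact hpre _ _ _

theorem postList_rel (hV : V.Rel R V') (hR : ∀ x y, R x y → R' x y)
    (hhon : ∀ s w w', (cref (V.hon s w) (V.coin s w')).Rel R' (cref' (V'.hon s w) (V'.coin s w')))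
    (s : Server) (k : Kind) (j : Fin (sz k)) :
    (postList c cref V πc πd s k j).Rel R' (postList c cref' V' πc πd s k j) := by
  unfold postList
  split_ifs
  · exact hhon _ _ _
  · exact (hV.hon _ _).mono hR

theorem viewOf_rel (hV : V.Rel R V') (hR : ∀ x y, R x y → R' x y)
    (hpre : ∀ s w w', (cref (V.pre s w) (V.coin s w')).Rel R' (cref' (V'.pre s w) (V'.coin s w')))
    (hhon : ∀ s w w', (cref (V.hon s w) (V.coin s w')).Rel R' (cref' (V'.hon s w) (V'.coin s w')))
    (hlit : ∀ k, ∀ i : Fin (sz k), R' (lit i.val) (lit' i.val)) (tg : Target sz) (b : Bool) :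
    List.Forall₂ R' (viewOf c cref lit V πc πd tg b) (viewOf c cref' lit' V' πc πd tg b) := by
  have keys : List.Forall₂ R' [V.N, V.pdk, V.rho, V.kap, V.auth]
      [V'.N, V'.pdk, V'.rho, V'.kap, V'.auth] :=
    .cons (hR _ _ hV.N) (.cons (hR _ _ hV.pdk) (.cons (hR _ _ hV.rho)
      (.cons (hR _ _ hV.kap) (.cons (hR _ _ hV.auth) .nil))))
  have part (s k) : List.Forall₂ R' (viewPart c cref lit V πc πd s k)
      (viewPart c cref' lit' V' πc πd s k) :=
    List.rel_append (List.rel_append (List.rel_append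
      (forall₂_flatTriples fun i => (hV.pre _ _).mono hR)
      (forall₂_flatTriples fun i => midList_rel c πc πd hV hR hpre s k i))
      (forall₂_flatTriples fun i => postList_rel c πc πd hV hR hhon s k i))
      (List.rel_append (forall₂_ofFn fun i => hR _ _ (hV.coin _ _))
        (forall₂_ofFn fun i => hlit k _))
  have pre (i) : List.Forall₂ R' (V.pre tg.o ⟨tg.k, i⟩).toList (V'.pre tg.o ⟨tg.k, i⟩).toList :=
    ((hV.pre _ _).mono hR).toList
  exact List.rel_append (List.rel_append (List.rel_append (List.rel_append (List.rel_append
    (List.rel_append (List.rel_append (List.rel_append keys (part _ _)) (part _ _)) (part _ _))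
    (part _ _)) (pre _)) (pre _)) (postList_rel c πc πd hV hR hhon _ _ _).toList)
    (.cons (hlit _ _) .nil)

end ViewRel

/-! ## Programs that compute the view -/

/-- The expression `e` represents the number `v` at cost at most `B`. -/
structure Rep (W : ℕ) (E : Env) (base : List ℕ) (B : ℕ) (e : Expr) (v : ℕ) : Prop where
  eval : e.eval W E base = v
  lt : v < 2 ^ W
  fits : e.Fits base.length
  cost : e.cost W ≤ B

namespace Rep

variable {W : ℕ} {E : Env} {base : List ℕ} {B B₁ B₂ B₃ : ℕ} {e e₁ e₂ e₃ : Expr}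
  {v v₁ v₂ v₃ : ℕ}

theorem mono (h : Rep W E base B₁ e v) (hB : B₁ ≤ B) : Rep W E base B e v :=
  ⟨h.eval, h.lt, h.fits, h.cost.trans hB⟩

theorem const (hv : v < 2 ^ W) : Rep W E base (W + 1) (.const v) v :=
  ⟨rfl, hv, trivial, by rw [Expr.cost, add_comm]; gcongr; exact Nat.size_le.2 hv⟩

theorem reg {i : ℕ} (hi : i < base.length) (hv : Brasp.reg base i = v) (hlt : v < 2 ^ W) :
    Rep W E base (W + 1) (.reg i) v :=
  ⟨by rw [Expr.eval, hv, Nat.mod_eq_of_lt hlt], hlt, hi, by rw [Expr.cost, add_comm]⟩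

theorem arith (op : Arith) (h₁ : Rep W E base B₁ e₁ v₁) (h₂ : Rep W E base B₂ e₂ v₂)
    (hv : op.eval v₁ v₂ = v) (hlt : v < 2 ^ W) :
    Rep W E base (B₁ + B₂ + (W + 1)) (.arith op e₁ e₂) v :=
  ⟨by rw [Expr.eval, h₁.eval, h₂.eval, hv, Nat.mod_eq_of_lt hlt], hlt, ⟨h₁.fits, h₂.fits⟩, by
    rw [Expr.cost, add_comm 1]; gcongr; exacts [h₁.cost, h₂.cost]⟩

theorem powMod (h₁ : Rep W E base B₁ e₁ v₁) (h₂ : Rep W E base B₂ e₂ v₂)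
    (h₃ : Rep W E base B₃ e₃ v₃) (hv : v₁ ^ v₂ % v₃ = v) (hlt : v < 2 ^ W) :
    Rep W E base (B₁ + B₂ + B₃ + (W + 1)) (.powMod e₁ e₂ e₃) v :=
  ⟨by rw [Expr.eval, h₁.eval, h₂.eval, h₃.eval, hv, Nat.mod_eq_of_lt hlt], hlt,
    ⟨h₁.fits, h₂.fits, h₃.fits⟩, by
    rw [Expr.cost, add_comm 1]; gcongr; exacts [h₁.cost, h₂.cost, h₃.cost]⟩

theorem call (p : Proc) (h₁ : Rep W E base B₁ e₁ v₁) (h₂ : Rep W E base B₂ e₂ v₂)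
    (hv : E p v₁ v₂ = v) (hlt : v < 2 ^ W) :
    Rep W E base (B₁ + B₂ + (W + 1)) (.call p e₁ e₂) v :=
  ⟨by rw [Expr.eval, h₁.eval, h₂.eval, hv, Nat.mod_eq_of_lt hlt], hlt, ⟨h₁.fits, h₂.fits⟩, by
    rw [Expr.cost, add_comm 1]; gcongr; exacts [h₁.cost, h₂.cost]⟩

theorem map_eval_eq {es : List Expr} {vs : List ℕ} (h : List.Forall₂ (Rep W E base B) es vs) :
    es.map (fun e => e.eval W E base % 2 ^ W) = vs := by
  induction h with
  | nil => rfl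
  | cons h _ ih => rw [List.map_cons, ih, h.eval, Nat.mod_eq_of_lt h.lt]

end Rep

theorem TPF.enc_lt (T : TPF) {n W : ℕ} (hW : T.len n ≤ W) (g : T.G n) : T.enc n g < 2 ^ W :=
  Nat.size_le.1 ((T.enc_size n g).trans hW)

theorem TPF.encPow_enc (T : TPF) (n : ℕ) (g : T.G n) (e : ℕ) :
    T.encPow n (T.enc n g) e = T.enc n (g ^ e) := by
  have h : ∃ g', T.enc n g' = T.enc n g := ⟨g, rfl⟩
  rw [TPF.encPow, dif_pos h, T.enc_injective n h.choose_spec]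

theorem TPF.encPow_lt (T : TPF) {n W : ℕ} (hW : T.len n ≤ W) (x e : ℕ) :
    T.encPow n x e < 2 ^ W := by
  unfold TPF.encPow
  split_ifs
  · exact T.enc_lt hW _
  · exact Nat.two_pow_pos W

theorem TPF.key_lt (T : TPF) {n W : ℕ} (hW : T.len n ≤ W) (k : T.Key n) : k.val.val < 2 ^ W := by
  have card_le : Fintype.card (T.G n) ≤ 2 ^ W := by
    simpa using Fintype.card_le_of_injective
      (fun g => (⟨T.enc n g, T.enc_lt hW g⟩ : Fin (2 ^ W)))
      fun a b h => T.enc_injective n (congrArg Fin.val h)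
  exact (ZMod.val_lt _).trans_le card_le

/-- `F` on encoded keys, as it is available to programs. -/
def prfNat (F : KeyedFun) (n k x : ℕ) : ℕ := if h : k < 2 ^ n then (F n ⟨k, h⟩ x).val else 0

theorem prfNat_val (F : KeyedFun) (n : ℕ) (k : Fin (2 ^ n)) (x : ℕ) :
    prfNat F n k.val x = (F n k x).val := by
  simp [prfNat]

theorem prfNat_lt (F : KeyedFun) {n W : ℕ} (hW : n ≤ W) (k x : ℕ) : prfNat F n k x < 2 ^ W := by
  refine lt_of_lt_of_le ?_ (Nat.pow_le_pow_right two_pos hW)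
  unfold prfNat
  split_ifs
  · exact Fin.is_lt _
  · exact Nat.two_pow_pos n

/-- The refresh by the corrupted server, on encoded entries. -/
noncomputable def refreshNat (T : TPF) (F : KeyedFun) (n : ℕ) {sz : Kind → ℕ} (V : Leaves ℕ sz)
    (t : Triple ℕ) (r : ℕ) : Triple ℕ where
  lab := T.encPow n t.lab V.rho
  id := t.id * (r ^ V.N % V.N ^ 2) % V.N ^ 2
  tag := prfNat F n V.kap t.tag

/-- The refresh by the corrupted server, as an expression. -/
def refreshExpr {sz : Kind → ℕ} (V : Leaves Expr sz) (t : Triple Expr) (r : Expr) :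
    Triple Expr where
  lab := .call .gpow t.lab V.rho
  id := .arith .mod (.arith .mul t.id (.powMod r V.N (.arith .mul V.N V.N)))
    (.arith .mul V.N V.N)
  tag := .call .prf V.kap t.tag

/-- The program that runs `A` on the view computed from the leaves. -/
def viewProg (W t : ℕ) (c : Server) {sz : Kind → ℕ} (V : Leaves Expr sz) (πc πd : Perms sz)
    (tg : Target sz) (b : Bool) (A : Program) : Program :=
  simProg W t (viewOf c (refreshExpr V) .const V πc πd tg b) A

theorem le_cost_viewProg (W t : ℕ) (c : Server) {sz : Kind → ℕ} (V : Leaves Expr sz)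
    (πc πd : Perms sz) (tg : Target sz) (b : Bool) (A : Program) :
    W ≤ (viewProg W t c V πc πd tg b A).cost :=
  le_cost_simProg _ _ _ (viewOf_ne_nil _ _ _ _ _ _ _ _)

/-- The numbers in the view are small enough for instructions of width `W`. -/
structure Small (T : TPF) (n W : ℕ) {sz : Kind → ℕ} (V' : Leaves ℕ sz) : Prop where
  len : T.len n ≤ W
  n_le : n ≤ W
  sz : ∀ k, sz k ≤ W
  N_ne : V'.N ≠ 0
  N4 : V'.N ^ 4 < 2 ^ W
  pre : ∀ s w, (V'.pre s w).id < V'.N ^ 2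
  hon : ∀ s w, (V'.hon s w).id < V'.N ^ 2

section ViewProg

variable {T : TPF} {F : KeyedFun} {n W B : ℕ} {pp : T.Param n} {chal : ℕ → ℕ}
  {base : List ℕ} {sz : Kind → ℕ} {V : Leaves Expr sz} {V' : Leaves ℕ sz}

theorem refresh_rel (hV : V.Rel (Rep W (env T F n pp chal) base B) V') (hs : Small T n W V')
    {t : Triple Expr} {t' : Triple ℕ} (ht : t.Rel (Rep W (env T F n pp chal) base B) t')
    (hid : t'.id < V'.N ^ 2) {r : Expr} {r' : ℕ} (hr : Rep W (env T F n pp chal) base B r r') :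
    (refreshExpr V t r).Rel (Rep W (env T F n pp chal) base (7 * B + 5 * (W + 1)))
      (refreshNat T F n V' t' r') := by
  have N_pos : 0 < V'.N := Nat.pos_of_ne_zero hs.N_ne
  have mod_lt (x) : x % V'.N ^ 2 < V'.N ^ 2 := Nat.mod_lt _ (pow_pos N_pos 2)
  have sq_lt : V'.N ^ 2 < 2 ^ W :=
    (Nat.pow_le_pow_right N_pos (by norm_num : 2 ≤ 4)).trans_lt hs.N4
  have product_lt : t'.id * (r' ^ V'.N % V'.N ^ 2) < 2 ^ W :=
    calc t'.id * (r' ^ V'.N % V'.N ^ 2) < V'.N ^ 2 * V'.N ^ 2 := Nat.mul_lt_mul'' hid (mod_lt _)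
      _ = V'.N ^ 4 := by ring
      _ < 2 ^ W := hs.N4
  have sq : Rep W (env T F n pp chal) base (B + B + (W + 1)) (.arith .mul V.N V.N) (V'.N ^ 2) :=
    .arith .mul hV.N hV.N (by simp [Arith.eval, sq]) sq_lt
  exact ⟨(Rep.call .gpow ht.lab hV.rho rfl (T.encPow_lt hs.len _ _)).mono (by lia),
    (Rep.arith .mod (.arith .mul ht.id (.powMod hr hV.N sq rfl ((mod_lt _).trans sq_lt)) rfl
      product_lt) sq rfl ((mod_lt _).trans sq_lt)).mono (by lia),
    (Rep.call .prf hV.kap ht.tag rfl (prfNat_lt F hs.n_le _ _)).mono (by lia)⟩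

theorem viewOf_rep (hV : V.Rel (Rep W (env T F n pp chal) base B) V') (hs : Small T n W V')
    (c : Server) (πc πd : Perms sz) (tg : Target sz) (b : Bool) :
    List.Forall₂ (Rep W (env T F n pp chal) base (7 * B + 5 * (W + 1)))
      (viewOf c (refreshExpr V) .const V πc πd tg b)
      (viewOf c (refreshNat T F n V') id V' πc πd tg b) :=
  viewOf_rel c πc πd hV (fun _ _ h => h.mono (by lia))
    (fun s w w' => refresh_rel hV hs (hV.pre s w) (hs.pre s w) (hV.coin s w'))
    (fun s w w' => refresh_rel hV hs (hV.hon s w) (hs.hon s w) (hV.coin s w'))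
    (fun k i => (Rep.const ((i.is_lt.trans_le (hs.sz k)).trans Nat.lt_two_pow_self)).mono
      (by lia)) tg b

theorem out_viewProg (hV : V.Rel (Rep W (env T F n pp chal) base B) V') (hs : Small T n W V')
    (c : Server) (πc πd : Perms sz) (tg : Target sz) (b : Bool) (A : Program) :
    (viewProg W base.length c V πc πd tg b A).out (env T F n pp chal) base =
      A.out (env T F n pp fun _ => 0) (viewOf c (refreshNat T F n V') id V' πc πd tg b) := by
  have view := viewOf_rep hV hs c πc πd tg b
  have fits : ∀ e ∈ viewOf c (refreshExpr V) .const V πc πd tg b, e.Fits base.length :=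
    fun e he => (exists_of_mem_forall₂ view he).elim fun _ h => h.fits
  rw [viewProg, out_simProg _ _ _ fits (viewOf_ne_nil _ _ _ _ _ _ _ _), silence_env,
    Rep.map_eval_eq view]

theorem cost_viewProg_le (hV : V.Rel (Rep W (env T F n pp chal) base B) V')
    (hs : Small T n W V') (t : ℕ) (c : Server) (πc πd : Perms sz) (tg : Target sz) (b : Bool)
    (A : Program) :
    (viewProg W t c V πc πd tg b A).cost ≤
      (15 + 22 * (sz .pref + sz .keyword)) * (7 * B + 6 * (W + 1)) + A.cost := by
  have cost_le : ∀ e ∈ viewOf c (refreshExpr V) .const V πc πd tg b,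
      e.cost W ≤ 7 * B + 5 * (W + 1) := fun e he =>
    (exists_of_mem_forall₂ (viewOf_rep hV hs c πc πd tg b) he).elim fun _ h => h.cost
  refine (cost_simProg_le W t _ A _ cost_le).trans_eq ?_
  rw [length_viewOf]
  ring

end ViewProg

/-! ## Reductions to a pseudorandom function -/

/-- The program `P`, whose challenge oracle answers the queries `q`, has output distribution
`f pp v` when the answers encode `v` under `encR`. -/
def Simulates (T : TPF) (F : KeyedFun) {n : ℕ} {Q R : Type} (q : Q → ℕ) (encR : R → ℕ)
    (P : Program) (f : T.Param n → (Q → R) → PMF Bool) : Prop :=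
  ∀ pp chal v, (∀ x, chal (q x) = encR (v x)) → P.out (env T F n pp chal) [] = f pp v

section Simulates

variable {T : TPF} {F : KeyedFun} {n : ℕ} {Q R : Type} {q : Q → ℕ} {encR : R → ℕ} {P : Program}
  {f : T.Param n → (Q → R) → PMF Bool}

theorem prfReal_of_simulates {K : Type} [Finite K] [Nonempty K] (h : Simulates T F q encR P f)
    (φ : T.Param n → K → ℕ → R) :
    prfReal T F n encR φ P =
      (T.setup n).bind fun pp => (unif K).bind fun k => f pp fun x => φ pp k (q x) :=
  congrArg _ (funext fun _ => congrArg _ (funext fun _ => h _ _ _ fun _ => rfl))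

theorem prfIdeal_of_simulates [Finite Q] [Finite R] [Nonempty R] (h : Simulates T F q encR P f)
    (hq : Function.Injective q) (hlt : ∀ x, q x < 2 ^ P.cost) :
    prfIdeal T F n encR P = (T.setup n).bind fun pp => (unif (Q → R)).bind (f pp) := by
  refine congrArg _ (funext fun pp => ?_)
  rw [← unif_bind_of_map (unif_map_comp (R := R) (fun x => (⟨q x, hlt x⟩ : Fin (2 ^ P.cost)))
    fun x y hxy => hq (congrArg Fin.val hxy))]
  exact congrArg _ (funext fun g => h _ _ _ fun x => by simp [hlt x])

end Simulates

/-- Pseudorandomness of a family of functions that depend on the public parameters and a key.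
`TPFSecure` and `FSecure` are instances. -/
def PRFSecure (T : TPF) (F : KeyedFun) {K R : ℕ → Type} [∀ n, Finite (K n)]
    [∀ n, Nonempty (K n)] [∀ n, Finite (R n)] [∀ n, Nonempty (R n)] (encR : ∀ n, R n → ℕ)
    (f : ∀ n, T.Param n → K n → ℕ → R n) : Prop :=
  ∀ A : Adversary, Negligible fun n =>
    |prob (prfReal T F n (encR n) (f n) (A.prog n)) - prob (prfIdeal T F n (encR n) (A.prog n))|

theorem PRFSecure.indist {T : TPF} {F : KeyedFun} {K R Q : ℕ → Type} [∀ n, Finite (K n)]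
    [∀ n, Nonempty (K n)] [∀ n, Finite (R n)] [∀ n, Nonempty (R n)] [∀ n, Finite (Q n)]
    {encR : ∀ n, R n → ℕ} {f : ∀ n, T.Param n → K n → ℕ → R n} (h : PRFSecure T F encR f)
    {q : ∀ n, Q n → ℕ} (hq : ∀ n, Function.Injective (q n)) {B : ℕ → ℕ} (hB : PolyBounded B)
    {d e : ℕ → PMF Bool}
    (H : ∀ n, ∃ P φ, P.cost ≤ B n ∧ (∀ x, q n x < 2 ^ P.cost) ∧
      Simulates T F (q n) (encR n) P φ ∧
      |prob (d n) - prob (e n)| ≤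
        |prob ((T.setup n).bind fun pp => (unif (K n)).bind fun k =>
            φ pp fun x => f n pp k (q n x)) -
          prob ((T.setup n).bind fun pp => (unif (Q n → R n)).bind (φ pp))|) :
    Indist d e := by
  choose P φ cost_le lt sim le using H
  refine (h ⟨P, hB.mono cost_le⟩).mono (fun _ => abs_nonneg _) fun n => ?_
  rw [prfReal_of_simulates (sim n), prfIdeal_of_simulates (sim n) (hq n) (lt n)]
  exact le n

/-! ## The games -/

/-- The labels of all words before and after the refresh by the honest server. -/
abbrev Lab (T : TPF) (n : ℕ) (sz : Kind → ℕ) : Type := (Word sz → T.G n) × (Word sz → T.G n)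

/-- The tags of all entries before the round and after the refresh by the honest server. -/
abbrev Tag (n : ℕ) (sz : Kind → ℕ) : Type :=
  (Server → Word sz → Fin (2 ^ n)) × (Server → Word sz → Fin (2 ^ n))

/-- The public key, the partial decryption key of the corrupted server, the ciphertexts of all
entries before the round and after the refresh by the honest server, and the randomizers of the
corrupted server. -/
structure Ciphers (sz : Kind → ℕ) where
  N : ℕ
  pdk : ℕ
  ct₁ : Server → Word sz → ℕ
  ct₂ : Server → Word sz → ℕ
  coin : Server → Word sz → ℕ

/-- The exponent of the corrupted server, the authorization key, and the permutations of the
corrupted and of the honest server. -/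
abbrev Misc (T : TPF) (n : ℕ) (sz : Kind → ℕ) : Type :=
  (T.Key n × T.Key n) × Perms sz × Perms sz

/-- A family of shuffle experiments, with a width `W` that suffices for the reductions. -/
structure Setting (T : TPF) where
  sz : ℕ → Kind → ℕ
  word : ∀ n, Word (sz n) → ℕ
  word_injective : ∀ n, Function.Injective (word n)
  c : Server
  tg : ∀ n, Target (sz n)
  A : Adversary
  u : ℕ → ℕ
  u_poly : PolyBounded u
  W : ℕ → ℕ
  W_poly : PolyBounded W
  len_le : ∀ n, T.len n ≤ W n
  n_le : ∀ n, n ≤ W n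
  sz_le : ∀ n k, sz n k ≤ W n
  word_lt : ∀ n w, word n w < 2 ^ W n
  pair_lt : ∀ n (s : Server) w, Nat.pair s.num (word n w) < 2 ^ W n

/-- Keys and ciphertexts are in their ranges. -/
structure InRange (W : ℕ) {sz : Kind → ℕ} (ck : Ciphers sz) : Prop where
  N_ne : ck.N ≠ 0
  N4 : ck.N ^ 4 < 2 ^ W
  pdk : ck.pdk < 2 ^ W
  ct₁ : ∀ s w, ck.ct₁ s w < ck.N ^ 2
  ct₂ : ∀ s w, ck.ct₂ s w < ck.N ^ 2
  coin : ∀ s w, ck.coin s w < 2 ^ W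

namespace InRange

variable {W : ℕ} {sz : Kind → ℕ} {ck : Ciphers sz}

theorem N_lt (h : InRange W ck) : ck.N < 2 ^ W := (Nat.le_self_pow (by simp) _).trans_lt h.N4

theorem sq_lt (h : InRange W ck) : ck.N ^ 2 < 2 ^ W :=
  (Nat.pow_le_pow_right (Nat.pos_of_ne_zero h.N_ne) (by simp)).trans_lt h.N4

end InRange

/-- The inputs of the view for given labels, tags, keys and ciphertexts. -/
def inputsOf (T : TPF) {n : ℕ} {sz : Kind → ℕ} (lab : Lab T n sz) (tag : Tag n sz)
    (ck : Ciphers sz) : Inputs ℕ sz where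
  N := ck.N
  pdk := ck.pdk
  lab₁ w := T.enc n (lab.1 w)
  lab₂ w := T.enc n (lab.2 w)
  tag₁ s w := (tag.1 s w).val
  tag₂ s w := (tag.2 s w).val
  ct₁ := ck.ct₁
  ct₂ := ck.ct₂
  coin := ck.coin

namespace Setting

variable {T : TPF} (F : KeyedFun) (X : Setting T) (n : ℕ)

/-- The leaves of the view for given labels, tags, keys and ciphertexts. -/
noncomputable def leaves (m : Misc T n (X.sz n)) (κ : Fin (2 ^ n)) (lab : Lab T n (X.sz n))
    (tag : Tag n (X.sz n)) (ck : Ciphers (X.sz n)) : Leaves ℕ (X.sz n) :=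
  (inputsOf T lab tag ck).leaves X.c (T.encPow n) m.1.1.val.val κ.val m.1.2.val.val

/-- The output of the adversary on the view. -/
noncomputable def play (b : Bool) (m : Misc T n (X.sz n)) (κ : Fin (2 ^ n))
    (tag : Tag n (X.sz n)) (ck : Ciphers (X.sz n)) (pp : T.Param n)
    (lab : Lab T n (X.sz n)) : PMF Bool :=
  (X.A.prog n).out (env T F n pp fun _ => 0)
    (viewOf X.c (refreshNat T F n (X.leaves n m κ lab tag ck)) id (X.leaves n m κ lab tag ck)
      m.2.1 m.2.2 (X.tg n) b)

/-- The shuffle experiment with given distributions of labels, tags, and ciphertexts. -/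
noncomputable def game (Dl : T.Param n → PMF (Lab T n (X.sz n)))
    (Dt : Fin (2 ^ n) → PMF (Tag n (X.sz n))) (Dk : PMF (Ciphers (X.sz n))) : PMF Bool :=
  (unif Bool).bind fun b => (unif (Misc T n (X.sz n))).bind fun m =>
    (unif (Fin (2 ^ n))).bind fun κ => (Dt κ).bind fun tag => Dk.bind fun ck =>
      (T.setup n).bind fun pp => (Dl pp).bind fun lab =>
        (X.play F n b m κ tag ck pp lab).map (· == b)

section Averaging

variable {α : Type}

theorem exists_game_sub_le_lab (p : PMF α) (Dl Dl' : α → T.Param n → PMF (Lab T n (X.sz n)))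
    (Dt : Fin (2 ^ n) → PMF (Tag n (X.sz n))) (Dk : PMF (Ciphers (X.sz n))) :
    ∃ a b m κ tag, ∃ ck ∈ Dk.support,
      |prob (X.game F n (fun pp => p.bind (Dl · pp)) Dt Dk) -
          prob (X.game F n (fun pp => p.bind (Dl' · pp)) Dt Dk)| ≤
        |prob ((T.setup n).bind fun pp => (Dl a pp).bind (X.play F n b m κ tag ck pp)) -
          prob ((T.setup n).bind fun pp => (Dl' a pp).bind (X.play F n b m κ tag ck pp))| := by
  simp only [game, PMF.bind_bind, PMF.bind_comm _ p]
  obtain ⟨a, -, ha⟩ := exists_mem_support_abs_prob_sub_le p _ _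
  obtain ⟨b, -, hb⟩ := exists_mem_support_abs_prob_sub_le (unif Bool) _ _
  obtain ⟨m, -, hm⟩ := exists_mem_support_abs_prob_sub_le (unif (Misc T n (X.sz n))) _ _
  obtain ⟨κ, -, hκ⟩ := exists_mem_support_abs_prob_sub_le (unif (Fin (2 ^ n))) _ _
  obtain ⟨tag, -, htag⟩ := exists_mem_support_abs_prob_sub_le (Dt κ) _ _
  obtain ⟨ck, hck, h⟩ := exists_mem_support_abs_prob_sub_le Dk _ _
  refine ⟨a, b, m, κ, tag, ck, hck,
    ha.trans (hb.trans (hm.trans (hκ.trans (htag.trans (h.trans_eq ?_)))))⟩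
  simp only [← PMF.map_bind]
  exact abs_prob_map_beq_sub _ _ _

theorem exists_game_sub_le_tag (p : PMF α) (L : PMF (Lab T n (X.sz n)))
    (Dt Dt' : Fin (2 ^ n) → α → PMF (Tag n (X.sz n))) (Dk : PMF (Ciphers (X.sz n))) :
    ∃ a b m κ lab, ∃ ck ∈ Dk.support,
      |prob (X.game F n (fun _ => L) (fun κ => p.bind (Dt κ)) Dk) -
          prob (X.game F n (fun _ => L) (fun κ => p.bind (Dt' κ)) Dk)| ≤
        |prob ((T.setup n).bind fun pp =>
            (Dt κ a).bind fun tag => X.play F n b m κ tag ck pp lab) -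
          prob ((T.setup n).bind fun pp =>
            (Dt' κ a).bind fun tag => X.play F n b m κ tag ck pp lab)| := by
  simp only [game, PMF.bind_bind]
  simp only [PMF.bind_comm _ L]
  simp only [PMF.bind_comm _ Dk]
  simp only [PMF.bind_comm _ p]
  obtain ⟨a, -, ha⟩ := exists_mem_support_abs_prob_sub_le p _ _
  obtain ⟨ck, hck, h⟩ := exists_mem_support_abs_prob_sub_le Dk _ _
  obtain ⟨lab, -, hlab⟩ := exists_mem_support_abs_prob_sub_le L _ _
  obtain ⟨b, -, hb⟩ := exists_mem_support_abs_prob_sub_le (unif Bool) _ _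
  obtain ⟨m, -, hm⟩ := exists_mem_support_abs_prob_sub_le (unif (Misc T n (X.sz n))) _ _
  obtain ⟨κ, -, hκ⟩ := exists_mem_support_abs_prob_sub_le (unif (Fin (2 ^ n))) _ _
  refine ⟨a, b, m, κ, lab, ck, hck,
    ha.trans (h.trans (hlab.trans (hb.trans (hm.trans (hκ.trans_eq ?_)))))⟩
  simp only [PMF.bind_comm _ (T.setup n), ← PMF.map_bind]
  exact abs_prob_map_beq_sub _ _ _

theorem exists_game_sub_le_ct (L : PMF (Lab T n (X.sz n)))
    (Dt : Fin (2 ^ n) → PMF (Tag n (X.sz n))) (Dk Dk' : PMF (Ciphers (X.sz n))) :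
    ∃ b m κ lab tag,
      |prob (X.game F n (fun _ => L) Dt Dk) - prob (X.game F n (fun _ => L) Dt Dk')| ≤
        |prob ((T.setup n).bind fun pp =>
            Dk.bind fun ck => X.play F n b m κ tag ck pp lab) -
          prob ((T.setup n).bind fun pp =>
            Dk'.bind fun ck => X.play F n b m κ tag ck pp lab)| := by
  simp only [game, PMF.bind_comm _ L]
  obtain ⟨lab, -, hlab⟩ := exists_mem_support_abs_prob_sub_le L _ _
  obtain ⟨b, -, hb⟩ := exists_mem_support_abs_prob_sub_le (unif Bool) _ _
  obtain ⟨m, -, hm⟩ := exists_mem_support_abs_prob_sub_le (unif (Misc T n (X.sz n))) _ _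
  obtain ⟨κ, -, hκ⟩ := exists_mem_support_abs_prob_sub_le (unif (Fin (2 ^ n))) _ _
  obtain ⟨tag, -, htag⟩ := exists_mem_support_abs_prob_sub_le (Dt κ) _ _
  refine ⟨b, m, κ, lab, tag,
    hlab.trans (hb.trans (hm.trans (hκ.trans (htag.trans_eq ?_))))⟩
  simp only [PMF.bind_comm _ (T.setup n), ← PMF.map_bind]
  exact abs_prob_map_beq_sub _ _ _

end Averaging

/-- The cost of the expressions for the inputs of the view in the reductions. -/
def budget : ℕ := (4 * X.u n + 20) * (X.W n + 1)

/-- The cost of the reductions. -/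
def bound : ℕ :=
  (15 + 22 * (X.W n + X.W n)) * (7 * (X.budget n + 2 * (X.W n + 1)) + 6 * (X.W n + 1)) +
    (X.A.prog n).cost

theorem polyBounded_bound : PolyBounded X.bound := by
  have width : PolyBounded fun n => X.W n + 1 := X.W_poly.add (polyBounded_const 1)
  have budget : PolyBounded X.budget :=
    (((polyBounded_const 4).mul X.u_poly).add (polyBounded_const 20)).mul width
  exact (((polyBounded_const 15).add ((polyBounded_const 22).mul (X.W_poly.add X.W_poly))).mul
    (((polyBounded_const 7).mul (budget.add ((polyBounded_const 2).mul width))).add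
      ((polyBounded_const 6).mul width))).add X.A.poly

/-- The adversary, run on a view whose inputs are given by expressions, with `t` registers in
use. -/
def reduction (t : ℕ) (b : Bool) (m : Misc T n (X.sz n)) (κ : Fin (2 ^ n))
    (V : Inputs Expr (X.sz n)) : Program :=
  viewProg (X.W n) t X.c (V.leaves X.c (.call .gpow) (.const m.1.1.val.val) (.const κ.val)
    (.const m.1.2.val.val)) m.2.1 m.2.2 (X.tg n) b (X.A.prog n)

section Reduction

variable {n} {b : Bool} {m : Misc T n (X.sz n)} {κ : Fin (2 ^ n)} {pp : T.Param n}
  {chal : ℕ → ℕ} {base : List ℕ} {lab : Lab T n (X.sz n)} {tag : Tag n (X.sz n)}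
  {ck : Ciphers (X.sz n)} {V : Inputs Expr (X.sz n)}

/-- The expressions represent the inputs of the view, within the cost budget. -/
abbrev Represents (pp : T.Param n) (chal : ℕ → ℕ) (base : List ℕ) (V : Inputs Expr (X.sz n))
    (V' : Inputs ℕ (X.sz n)) : Prop :=
  V.Rel (Rep (X.W n) (env T F n pp chal) base (X.budget n)) V'

theorem le_budget {k : ℕ} (hk : k ≤ 4 * X.u n + 20) : k * (X.W n + 1) ≤ X.budget n :=
  Nat.mul_le_mul_right _ hk

theorem small_leaves (hck : InRange (X.W n) ck) :
    Small T n (X.W n) (X.leaves n m κ lab tag ck) :=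
  ⟨X.len_le n, X.n_le n, X.sz_le n, hck.N_ne, hck.N4, hck.ct₁, hck.ct₂⟩

theorem fin_lt (x : Fin (2 ^ n)) : x.val < 2 ^ X.W n :=
  x.is_lt.trans_le (Nat.pow_le_pow_right two_pos (X.n_le n))

variable {F}

theorem leaves_rel (h : X.Represents F pp chal base V (inputsOf T lab tag ck))
    (m : Misc T n (X.sz n)) (κ : Fin (2 ^ n)) :
    (V.leaves X.c (.call .gpow) (.const m.1.1.val.val) (.const κ.val)
        (.const m.1.2.val.val)).Rel
      (Rep (X.W n) (env T F n pp chal) base (X.budget n + 2 * (X.W n + 1)))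
      (X.leaves n m κ lab tag ck) := by
  have const_rep {v : ℕ} (hv : v < 2 ^ X.W n) :
      Rep (X.W n) (env T F n pp chal) base (X.budget n + 2 * (X.W n + 1)) (.const v) v :=
    (Rep.const hv).mono (by lia)
  exact h.leaves (fun _ _ h => h.mono (by lia)) X.c (const_rep (T.key_lt (X.len_le n) _))
    (const_rep (X.fin_lt κ)) (const_rep (T.key_lt (X.len_le n) _)) fun w =>
      (Rep.call .gpow (h.lab₂ w) (Rep.const (T.key_lt (X.len_le n) _)) rfl
        (T.encPow_lt (X.len_le n) _ _)).mono (by lia)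

theorem out_reduction (hck : InRange (X.W n) ck)
    (h : X.Represents F pp chal base V (inputsOf T lab tag ck)) :
    (X.reduction n base.length b m κ V).out (env T F n pp chal) base =
      X.play F n b m κ tag ck pp lab :=
  out_viewProg (X.leaves_rel h m κ) (X.small_leaves hck) X.c m.2.1 m.2.2 (X.tg n) b _

theorem cost_reduction_le (hck : InRange (X.W n) ck)
    (h : X.Represents F pp chal base V (inputsOf T lab tag ck)) (t : ℕ) :
    (X.reduction n t b m κ V).cost ≤ X.bound n := by
  refine (cost_viewProg_le (X.leaves_rel h m κ) (X.small_leaves hck) t X.c m.2.1 m.2.2 (X.tg n)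
    b _).trans ?_
  unfold bound
  gcongr
  · exact X.sz_le n _
  · exact X.sz_le n _

theorem rep_const {v : ℕ} (hv : v < 2 ^ X.W n) :
    Rep (X.W n) (env T F n pp chal) base (X.budget n) (.const v) v :=
  (Rep.const hv).mono (by simpa using X.le_budget (n := n) (k := 1) (by lia))

theorem rep_chal {x v : ℕ} (hx : x < 2 ^ X.W n) (hv : v < 2 ^ X.W n) (h : chal x = v) :
    Rep (X.W n) (env T F n pp chal) base (3 * (X.W n + 1))
      (.call .chal (.const x) (.const 0)) v :=
  (Rep.call .chal (Rep.const hx) (Rep.const (Nat.two_pow_pos _)) h hv).mono (by lia)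

end Reduction

section Expressible

variable {n} {Q R : Type} {q : Q → ℕ} {encR : R → ℕ}

/-- The number `x pp v` is the value of an affordable expression, when the challenge oracle answers
the queries `q` with the encodings of `v`. -/
def Expressible (q : Q → ℕ) (encR : R → ℕ) (x : T.Param n → (Q → R) → ℕ) : Prop :=
  ∃ e, ∀ pp chal v, (∀ y, chal (q y) = encR (v y)) →
    Rep (X.W n) (env T F n pp chal) [] (X.budget n) e (x pp v)

variable {F}

theorem expressible_const {v : ℕ} (hv : v < 2 ^ X.W n) :
    X.Expressible F q encR fun (_ : T.Param n) _ => v :=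
  ⟨_, fun _ _ _ _ => X.rep_const hv⟩

theorem expressible_chal {y : Q} (hq : q y < 2 ^ X.W n) (hR : ∀ r, encR r < 2 ^ X.W n) :
    X.Expressible F q encR fun (_ : T.Param n) v => encR (v y) :=
  ⟨_, fun _ _ v hv => (X.rep_chal hq (hR (v y)) (hv y)).mono (X.le_budget (by lia))⟩

theorem exists_simulates [Nonempty R] (b : Bool) (m : Misc T n (X.sz n)) (κ : Fin (2 ^ n))
    {ck : Ciphers (X.sz n)} (hck : InRange (X.W n) ck)
    {lab : T.Param n → (Q → R) → Lab T n (X.sz n)} {tag : (Q → R) → Tag n (X.sz n)}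
    (hl₁ : ∀ w, X.Expressible F q encR fun pp v => T.enc n ((lab pp v).1 w))
    (hl₂ : ∀ w, X.Expressible F q encR fun pp v => T.enc n ((lab pp v).2 w))
    (ht₁ : ∀ s w, X.Expressible F q encR fun (_ : T.Param n) v => ((tag v).1 s w).val)
    (ht₂ : ∀ s w, X.Expressible F q encR fun (_ : T.Param n) v => ((tag v).2 s w).val) :
    ∃ P : Program, P.cost ≤ X.bound n ∧ X.W n ≤ P.cost ∧
      Simulates T F q encR P fun pp v => X.play F n b m κ (tag v) ck pp (lab pp v) := by
  choose l₁ hl₁ using hl₁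
  choose l₂ hl₂ using hl₂
  choose t₁ ht₁ using ht₁
  choose t₂ ht₂ using ht₂
  let V : Inputs Expr (X.sz n) :=
    { N := .const ck.N, pdk := .const ck.pdk, lab₁ := l₁, lab₂ := l₂, tag₁ := t₁, tag₂ := t₂,
      ct₁ := fun s w => .const (ck.ct₁ s w), ct₂ := fun s w => .const (ck.ct₂ s w),
      coin := fun s w => .const (ck.coin s w) }
  have hV (pp chal v) (hv : ∀ y, chal (q y) = encR (v y)) :
      X.Represents F pp chal [] V (inputsOf T (lab pp v) (tag v) ck) :=
    ⟨X.rep_const hck.N_lt, X.rep_const hck.pdk, fun w => hl₁ w pp chal v hv,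
      fun w => hl₂ w pp chal v hv, fun s w => ht₁ s w pp chal v hv,
      fun s w => ht₂ s w pp chal v hv,
      fun s w => X.rep_const ((hck.ct₁ s w).trans hck.sq_lt),
      fun s w => X.rep_const ((hck.ct₂ s w).trans hck.sq_lt),
      fun s w => X.rep_const (hck.coin s w)⟩
  obtain ⟨pp, -⟩ := (T.setup n).support_nonempty
  obtain ⟨r⟩ := ‹Nonempty R›
  refine ⟨X.reduction n 0 b m κ V, ?_, le_cost_viewProg .., fun pp chal v hv => ?_⟩
  · exact X.cost_reduction_le hck (hV pp (fun _ => encR r) (fun _ => r) fun _ => rfl) 0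
  · simpa only [List.length_nil] using X.out_reduction (base := []) hck (hV pp chal v hv)

end Expressible

end Setting

/-! ## Replacing labels by random ones -/

namespace Setting

variable {T : TPF} (F : KeyedFun) (X : Setting T)

/-- The labels under two independent keys. -/
noncomputable def labReal (n : ℕ) (pp : T.Param n) : PMF (Lab T n (X.sz n)) :=
  (unif (T.Key n)).bind fun k₂ => (unif (T.Key n)).map fun k₁ =>
    (fun w => T.rnd pp k₁ (X.word n w), fun w => T.rnd pp k₂ (X.word n w))

/-- The labels with random labels before the refresh by the honest server. -/
noncomputable def labMid (n : ℕ) (pp : T.Param n) : PMF (Lab T n (X.sz n)) :=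
  (unif (Word (X.sz n) → T.G n)).bind fun L₁ => (unif (T.Key n)).map fun k₂ =>
    (L₁, fun w => T.rnd pp k₂ (X.word n w))

variable {F}

theorem indist_game_of_TPFSecure (hT : TPFSecure T F) {α : ℕ → Type} (p : ∀ n, PMF (α n))
    (L : ∀ n, α n → T.Param n → (Word (X.sz n) → T.G n) → Lab T n (X.sz n))
    (h₁ : ∀ n a w, X.Expressible F (X.word n) (T.enc n) fun pp v => T.enc n ((L n a pp v).1 w))
    (h₂ : ∀ n a w, X.Expressible F (X.word n) (T.enc n) fun pp v => T.enc n ((L n a pp v).2 w))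
    (Dt : ∀ n, Fin (2 ^ n) → PMF (Tag n (X.sz n))) {Dk : ∀ n, PMF (Ciphers (X.sz n))}
    (hDk : ∀ n, ∀ ck ∈ (Dk n).support, InRange (X.W n) ck) :
    Indist
      (fun n => X.game F n (fun pp => (p n).bind fun a =>
        (unif (T.Key n)).map fun k => L n a pp fun w => T.rnd pp k (X.word n w)) (Dt n) (Dk n))
      (fun n => X.game F n (fun pp => (p n).bind fun a =>
        (unif (Word (X.sz n) → T.G n)).map (L n a pp)) (Dt n) (Dk n)) := by
  have secure : PRFSecure T F T.enc (fun _ pp (k : T.Key _) => T.rnd pp k) := hT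
  refine secure.indist X.word_injective X.polyBounded_bound fun n => ?_
  obtain ⟨a, b, m, κ, tag, ck, hck, le⟩ := X.exists_game_sub_le_lab F n (p n)
    (fun a pp => (unif (T.Key n)).map fun k => L n a pp fun w => T.rnd pp k (X.word n w))
    (fun a pp => (unif (Word (X.sz n) → T.G n)).map (L n a pp)) (Dt n) (Dk n)
  have tag_expressible (x : Fin (2 ^ n)) :
      X.Expressible F (X.word n) (T.enc n) fun _ _ => x.val := X.expressible_const (X.fin_lt x)
  obtain ⟨P, cost_le, le_cost, sim⟩ := X.exists_simulates b m κ (hDk n ck hck) (h₁ n a) (h₂ n a)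
    (fun s w => tag_expressible (tag.1 s w)) (fun s w => tag_expressible (tag.2 s w))
  refine ⟨P, _, cost_le, fun w => (X.word_lt n w).trans_le (by gcongr; simp), sim, ?_⟩
  simpa only [PMF.bind_map, Function.comp_def] using le

theorem expressible_enc {n : ℕ} {Q R : Type} {q : Q → ℕ} {encR : R → ℕ} (x : T.G n) :
    X.Expressible F q encR fun (_ : T.Param n) _ => T.enc n x :=
  X.expressible_const (T.enc_lt (X.len_le n) x)

theorem expressible_rnd {n : ℕ} {Q R : Type} {q : Q → ℕ} {encR : R → ℕ} (k : T.Key n)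
    (w : Word (X.sz n)) :
    X.Expressible F q encR fun pp _ => T.enc n (T.rnd pp k (X.word n w)) :=
  ⟨_, fun _ _ _ _ => (Rep.call .gpow (Rep.call .hash (Rep.const (X.word_lt n w))
    (Rep.const (Nat.two_pow_pos _)) rfl (T.enc_lt (X.len_le n) _))
    (Rep.const (T.key_lt (X.len_le n) k)) (T.encPow_enc n _ _) (T.enc_lt (X.len_le n) _)).mono
      (le_trans (by linarith) (X.le_budget (k := 5) (by lia)))⟩

theorem expressible_answer {n : ℕ} (w : Word (X.sz n)) :
    X.Expressible F (X.word n) (T.enc n) fun (_ : T.Param n) v => T.enc n (v w) :=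
  X.expressible_chal (X.word_lt n w) (T.enc_lt (X.len_le n))

theorem indist_labReal_labMid (hT : TPFSecure T F)
    (Dt : ∀ n, Fin (2 ^ n) → PMF (Tag n (X.sz n))) {Dk : ∀ n, PMF (Ciphers (X.sz n))}
    (hDk : ∀ n, ∀ ck ∈ (Dk n).support, InRange (X.W n) ck) :
    Indist (fun n => X.game F n (X.labReal n) (Dt n) (Dk n))
      (fun n => X.game F n (X.labMid n) (Dt n) (Dk n)) := by
  have hop := X.indist_game_of_TPFSecure hT (fun n => unif (T.Key n))
    (fun n k₂ pp v => (v, fun w => T.rnd pp k₂ (X.word n w)))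
    (fun n _ => X.expressible_answer) (fun n => X.expressible_rnd) Dt hDk
  have swap : X.labMid = fun n pp => (unif (T.Key n)).bind fun k₂ =>
      (unif (Word (X.sz n) → T.G n)).map fun L₁ => (L₁, fun w => T.rnd pp k₂ (X.word n w)) :=
    funext₂ fun _ _ => PMF.bind_comm _ _ _
  rw [swap]
  exact hop

theorem indist_labMid_labIdeal (hT : TPFSecure T F)
    (Dt : ∀ n, Fin (2 ^ n) → PMF (Tag n (X.sz n))) {Dk : ∀ n, PMF (Ciphers (X.sz n))}
    (hDk : ∀ n, ∀ ck ∈ (Dk n).support, InRange (X.W n) ck) :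
    Indist (fun n => X.game F n (X.labMid n) (Dt n) (Dk n))
      (fun n => X.game F n (fun _ => unif (Lab T n (X.sz n))) (Dt n) (Dk n)) := by
  have hop := X.indist_game_of_TPFSecure hT (fun n => unif (Word (X.sz n) → T.G n))
    (fun n L₁ _ v => (L₁, v)) (fun n L₁ w => X.expressible_enc (L₁ w))
    (fun n _ => X.expressible_answer) Dt hDk
  simp only [unif_prod]
  exact hop

end Setting

/-! ## Replacing tags by values of a random function -/

section Chain

variable {Y : Type} (c : Server) (fc fd : Y → Y)

/-- The tag of an entry of the share of `s` after `u` rounds, where `fc` and `fd` are the tag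
functions of the corrupted and of the honest server. -/
def preTag (u : ℕ) (s : Server) (t : Y) : Y :=
  if s = c then (fun x => fc (fd x))^[u] t else (fun x => fd (fc x))^[u] t

/-- The tag after the refresh by the honest server in the next round. -/
def honTag (u : ℕ) (s : Server) (t : Y) : Y :=
  fd (if s = c then preTag c fc fd u s t else fc (preTag c fc fd u s t))

end Chain

section ChainRep

variable {W n B D : ℕ} {E : Env} {base : List ℕ} {fc fd : Fin (2 ^ n) → Fin (2 ^ n)}
  {ec ed : Expr → Expr} (c : Server)

/-- Applying `ef` to an expression applies `f` to its value, at the additional cost `D`. -/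
abbrev RepMap (W : ℕ) (E : Env) (base : List ℕ) (D : ℕ) (ef : Expr → Expr)
    (f : Fin (2 ^ n) → Fin (2 ^ n)) : Prop :=
  ∀ B e t, Rep W E base B e t.val → Rep W E base (B + D) (ef e) (f t).val

theorem RepMap.iterate {f : Fin (2 ^ n) → Fin (2 ^ n)} {ef : Expr → Expr}
    (hf : RepMap W E base D ef f) (u : ℕ) : RepMap W E base (u * D) ef^[u] f^[u] := by
  induction u with
  | zero => simp [RepMap]
  | succ u ih =>
    intro B e t h
    rw [Function.iterate_succ_apply, Function.iterate_succ_apply]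
    exact (ih _ _ _ (hf _ _ _ h)).mono (by rw [Nat.succ_mul]; lia)

theorem RepMap.comp {f g : Fin (2 ^ n) → Fin (2 ^ n)} {ef eg : Expr → Expr}
    (hf : RepMap W E base D ef f) (hg : RepMap W E base D eg g) :
    RepMap W E base (2 * D) (fun e => ef (eg e)) (fun x => f (g x)) :=
  fun B e t h => (hf _ _ _ (hg _ _ _ h)).mono (by lia)

theorem RepMap.preTag (hc : RepMap W E base D ec fc) (hd : RepMap W E base D ed fd) (u : ℕ)
    (s : Server) :
    RepMap W E base (u * (2 * D)) (preTag c ec ed u s) (preTag c fc fd u s) := by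
  unfold Brasp.preTag
  split_ifs
  · exact (hc.comp hd).iterate u
  · exact (hd.comp hc).iterate u

theorem RepMap.honTag (hc : RepMap W E base D ec fc) (hd : RepMap W E base D ed fd) (u : ℕ)
    (s : Server) :
    RepMap W E base (u * (2 * D) + 2 * D) (honTag c ec ed u s) (honTag c fc fd u s) := by
  intro B e t h
  have pre := hc.preTag c hd u s _ _ _ h
  unfold Brasp.honTag
  split_ifs
  · exact (hd _ _ _ pre).mono (by lia)
  · exact (hd _ _ _ (hc _ _ _ pre)).mono (by lia)

end ChainRep

namespace Setting

variable {T : TPF} (F : KeyedFun) (X : Setting T) (n : ℕ)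

/-- All tags, for given tag functions of the servers and initial tags. -/
def tagsOf (fc fd : Fin (2 ^ n) → Fin (2 ^ n)) (t : Server × Word (X.sz n) → Fin (2 ^ n)) :
    Tag n (X.sz n) :=
  (fun s w => preTag X.c fc fd (X.u n) s (t (s, w)),
    fun s w => honTag X.c fc fd (X.u n) s (t (s, w)))

/-- The string from which the initial tag is computed. -/
def tagInput (x : Server × Word (X.sz n)) : ℕ := Nat.pair x.1.num (X.word n x.2)

theorem tagInput_injective : Function.Injective (X.tagInput n) := by
  rintro ⟨s, w⟩ ⟨s', w'⟩ h
  obtain ⟨hs, hw⟩ := Nat.pair_eq_pair.1 h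
  obtain rfl := X.word_injective n hw
  cases s <;> cases s' <;> simp_all [Server.num]

/-- The real tags. -/
noncomputable def tagReal (κ : Fin (2 ^ n)) : PMF (Tag n (X.sz n)) :=
  (unif (Fin (2 ^ n))).bind fun κd => (unif (Fin (2 ^ n))).map fun kT =>
    X.tagsOf n (fun x => F n κ x.val) (fun x => F n κd x.val) fun x => F n kT (X.tagInput n x)

/-- The tags with random initial tags. -/
noncomputable def tagInit (κ : Fin (2 ^ n)) : PMF (Tag n (X.sz n)) :=
  (unif (Fin (2 ^ n))).bind fun κd =>
    (unif (Server × Word (X.sz n) → Fin (2 ^ n))).map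
      (X.tagsOf n (fun x => F n κ x.val) fun x => F n κd x.val)

/-- The tags with random initial tags and a random function of the honest server. -/
noncomputable def tagFun (κ : Fin (2 ^ n)) : PMF (Tag n (X.sz n)) :=
  (unif (Server × Word (X.sz n) → Fin (2 ^ n))).bind fun t =>
    (unif (Fin (2 ^ n) → Fin (2 ^ n))).map fun g => X.tagsOf n (fun x => F n κ x.val) g t

variable {F}

theorem indist_game_of_FSecure (hF : FSecure T F) {α Q : ℕ → Type} [∀ n, Finite (Q n)]
    {q : ∀ n, Q n → ℕ} (hq : ∀ n, Function.Injective (q n)) (hlt : ∀ n x, q n x < 2 ^ X.W n)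
    (p : ∀ n, PMF (α n)) (t : ∀ n, Fin (2 ^ n) → α n → (Q n → Fin (2 ^ n)) → Tag n (X.sz n))
    (h₁ : ∀ n κ a s w, X.Expressible F (q n) (fun x : Fin (2 ^ n) => x.val)
      fun (_ : T.Param n) v => ((t n κ a v).1 s w).val)
    (h₂ : ∀ n κ a s w, X.Expressible F (q n) (fun x : Fin (2 ^ n) => x.val)
      fun (_ : T.Param n) v => ((t n κ a v).2 s w).val)
    (L : ∀ n, PMF (Lab T n (X.sz n))) {Dk : ∀ n, PMF (Ciphers (X.sz n))}
    (hDk : ∀ n, ∀ ck ∈ (Dk n).support, InRange (X.W n) ck) :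
    Indist
      (fun n => X.game F n (fun _ => L n) (fun κ => (p n).bind fun a =>
        (unif (Fin (2 ^ n))).map fun k => t n κ a fun x => F n k (q n x)) (Dk n))
      (fun n => X.game F n (fun _ => L n) (fun κ => (p n).bind fun a =>
        (unif (Q n → Fin (2 ^ n))).map (t n κ a)) (Dk n)) := by
  have secure : PRFSecure T F (fun n (x : Fin (2 ^ n)) => x.val) (fun n _ k => F n k) := hF
  refine secure.indist hq X.polyBounded_bound fun n => ?_
  obtain ⟨a, b, m, κ, lab, ck, hck, le⟩ := X.exists_game_sub_le_tag F n (p n) (L n)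
    (fun κ a => (unif (Fin (2 ^ n))).map fun k => t n κ a fun x => F n k (q n x))
    (fun κ a => (unif (Q n → Fin (2 ^ n))).map (t n κ a)) (Dk n)
  obtain ⟨P, cost_le, le_cost, sim⟩ := X.exists_simulates b m κ (hDk n ck hck)
    (fun w => X.expressible_enc (lab.1 w)) (fun w => X.expressible_enc (lab.2 w))
    (h₁ n κ a) (h₂ n κ a)
  refine ⟨P, _, cost_le, fun x => (hlt n x).trans_le (by gcongr; simp), sim, ?_⟩
  simpa only [PMF.bind_map, Function.comp_def] using le

/-- `F` with an explicitly given key, as an expression. -/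
def prfExpr (k : ℕ) (e : Expr) : Expr := .call .prf (.const k) e

/-- The challenge oracle, as an expression. -/
def chalExpr (e : Expr) : Expr := .call .chal e (.const 0)

section Rep

variable {n} {pp : T.Param n} {chal : ℕ → ℕ} {base : List ℕ} {ec ed : Expr → Expr}
  {fc fd : Fin (2 ^ n) → Fin (2 ^ n)} {e : Expr} {t : Server × Word (X.sz n) → Fin (2 ^ n)}
  {s : Server} {w : Word (X.sz n)}

theorem repMap_prfExpr (κ : Fin (2 ^ n)) :
    RepMap (X.W n) (env T F n pp chal) base (2 * (X.W n + 1)) (prfExpr κ.val)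
      fun x => F n κ x.val := fun _ _ t h =>
  (Rep.call .prf (Rep.const (X.fin_lt κ)) h (prfNat_val F n κ t.val) (X.fin_lt _)).mono (by lia)

theorem repMap_chalExpr {g : Fin (2 ^ n) → Fin (2 ^ n)} (hg : ∀ x, chal x.val = (g x).val) :
    RepMap (X.W n) (env T F n pp chal) base (2 * (X.W n + 1)) chalExpr g := fun _ _ t h =>
  (Rep.call .chal h (Rep.const (Nat.two_pow_pos _)) (hg t) (X.fin_lt _)).mono (by lia)

theorem rep_tagsOf_fst
    (hc : RepMap (X.W n) (env T F n pp chal) base (2 * (X.W n + 1)) ec fc)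
    (hd : RepMap (X.W n) (env T F n pp chal) base (2 * (X.W n + 1)) ed fd)
    (h : Rep (X.W n) (env T F n pp chal) base (3 * (X.W n + 1)) e (t (s, w)).val) :
    Rep (X.W n) (env T F n pp chal) base (X.budget n) (preTag X.c ec ed (X.u n) s e)
      ((X.tagsOf n fc fd t).1 s w).val :=
  (hc.preTag X.c hd (X.u n) s _ _ _ h).mono (by unfold budget; nlinarith)

theorem rep_tagsOf_snd
    (hc : RepMap (X.W n) (env T F n pp chal) base (2 * (X.W n + 1)) ec fc)
    (hd : RepMap (X.W n) (env T F n pp chal) base (2 * (X.W n + 1)) ed fd)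
    (h : Rep (X.W n) (env T F n pp chal) base (3 * (X.W n + 1)) e (t (s, w)).val) :
    Rep (X.W n) (env T F n pp chal) base (X.budget n) (honTag X.c ec ed (X.u n) s e)
      ((X.tagsOf n fc fd t).2 s w).val :=
  (hc.honTag X.c hd (X.u n) s _ _ _ h).mono (by unfold budget; nlinarith)

end Rep

theorem indist_tagReal_tagInit (hF : FSecure T F) (L : ∀ n, PMF (Lab T n (X.sz n)))
    {Dk : ∀ n, PMF (Ciphers (X.sz n))}
    (hDk : ∀ n, ∀ ck ∈ (Dk n).support, InRange (X.W n) ck) :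
    Indist (fun n => X.game F n (fun _ => L n) (X.tagReal F n) (Dk n))
      (fun n => X.game F n (fun _ => L n) (X.tagInit F n) (Dk n)) := by
  have init_rep {n} (pp : T.Param n) (chal : ℕ → ℕ) (v : Server × Word (X.sz n) → Fin (2 ^ n))
      (hv : ∀ x, chal (X.tagInput n x) = (v x).val) (s w) :=
    X.rep_chal (F := F) (pp := pp) (base := []) (X.pair_lt n s w) (X.fin_lt _) (hv (s, w))
  exact X.indist_game_of_FSecure hF X.tagInput_injective (fun n x => X.pair_lt n x.1 x.2)
    (fun n => unif (Fin (2 ^ n)))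
    (fun n κ κd => X.tagsOf n (fun x => F n κ x.val) fun x => F n κd x.val)
    (fun _ κ κd s w => ⟨_, fun pp chal v hv =>
      X.rep_tagsOf_fst (X.repMap_prfExpr κ) (X.repMap_prfExpr κd) (init_rep pp chal v hv s w)⟩)
    (fun _ κ κd s w => ⟨_, fun pp chal v hv =>
      X.rep_tagsOf_snd (X.repMap_prfExpr κ) (X.repMap_prfExpr κd) (init_rep pp chal v hv s w)⟩)
    L hDk

theorem indist_tagInit_tagFun (hF : FSecure T F) (L : ∀ n, PMF (Lab T n (X.sz n)))
    {Dk : ∀ n, PMF (Ciphers (X.sz n))}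
    (hDk : ∀ n, ∀ ck ∈ (Dk n).support, InRange (X.W n) ck) :
    Indist (fun n => X.game F n (fun _ => L n) (X.tagInit F n) (Dk n))
      (fun n => X.game F n (fun _ => L n) (X.tagFun F n) (Dk n)) := by
  have swap : X.tagInit F = fun n κ =>
      (unif (Server × Word (X.sz n) → Fin (2 ^ n))).bind fun t => (unif (Fin (2 ^ n))).map
        fun κd => X.tagsOf n (fun x => F n κ x.val) (fun x => F n κd x.val) t :=
    funext₂ fun _ _ => PMF.bind_comm _ _ _
  have init_rep {n} (pp : T.Param n) (chal : ℕ → ℕ) (x : Fin (2 ^ n)) :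
      Rep (X.W n) (env T F n pp chal) [] (3 * (X.W n + 1)) (.const x.val) x.val :=
    (Rep.const (X.fin_lt x)).mono (by lia)
  rw [swap]
  exact X.indist_game_of_FSecure hF (fun _ => Fin.val_injective) (fun _ => X.fin_lt)
    (fun n => unif (Server × Word (X.sz n) → Fin (2 ^ n)))
    (fun n κ t g => X.tagsOf n (fun x => F n κ x.val) g t)
    (fun _ κ t s w => ⟨_, fun pp chal v hv => X.rep_tagsOf_fst (X.repMap_prfExpr κ)
      (X.repMap_chalExpr hv) (init_rep pp chal (t (s, w)))⟩)
    (fun _ κ t s w => ⟨_, fun pp chal v hv => X.rep_tagsOf_snd (X.repMap_prfExpr κ)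
      (X.repMap_chalExpr hv) (init_rep pp chal (t (s, w)))⟩)
    L hDk

end Setting

/-! ## Collisions of a pseudorandom function -/

section Collision

theorem prob_unif_eq_apply_snd {α : Type} [Finite α] [Nonempty α] [DecidableEq α] (f : α → α) :
    prob ((unif (α × α)).map fun v => decide (v.1 = f v.2)) = (Nat.card α : ℝ)⁻¹ := by
  rw [← unif_map_equiv (Equiv.prodComm α α), PMF.map_comp, unif_prod_map]
  change prob ((unif α).bind fun b => (unif α).map fun a => decide (a = f b)) = _
  rw [prob_bind]
  simp only [prob_unif_map_eq, tsum_mul_right]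
  rw [← ENNReal.tsum_toReal_eq (PMF.apply_ne_top _), PMF.tsum_coe, ENNReal.toReal_one, one_mul]

theorem prob_unif_apply_eq_apply {α : Type} [Finite α] [Nonempty α] [DecidableEq α]
    {x y : α} (hxy : x ≠ y) :
    prob ((unif (α → α)).map fun g => decide (g x = g y)) = (Nat.card α : ℝ)⁻¹ := by
  rw [← prob_unif_eq_apply_snd (id : α → α), ← unif_map_pair hxy, PMF.map_comp]
  rfl

/-- An expression with the value `1` if and only if the challenge oracle answers equally at `x` and
at `y`. As the subtraction is truncated, the sum of both differences vanishes in this case only. -/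
def collisionExpr (x y : ℕ) : Expr :=
  let a := Expr.call .chal (.const x) (.const 0)
  let b := Expr.call .chal (.const y) (.const 0)
  .arith .sub (.const 1) (.arith .add (.arith .sub a b) (.arith .sub b a))

theorem rep_collisionExpr {E : Env} {n x y gx gy : ℕ} (hx : x < 2 ^ n) (hy : y < 2 ^ n)
    (hgx : gx < 2 ^ n) (hgy : gy < 2 ^ n) (h₁ : E .chal x 0 = gx) (h₂ : E .chal y 0 = gy) :
    Rep (n + 1) E [] (17 * (n + 2)) (collisionExpr x y) (1 - ((gx - gy) + (gy - gx))) := by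
  have two_mul_pow : 2 ^ (n + 1) = 2 ^ n + 2 ^ n := by ring
  have a := Rep.call (W := n + 1) (base := []) .chal (Rep.const (by lia)) (Rep.const (by lia)) h₁
    (by lia)
  have b := Rep.call (W := n + 1) (base := []) .chal (Rep.const (by lia)) (Rep.const (by lia)) h₂
    (by lia)
  have distance := Rep.arith .add (Rep.arith .sub a b rfl (by simp only [Arith.eval]; lia))
    (Rep.arith .sub b a rfl (by simp only [Arith.eval]; lia)) rfl (by simp only [Arith.eval]; lia)
  exact (Rep.arith .sub (Rep.const (by lia)) distance rfl (by simp only [Arith.eval]; lia)).mono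
    (by lia)

theorem out_compile {W B : ℕ} {E : Env} {e : Expr} {v : ℕ} (h : Rep W E [] B e v) :
    Program.out (e.compile W 0) E [] = PMF.pure (decide (v = 1)) := by
  obtain ⟨l, hl⟩ := e.exists_trace_eq W E []
  have run := Expr.run_compile W E [] h.fits (s := []) (t := 0) rfl
  simp only [List.nil_append] at run
  rw [Program.out, run, PMF.pure_map, hl, h.eval]
  simp

variable {T : TPF} (F : KeyedFun) (n : ℕ)

/-- Whether `F` with a random key has a collision at two random points. -/
noncomputable def collisionReal : PMF Bool :=
  (unif (Fin (2 ^ n) × Fin (2 ^ n))).bind fun v => (unif (Fin (2 ^ n))).map fun κ =>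
    decide (F n κ v.1.val = F n κ v.2.val)

/-- Whether a random function has a collision at two random points. -/
noncomputable def collisionIdeal : PMF Bool :=
  (unif (Fin (2 ^ n) × Fin (2 ^ n))).bind fun v => (unif (Fin (2 ^ n) → Fin (2 ^ n))).map fun g =>
    decide (g v.1 = g v.2)

variable {F n}

theorem simulates_collisionExpr (x y : Fin (2 ^ n)) :
    Simulates T F (fun x : Fin (2 ^ n) => x.val) (fun x : Fin (2 ^ n) => x.val)
      ((collisionExpr x.val y.val).compile (n + 1) 0)
      fun (_ : T.Param n) g => PMF.pure (decide (g x = g y)) := by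
  intro pp chal g hg
  rw [out_compile (rep_collisionExpr x.is_lt y.is_lt (g x).is_lt (g y).is_lt (hg x) (hg y))]
  congr 2
  rw [Fin.ext_iff, eq_iff_iff]
  lia

theorem cost_collisionExpr_le (x y : Fin (2 ^ n)) :
    ((collisionExpr x.val y.val).compile (n + 1) 0).cost ≤ 17 * (n + 2) := by
  rw [Expr.cost_compile]
  exact (rep_collisionExpr (E := fun _ _ _ => 0) x.is_lt y.is_lt (Nat.two_pow_pos n)
    (Nat.two_pow_pos n) rfl rfl).cost

theorem le_cost_collisionExpr (x y : ℕ) : n ≤ ((collisionExpr x y).compile (n + 1) 0).cost := by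
  rw [Expr.cost_compile]
  simp only [collisionExpr, Expr.cost]
  lia

theorem indist_collision (hF : FSecure T F) : Indist (collisionReal F) collisionIdeal := by
  have secure : PRFSecure T F (fun n (x : Fin (2 ^ n)) => x.val) (fun n _ k => F n k) := hF
  refine secure.indist (Q := fun n => Fin (2 ^ n)) (fun _ => Fin.val_injective)
    ((polyBounded_const 17).mul (polyBounded_id.add (polyBounded_const 2))) fun n => ?_
  obtain ⟨v, -, le⟩ := exists_mem_support_abs_prob_sub_le
    (unif (Fin (2 ^ n) × Fin (2 ^ n)))
    (fun v : Fin (2 ^ n) × Fin (2 ^ n) => (unif (Fin (2 ^ n))).map fun κ =>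
       decide (F n κ v.1.val = F n κ v.2.val))
    (fun v : Fin (2 ^ n) × Fin (2 ^ n) => (unif (Fin (2 ^ n) → Fin (2 ^ n))).map
      fun g : Fin (2 ^ n) → Fin (2 ^ n) => decide (g v.1 = g v.2))
  refine ⟨_, _, cost_collisionExpr_le v.1 v.2, fun z => z.is_lt.trans_le ?_,
    simulates_collisionExpr v.1 v.2, le.trans_eq ?_⟩
  · gcongr
    · simp
    · exact le_cost_collisionExpr _ _
  · rw [PMF.bind_const, PMF.bind_const]
    rfl

theorem prob_collisionIdeal_le : prob (collisionIdeal n) ≤ 2 * ((2 : ℝ) ^ n)⁻¹ := by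
  have distinct (v : Fin (2 ^ n) × Fin (2 ^ n)) (hv : decide (v.1 = id v.2) = false) :
      prob ((unif (Fin (2 ^ n) → Fin (2 ^ n))).map fun g => decide (g v.1 = g v.2)) ≤
        ((2 : ℝ) ^ n)⁻¹ := by
    rw [prob_unif_apply_eq_apply (by simpa using hv)]
    simp
  have union := prob_bind_le_prob_map_add (unif (Fin (2 ^ n) × Fin (2 ^ n))) _ _
    (by positivity) distinct
  rw [prob_unif_eq_apply_snd, Nat.card_fin, Nat.cast_pow, Nat.cast_ofNat] at union
  exact union.trans_eq (two_mul _).symm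

theorem negligible_prob_collisionReal (hF : FSecure T F) :
    Negligible fun n => prob (collisionReal F n) :=
  ((indist_collision hF).add (negligible_two_pow_inv.const_mul 2)).mono
    (fun _ => prob_nonneg _) fun n => by
      have close := le_abs_self (prob (collisionReal F n) - prob (collisionIdeal n))
      have ideal := prob_collisionIdeal_le (n := n)
      linarith

end Collision

/-! ## Chains of random tags -/

section Tape

variable {Y : Type} (c : Server) (fc : Y → Y)

/-- The argument of the tag function of the honest server in round `j` on an entry of the share of
`s`, where `x` is its previous value. The corrupted server comes in between except in round `0` on
its own share. -/
def honestInput (s : Server) (j : ℕ) (x : Y) : Y := if s = c ∧ j = 0 then x else fc x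

/-- The initial tag `t` and the successive values of the tag function `g` of the honest server. -/
def honestChain (g : Y → Y) (s : Server) (t : Y) : ℕ → Y
  | 0 => t
  | j + 1 => g (honestInput c fc s j (honestChain g s t j))

theorem preTag_eq (g : Y → Y) (u : ℕ) (s : Server) (t : Y) :
    preTag c fc g u s t =
      if s = c then honestInput c fc s u (honestChain c fc g s t u)
      else honestChain c fc g s t u := by
  unfold preTag
  split_ifs with own
  · induction u with
    | zero => simp [honestInput, honestChain, own]
    | succ u ih =>
      rw [Function.iterate_succ_apply', ih]
      simp [honestInput, honestChain]
  · induction u with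
    | zero => simp [honestChain]
    | succ u ih =>
      rw [Function.iterate_succ_apply', ih]
      simp [honestInput, honestChain, own]

theorem honTag_eq (g : Y → Y) (u : ℕ) (s : Server) (t : Y) :
    honTag c fc g u s t = honestChain c fc g s t (u + 1) := by
  rw [honTag, preTag_eq, honestChain]
  split_ifs with own
  · rfl
  · simp [honestInput, own]

variable {A : Type} (srv : A → Server) (u : ℕ)

/-- The chains of all entries, where the entry `a` belongs to the share of `srv a`. -/
def chainTape (t : A → Y) (g : Y → Y) : A × Fin (u + 2) → Y :=
  fun x => honestChain c fc g (srv x.1) (t x.1) x.2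

/-- All arguments of the tag function of the honest server. -/
def inputs (z : A × Fin (u + 2) → Y) (x : A × Fin (u + 1)) : Y :=
  honestInput c fc (srv x.1) x.2 (z (x.1, x.2.castSucc))

theorem chainTape_eq_iff (t : A → Y) (g : Y → Y) (z : A × Fin (u + 2) → Y) :
    chainTape c fc srv u t g = z ↔
      (t = fun a => z (a, 0)) ∧
        (fun x => g (inputs c fc srv u z x)) = fun x : A × Fin (u + 1) => z (x.1, x.2.succ) := by
  constructor
  · rintro rfl
    exact ⟨rfl, rfl⟩
  · rintro ⟨rfl, step⟩
    funext ⟨a, j⟩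
    induction j using Fin.induction with
    | zero => rfl
    | succ j ih =>
      rw [← congrFun step (a, j)]
      change g (honestInput c fc (srv a) j _) = g (honestInput c fc (srv a) j _)
      rw [← ih]
      rfl

variable [Finite A] [Finite Y] [Nonempty Y]

/-- The distribution of the chains for random initial tags and a random function. -/
noncomputable def chainDist : PMF (A × Fin (u + 2) → Y) :=
  (unif (A → Y)).bind fun t => (unif (Y → Y)).map (chainTape c fc srv u t)

theorem chainDist_apply_of_injective (z : A × Fin (u + 2) → Y)
    (hz : Function.Injective (inputs c fc srv u z)) :
    chainDist c fc srv u z = unif (A × Fin (u + 2) → Y) z := by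
  classical
  have wrong_start (t) (ht : t ≠ fun a => z (a, 0)) :
      unif (A → Y) t * ((unif (Y → Y)).map (chainTape c fc srv u t)) z = 0 := by
    simp [PMF.map_apply, eq_comm (a := z), chainTape_eq_iff, ht]
  -- At distinct arguments a random function has independent values.
  have right_start : ((unif (Y → Y)).map (chainTape c fc srv u fun a => z (a, 0))) z =
      unif (A × Fin (u + 1) → Y) fun x => z (x.1, x.2.succ) := by
    rw [← unif_map_comp (R := Y) _ hz]
    simp only [PMF.map_apply, eq_comm (a := z), chainTape_eq_iff, true_and]
    exact tsum_congr fun g => if_congr eq_comm rfl rfl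
  rw [chainDist, PMF.bind_apply, tsum_eq_single _ wrong_start, right_start]
  simp only [unif_apply, Nat.card_fun, Nat.card_prod, Nat.card_fin]
  rw [← ENNReal.mul_inv (.inr (ENNReal.natCast_ne_top _)) (.inl (ENNReal.natCast_ne_top _)),
    ← Nat.cast_mul, ← pow_add]
  congr 3
  ring

end Tape

/-! ## Replacing values of a random function by fresh tags -/

namespace Setting

variable {T : TPF} (F : KeyedFun) (X : Setting T) (n : ℕ)

/-- Values for the chains of all entries: the initial tag, and one value of the tag function of the
honest server for each previous round and for the challenge round. -/
abbrev Tape : Type := (Server × Word (X.sz n)) × Fin (X.u n + 2) → Fin (2 ^ n)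

/-- The arguments of the tag function of the honest server for given values. -/
abbrev tapeInputs (κ : Fin (2 ^ n)) (z : X.Tape n) :
    (Server × Word (X.sz n)) × Fin (X.u n + 1) → Fin (2 ^ n) :=
  inputs X.c (fun x => F n κ x.val) Prod.fst (X.u n) z

/-- The tags, as a function of the initial tags and all values of the tag function of the honest
server. -/
def tapeTags (κ : Fin (2 ^ n)) (z : X.Tape n) : Tag n (X.sz n) :=
  (fun s w => if s = X.c then
      honestInput X.c (fun x => F n κ x.val) s (X.u n) (z ((s, w), (Fin.last _).castSucc))
    else z ((s, w), (Fin.last _).castSucc),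
    fun s w => z ((s, w), Fin.last _))

/-- The tags for independent random values. -/
noncomputable def tagIdeal (κ : Fin (2 ^ n)) : PMF (Tag n (X.sz n)) :=
  (unif (X.Tape n)).map (X.tapeTags F n κ)

theorem tagFun_eq (κ : Fin (2 ^ n)) :
    X.tagFun F n κ =
      (chainDist X.c (fun x => F n κ x.val) Prod.fst (X.u n)).map (X.tapeTags F n κ) := by
  have tags (t g) : X.tagsOf n (fun x => F n κ x.val) g t =
      X.tapeTags F n κ (chainTape X.c (fun x => F n κ x.val) Prod.fst (X.u n) t g) := by
    simp only [tagsOf, preTag_eq, honTag_eq]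
    rfl
  simp only [tagFun, chainDist, PMF.map_bind, PMF.map_comp, tags]
  rfl

open Classical in
/-- Some argument of the tag function of the honest server is repeated. -/
noncomputable def repeats (κ : Fin (2 ^ n)) (z : X.Tape n) : Bool :=
  decide ¬ Function.Injective (X.tapeInputs F n κ z)

theorem abs_prob_game_tagFun_sub_tagIdeal_le (Dl : T.Param n → PMF (Lab T n (X.sz n)))
    (Dk : PMF (Ciphers (X.sz n))) :
    |prob (X.game F n Dl (X.tagFun F n) Dk) - prob (X.game F n Dl (X.tagIdeal F n) Dk)| ≤
      prob ((unif (Fin (2 ^ n))).bind fun κ => (unif (X.Tape n)).map (X.repeats F n κ)) := by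
  obtain ⟨b, -, hb⟩ := exists_mem_support_abs_prob_sub_le (unif Bool) _ _
  obtain ⟨m, -, hm⟩ := exists_mem_support_abs_prob_sub_le (unif (Misc T n (X.sz n))) _ _
  refine hb.trans (hm.trans (abs_prob_bind_sub_le _ _ _ _ fun κ => ?_))
  rw [tagFun_eq, tagIdeal, PMF.bind_map, PMF.bind_map]
  exact abs_prob_bind_sub_le_of_eq_off
    (fun z hz => chainDist_apply_of_injective _ _ _ _ z (by simpa [repeats] using hz)) _

/-- A bound for the probability that two given arguments agree. -/
noncomputable def pairBound (n : ℕ) : ℝ := prob (collisionReal F n) + ((2 : ℝ) ^ n)⁻¹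

theorem prob_honestInput_eq_le (s s' : Server) (j j' : ℕ) :
    prob ((unif (Fin (2 ^ n))).bind fun κ => (unif (Fin (2 ^ n) × Fin (2 ^ n))).map fun v =>
      decide (honestInput X.c (fun x => F n κ x.val) s j v.1 =
        honestInput X.c (fun x => F n κ x.val) s' j' v.2)) ≤ pairBound F n := by
  have bound_of_uniform_side (f : Fin (2 ^ n) → Fin (2 ^ n)) :
      prob ((unif (Fin (2 ^ n) × Fin (2 ^ n))).map fun v => decide (v.1 = f v.2)) ≤
        pairBound F n := by
    rw [prob_unif_eq_apply_snd, Nat.card_fin, Nat.cast_pow, Nat.cast_ofNat]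
    exact le_add_of_nonneg_left (prob_nonneg _)
  by_cases h : s = X.c ∧ j = 0
  · refine prob_bind_le _ _ fun κ => ?_
    simp only [honestInput, h, and_self, if_true]
    exact bound_of_uniform_side fun x => if s' = X.c ∧ j' = 0 then x else F n κ x.val
  by_cases h' : s' = X.c ∧ j' = 0
  · refine prob_bind_le _ _ fun κ => ?_
    simp only [honestInput, h', and_self, if_true]
    rw [← unif_map_equiv (Equiv.prodComm (Fin (2 ^ n)) (Fin (2 ^ n))), PMF.map_comp]
    simp only [Function.comp_def, Equiv.prodComm_apply, Prod.fst_swap, Prod.snd_swap,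
      eq_comm (b := Prod.fst _)]
    exact bound_of_uniform_side fun x => if s = X.c ∧ j = 0 then x else F n κ x.val
  · simp only [honestInput, h, h', if_false]
    exact (congrArg prob (PMF.bind_comm _ _ _)).trans_le
      (le_add_of_nonneg_right (by positivity))

theorem prob_tapeInputs_eq_le {x y : (Server × Word (X.sz n)) × Fin (X.u n + 1)} (hxy : x ≠ y) :
    prob ((unif (Fin (2 ^ n))).bind fun κ => (unif (X.Tape n)).map fun z =>
      decide (X.tapeInputs F n κ z x = X.tapeInputs F n κ z y)) ≤ pairBound F n := by
  have distinct : (x.1, x.2.castSucc) ≠ (y.1, y.2.castSucc) := fun h =>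
    hxy (Prod.ext (Prod.mk.inj h).1 (Fin.castSucc_injective _ (Prod.mk.inj h).2))
  have pair := X.prob_honestInput_eq_le F n x.1.1 y.1.1 x.2 y.2
  rw [← unif_map_pair distinct] at pair
  simp only [PMF.map_comp] at pair
  exact pair

theorem card_word_le : Fintype.card (Word (X.sz n)) ≤ X.W n + X.W n := by
  rw [Fintype.card_sigma]
  simp only [Fintype.card_fin]
  exact add_le_add (X.sz_le n .pref) (X.sz_le n .keyword)

/-- A bound for the number of arguments of the tag function of the honest server. -/
def numInputs (n : ℕ) : ℕ := 2 * (X.W n + X.W n) * (X.u n + 1)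

theorem prob_repeats_le :
    prob ((unif (Fin (2 ^ n))).bind fun κ => (unif (X.Tape n)).map (X.repeats F n κ)) ≤
      (X.numInputs n * X.numInputs n : ℕ) * pairBound F n := by
  classical
  let I := (Server × Word (X.sz n)) × Fin (X.u n + 1)
  have exists_pair (v : Fin (2 ^ n) × X.Tape n) (hv : X.repeats F n v.1 v.2 = true) :
      ∃ p : {p : I × I // p.1 ≠ p.2},
        decide (X.tapeInputs F n v.1 v.2 p.1.1 = X.tapeInputs F n v.1 v.2 p.1.2) = true := by
    obtain ⟨x, y, eq, ne⟩ := Function.not_injective_iff.1 (of_decide_eq_true hv)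
    exact ⟨⟨(x, y), ne⟩, decide_eq_true eq⟩
  have pair_le (p : {p : I × I // p.1 ≠ p.2}) :
      prob ((unif (Fin (2 ^ n) × X.Tape n)).map fun v =>
        decide (X.tapeInputs F n v.1 v.2 p.1.1 = X.tapeInputs F n v.1 v.2 p.1.2)) ≤
          pairBound F n := by
    rw [unif_prod_map]
    exact X.prob_tapeInputs_eq_le F n p.2
  have card_le : Fintype.card {p : I × I // p.1 ≠ p.2} ≤ X.numInputs n * X.numInputs n := by
    refine (Fintype.card_subtype_le _).trans ?_
    have words := X.card_word_le n
    have servers : Fintype.card Server = 2 := rfl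
    simp only [I, numInputs, Fintype.card_prod, Fintype.card_fin, servers]
    gcongr
  rw [← unif_prod_map fun v : Fin (2 ^ n) × X.Tape n => X.repeats F n v.1 v.2]
  refine (prob_map_exists_le _ _ _ exists_pair).trans
    ((Finset.sum_le_card_nsmul _ _ _ fun p _ => pair_le p).trans ?_)
  rw [nsmul_eq_mul, Finset.card_univ]
  have nonneg : 0 ≤ pairBound F n := add_nonneg (prob_nonneg _) (by positivity)
  gcongr

variable {F}

theorem indist_tagFun_tagIdeal (hF : FSecure T F)
    (Dl : ∀ n, T.Param n → PMF (Lab T n (X.sz n))) (Dk : ∀ n, PMF (Ciphers (X.sz n))) :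
    Indist (fun n => X.game F n (Dl n) (X.tagFun F n) (Dk n))
      (fun n => X.game F n (Dl n) (X.tagIdeal F n) (Dk n)) := by
  have poly : PolyBounded X.numInputs :=
    ((polyBounded_const 2).mul (X.W_poly.add X.W_poly)).mul (X.u_poly.add (polyBounded_const 1))
  exact (((negligible_prob_collisionReal hF).add negligible_two_pow_inv).poly_mul
    (poly.mul poly)).mono (fun _ => abs_nonneg _) fun n =>
      (X.abs_prob_game_tagFun_sub_tagIdeal_le F n (Dl n) (Dk n)).trans (X.prob_repeats_le F n)

end Setting

/-! ## Paillier re-encryption -/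

section Paillier

variable {N m : ℕ}

theorem turEnc_lt (hN : N ≠ 0) (m : ℕ) (r : (ZMod N)ˣ) : turEnc N m r < N ^ 2 :=
  Nat.mod_lt _ (by positivity)

theorem turReEnc_turEnc (hN : N ≠ 0) (m : ℕ) (r₀ r : (ZMod N)ˣ) :
    turReEnc N (turEnc N m r₀) r = turEnc N m (r₀ * r) := by
  have : NeZero N := ⟨hN⟩
  have mul_modEq : r₀.val.val * r.val.val ≡ (r₀ * r).val.val [MOD N] := by
    rw [Units.val_mul, ZMod.val_mul]
    exact (Nat.mod_modEq _ _).symm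
  have pow_modEq : (r₀.val.val * r.val.val) ^ N ≡ (r₀ * r).val.val ^ N [MOD N ^ 2] := by
    rw [Nat.modEq_iff_dvd] at mul_modEq ⊢
    simpa using dvd_sub_pow_of_dvd_sub mul_modEq 1
  rw [turReEnc, turEnc, turEnc, turEnc, pow_zero, one_mul]
  change _ ≡ _ [MOD N ^ 2]
  calc (1 + N) ^ m * r₀.val.val ^ N % N ^ 2 * (r.val.val ^ N % N ^ 2)
      ≡ (1 + N) ^ m * r₀.val.val ^ N * r.val.val ^ N [MOD N ^ 2] :=
        (Nat.mod_modEq _ _).mul (Nat.mod_modEq _ _)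
    _ = (1 + N) ^ m * (r₀.val.val * r.val.val) ^ N := by ring
    _ ≡ (1 + N) ^ m * (r₀ * r).val.val ^ N [MOD N ^ 2] := pow_modEq.mul_left _

theorem unif_bind_turReEnc {α : Type*} (hN : N ≠ 0) (m : ℕ) (r₀ : (ZMod N)ˣ) (g : ℕ → PMF α) :
    ((unif (ZMod N)ˣ).bind fun r => g (turReEnc N (turEnc N m r₀) r)) =
      (unif (ZMod N)ˣ).bind fun r => g (turEnc N m r) := by
  simp only [turReEnc_turEnc hN]
  exact unif_bind_equiv (Equiv.mulLeft r₀) fun r => g (turEnc N m r)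

end Paillier

theorem lt_two_pow_of_mem_support_turSetup {n : ℕ} {pq : ℕ × ℕ} (h : pq ∈ (turSetup n).support) :
    pq.1 ≠ 0 ∧ pq.2 ≠ 0 ∧ pq.1 < 2 ^ (n + 3) ∧ pq.2 < 2 ^ (n + 3) := by
  rw [turSetup] at h
  split_ifs at h
  · simp only [PMF.mem_support_uniformOfFinset_iff, primePairs, Finset.mem_filter,
      Finset.mem_product, Finset.mem_range] at h
    obtain ⟨⟨hp, hq⟩, -, -, hp', hq', -⟩ := h
    have mono : 2 ^ n ≤ 2 ^ (n + 3) := Nat.pow_le_pow_right two_pos (Nat.le_add_right n 3)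
    exact ⟨hp'.ne_zero, hq'.ne_zero, hp.trans_le mono, hq.trans_le mono⟩
  · simp only [PMF.support_pure, Set.mem_singleton_iff] at h
    have mono : 2 ^ 3 ≤ 2 ^ (n + 3) := Nat.pow_le_pow_right two_pos (Nat.le_add_left 3 n)
    subst h
    exact ⟨by simp, by simp, by simp only; lia, by simp only; lia⟩

/-- The distribution of the public key and the partial decryption key of `c`. -/
noncomputable def keyDist (S : KeySplit) (n : ℕ) (c : Server) : PMF (ℕ × ℕ) :=
  (turSetup n).bind fun pq => (S.keyGen n pq.1 pq.2).map fun pdk => (pq.1 * pq.2, pdk c)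

section KeyDist

variable {S : KeySplit} {n : ℕ} {c : Server}

theorem mem_support_keyDist {pq : ℕ × ℕ} {pdk : Server → ℕ} (hpq : pq ∈ (turSetup n).support)
    (hpdk : pdk ∈ (S.keyGen n pq.1 pq.2).support) :
    (pq.1 * pq.2, pdk c) ∈ (keyDist S n c).support :=
  (PMF.mem_support_bind_iff _ _ _).2 ⟨pq, hpq, (PMF.mem_support_map_iff _ _ _).2 ⟨pdk, hpdk, rfl⟩⟩

theorem keyDist_range {key : ℕ × ℕ} (h : key ∈ (keyDist S n c).support) :
    key.1 ≠ 0 ∧ key.1 ^ 4 < 2 ^ (8 * n + 24) ∧ key.2 < 2 ^ S.len n := by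
  rw [keyDist, PMF.mem_support_bind_iff] at h
  obtain ⟨pq, hpq, h⟩ := h
  rw [PMF.mem_support_map_iff] at h
  obtain ⟨pdk, hpdk, rfl⟩ := h
  obtain ⟨hp, hq, hp', hq'⟩ := lt_two_pow_of_mem_support_turSetup hpq
  refine ⟨mul_ne_zero hp hq, ?_, Nat.size_le.1 (S.pdk_size n pq hpq pdk hpdk c)⟩
  calc (pq.1 * pq.2) ^ 4 < (2 ^ (n + 3) * 2 ^ (n + 3)) ^ 4 :=
        Nat.pow_lt_pow_left (Nat.mul_lt_mul'' hp' hq') (by simp)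
    _ = 2 ^ (8 * n + 24) := by ring

end KeyDist

/-! ## Programs that sample units and encrypt -/

theorem run_sampleUnits (E : Env) {W N : ℕ} (hN : N ≠ 0) (hW : N < 2 ^ W) (M : ℕ)
    (l : List ℕ) :
    Program.run E (List.replicate M (.sampleUnit W 0)) (N :: l) =
      (unif (Fin M → (ZMod N)ˣ)).map fun ρ => (N :: l) ++ List.ofFn fun j => (ρ j).val.val := by
  have : NeZero N := ⟨hN⟩
  have eval_sample (l : List ℕ) : Instr.eval E (N :: l) (.sampleUnit W 0) =
      (unif (ZMod N)ˣ).map fun x => x.val.val := by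
    change ((unif (ZMod N)ˣ).map fun x => x.val.val % 2 ^ W) = _
    congr 1
    funext x
    exact Nat.mod_eq_of_lt ((ZMod.val_lt _).trans hW)
  induction M generalizing l with
  | zero =>
    simp only [List.replicate_zero, Program.run, List.ofFn_zero, List.append_nil]
    exact (PMF.map_const _ _).symm
  | succ M ih =>
    rw [List.replicate_succ, Program.run, eval_sample, PMF.bind_map,
      ← unif_map_equiv (Fin.consEquiv fun _ : Fin (M + 1) => (ZMod N)ˣ), PMF.map_comp,
      unif_prod_map]
    congr 1
    funext x
    rw [Function.comp, List.cons_append, ih]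
    congr 1
    funext ρ
    simp [Fin.consEquiv, List.ofFn_succ]

/-- The expression for Paillier encryption of the plaintext `m`. -/
def encExpr (N : Expr) (m : ℕ) (r : Expr) : Expr :=
  .arith .mod (.arith .mul (.powMod (.arith .add (.const 1) N) (.const m) (.arith .mul N N))
    (.powMod r N (.arith .mul N N))) (.arith .mul N N)

theorem rep_encExpr {W N m : ℕ} {E : Env} {base : List ℕ} {eN er : Expr} (hN : N ≠ 0)
    (hN4 : N ^ 4 < 2 ^ W) (hN1 : 1 + N < 2 ^ W) (hm : m < 2 ^ W) {r : (ZMod N)ˣ}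
    (heN : Rep W E base (W + 1) eN N) (her : Rep W E base (W + 1) er r.val.val) :
    Rep W E base (19 * (W + 1)) (encExpr eN m er) (turEnc N m r) := by
  have sq_pos : 0 < N ^ 2 := by positivity
  have sq_lt : N ^ 2 < 2 ^ W :=
    (Nat.pow_le_pow_right (Nat.pos_of_ne_zero hN) (by simp)).trans_lt hN4
  have mod_lt (x : ℕ) : x % N ^ 2 < 2 ^ W := (Nat.mod_lt _ sq_pos).trans sq_lt
  have mul_lt (x y : ℕ) : x % N ^ 2 * (y % N ^ 2) < 2 ^ W :=
    (Nat.mul_lt_mul'' (Nat.mod_lt _ sq_pos) (Nat.mod_lt _ sq_pos)).trans (by rwa [← pow_add])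
  have modulus : Rep W E base (3 * (W + 1)) (.arith .mul eN eN) (N ^ 2) :=
    (Rep.arith .mul heN heN (sq N).symm sq_lt).mono (by lia)
  have generator : Rep W E base (3 * (W + 1)) (.arith .add (.const 1) eN) (1 + N) :=
    (Rep.arith .add (Rep.const (by lia)) heN rfl hN1).mono (by lia)
  exact (Rep.arith .mod (Rep.arith .mul (Rep.powMod generator (Rep.const hm) modulus rfl (mod_lt _))
    (Rep.powMod her heN modulus rfl (mod_lt _)) rfl (mul_lt _ _)) modulus
    (Nat.mul_mod _ _ _).symm (mod_lt _)).mono (by lia)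

/-! ## Changing a plaintext -/

/-- The randomizers of all entries: of the ciphertexts before the round, of those after the refresh
by the honest server, and of the refresh by the corrupted server. -/
abbrev Randomizers (N : ℕ) (sz : Kind → ℕ) : Type := Fin 3 × Server × Word sz → (ZMod N)ˣ

section Ciphers

variable {sz : Kind → ℕ}

/-- The ciphertexts of the plaintexts `m₁` before the round and `m₂` after the refresh by the
honest server. -/
def encryptAll (m₁ m₂ : Server → Word sz → ℕ) (key : ℕ × ℕ) (R : Randomizers key.1 sz) :
    Ciphers sz where
  N := key.1
  pdk := key.2
  ct₁ s w := turEnc key.1 (m₁ s w) (R (0, s, w))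
  ct₂ s w := turEnc key.1 (m₂ s w) (R (1, s, w))
  coin s w := (R (2, s, w)).val.val

/-- The ciphertexts `ck`, where `C` takes the place of the one of the entry `x` after the refresh by
the honest server. -/
def Ciphers.replace (ck : Ciphers sz) (x : Server × Word sz) (C : ℕ) : Ciphers sz :=
  { ck with ct₂ := fun s w => if (s, w) = x then C else ck.ct₂ s w }

/-- The distribution of `encryptAll` for random keys and randomizers. -/
noncomputable def cipherDist (S : KeySplit) (n : ℕ) (c : Server) (m₁ m₂ : Server → Word sz → ℕ) :
    PMF (Ciphers sz) :=
  (keyDist S n c).bind fun key => (unif (Randomizers key.1 sz)).map (encryptAll m₁ m₂ key)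

theorem InRange.one_add_N_lt {W : ℕ} {ck : Ciphers sz} (h : InRange W ck) (hW : 2 ≤ W) :
    1 + ck.N < 2 ^ W := by
  have four_le : 2 ^ 2 ≤ 2 ^ W := Nat.pow_le_pow_right two_pos hW
  obtain N_le | N_gt := Nat.lt_or_ge ck.N 2
  · lia
  · nlinarith [h.N4, Nat.pow_le_pow_left N_gt 3]

theorem InRange.replace {W : ℕ} {ck : Ciphers sz} (h : InRange W ck) (x : Server × Word sz) {C : ℕ}
    (hC : C < ck.N ^ 2) : InRange W (ck.replace x C) where
  __ := h
  ct₂ s w := by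
    simp only [Ciphers.replace]
    split_ifs
    exacts [hC, h.ct₂ s w]

variable {S : KeySplit} {n W : ℕ} {c : Server} (m₁ m₂ : Server → Word sz → ℕ)

theorem inRange_encryptAll (hW : 8 * n + 24 + S.len n ≤ W) {key : ℕ × ℕ}
    (hkey : key ∈ (keyDist S n c).support) (R : Randomizers key.1 sz) :
    InRange W (encryptAll m₁ m₂ key R) := by
  obtain ⟨hN, hN4, hpdk⟩ := keyDist_range hkey
  have : NeZero key.1 := ⟨hN⟩
  have N4 : key.1 ^ 4 < 2 ^ W := hN4.trans_le (Nat.pow_le_pow_right two_pos (by lia))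
  exact ⟨hN, N4, hpdk.trans_le (Nat.pow_le_pow_right two_pos (by lia)),
    fun _ _ => turEnc_lt hN _ _, fun _ _ => turEnc_lt hN _ _,
    fun _ _ => (ZMod.val_lt _).trans ((Nat.le_self_pow (by simp) _).trans_lt N4)⟩

theorem inRange_cipherDist (hW : 8 * n + 24 + S.len n ≤ W) :
    ∀ ck ∈ (cipherDist S n c m₁ m₂).support, InRange W ck := by
  intro ck hck
  obtain ⟨key, hkey, hck⟩ := (PMF.mem_support_bind_iff _ _ _).1 hck
  obtain ⟨R, -, rfl⟩ := (PMF.mem_support_map_iff _ _ _).1 hck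
  exact inRange_encryptAll m₁ m₂ hW hkey R

variable {m₁ m₂}

theorem replace_encryptAll {μ : Server → Word sz → ℕ} {x : Server × Word sz}
    (hμ : ∀ s w, (s, w) ≠ x → μ s w = m₂ s w) (key : ℕ × ℕ) (R : Randomizers key.1 sz)
    (r : (ZMod key.1)ˣ) :
    (encryptAll m₁ m₂ key R).replace x (turEnc key.1 (μ x.1 x.2) r) =
      encryptAll m₁ μ key (Function.update R (1, x) r) := by
  simp only [encryptAll, Ciphers.replace, Ciphers.mk.injEq, true_and]
  refine ⟨?_, ?_, ?_⟩
  · funext s w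
    rw [Function.update_of_ne (by simp)]
  · funext s w
    split_ifs with h
    · subst h
      rw [Function.update_self]
    · rw [Function.update_of_ne (by simpa using h), hμ s w h]
  · funext s w
    rw [Function.update_of_ne (by simp)]

theorem bind_replace_encryptAll {μ : Server → Word sz → ℕ} {x : Server × Word sz}
    (hμ : ∀ s w, (s, w) ≠ x → μ s w = m₂ s w) (f : Ciphers sz → PMF Bool) :
    ((keyDist S n c).bind fun key => (unif (ZMod key.1)ˣ).bind fun r =>
      (unif (Randomizers key.1 sz)).bind fun R =>
        f ((encryptAll m₁ m₂ key R).replace x (turEnc key.1 (μ x.1 x.2) r))) =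
      (cipherDist S n c m₁ μ).bind f := by
  simp only [replace_encryptAll hμ, cipherDist, PMF.bind_bind, PMF.bind_map]
  congr 1
  funext key
  exact unif_bind_update (1, x) (f ∘ encryptAll m₁ μ key)

end Ciphers

/-! ## The linking adversary -/

namespace Setting

variable {T : TPF} {F : KeyedFun} (X : Setting T) (n : ℕ)

/-- The number of sampled randomizers. -/
def numUnits : ℕ := Fintype.card (Fin 3 × Server × Word (X.sz n))

/-- The order in which the randomizers are sampled. -/
noncomputable def unitEquiv : Fin 3 × Server × Word (X.sz n) ≃ Fin (X.numUnits n) :=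
  Fintype.equivFin _

/-- The register of a sampled randomizer; the first five registers hold the input. -/
noncomputable def unitReg (i : Fin 3 × Server × Word (X.sz n)) : Expr :=
  .reg (5 + (X.unitEquiv n i).val)

/-- The registers of the linking adversary once all randomizers are sampled. -/
noncomputable def linkRegs {N : ℕ} (pdk C₀ C₁ C : ℕ) (R : Randomizers N (X.sz n)) : List ℕ :=
  [N, pdk, C₀, C₁, C] ++
    List.ofFn fun j : Fin (X.numUnits n) => (R ((X.unitEquiv n).symm j)).val.val

/-- The inputs of the view in the linking adversary, whose last input is used as the ciphertext of
the entry `x` after the refresh by the honest server. -/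
noncomputable def linkInputs (m₁ m₂ : Server → Word (X.sz n) → ℕ) (x : Server × Word (X.sz n))
    (lab : Lab T n (X.sz n)) (tag : Tag n (X.sz n)) : Inputs Expr (X.sz n) where
  N := .reg 0
  pdk := .reg 1
  lab₁ w := .const (T.enc n (lab.1 w))
  lab₂ w := .const (T.enc n (lab.2 w))
  tag₁ s w := .const (tag.1 s w).val
  tag₂ s w := .const (tag.2 s w).val
  ct₁ s w := encExpr (.reg 0) (m₁ s w) (X.unitReg n (0, s, w))
  ct₂ s w := if (s, w) = x then .reg 4 else encExpr (.reg 0) (m₂ s w) (X.unitReg n (1, s, w))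
  coin s w := X.unitReg n (2, s, w)

/-- The linking adversary: it samples all randomizers and runs the adversary on the view. -/
noncomputable def linkProg (m₁ m₂ : Server → Word (X.sz n) → ℕ) (x : Server × Word (X.sz n))
    (b : Bool) (m : Misc T n (X.sz n)) (κ : Fin (2 ^ n)) (lab : Lab T n (X.sz n))
    (tag : Tag n (X.sz n)) : Program :=
  List.replicate (X.numUnits n) (.sampleUnit (X.W n) 0) ++
    X.reduction n (5 + X.numUnits n) b m κ (X.linkInputs n m₁ m₂ x lab tag)

section

variable {n} {S : KeySplit} {m₁ m₂ : Server → Word (X.sz n) → ℕ} {x : Server × Word (X.sz n)}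
  {b : Bool} {m : Misc T n (X.sz n)} {κ : Fin (2 ^ n)} {lab : Lab T n (X.sz n)}
  {tag : Tag n (X.sz n)} {key : ℕ × ℕ}

theorem length_linkRegs {N : ℕ} (pdk C₀ C₁ C : ℕ) (R : Randomizers N (X.sz n)) :
    (X.linkRegs n pdk C₀ C₁ C R).length = 5 + X.numUnits n := by
  rw [linkRegs, List.length_append, List.length_ofFn]
  rfl

theorem reg_unit_linkRegs {N : ℕ} (pdk C₀ C₁ C : ℕ) (R : Randomizers N (X.sz n))
    (i : Fin 3 × Server × Word (X.sz n)) :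
    reg (X.linkRegs n pdk C₀ C₁ C R) (5 + (X.unitEquiv n i).val) = (R i).val.val := by
  rw [linkRegs, show 5 = [N, pdk, C₀, C₁, C].length from rfl, reg_append_right]
  simp [reg]

theorem represents_linkInputs (hW : 8 * n + 24 + S.len n ≤ X.W n)
    (hm₁ : ∀ s w, m₁ s w < 2 ^ X.W n) (hm₂ : ∀ s w, m₂ s w < 2 ^ X.W n)
    (hkey : key ∈ (keyDist S n X.c).support) (pp : T.Param n) (chal : ℕ → ℕ) (C₀ C₁ : ℕ) {C : ℕ}
    (hC : C < key.1 ^ 2) (R : Randomizers key.1 (X.sz n)) :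
    X.Represents F pp chal (X.linkRegs n key.2 C₀ C₁ C R) (X.linkInputs n m₁ m₂ x lab tag)
      (inputsOf T lab tag ((encryptAll m₁ m₂ key R).replace x C)) := by
  have range := inRange_encryptAll m₁ m₂ hW hkey R
  have : NeZero key.1 := ⟨range.N_ne⟩
  have le_budget : X.W n + 1 ≤ X.budget n := by
    simpa using X.le_budget (n := n) (k := 1) (by lia)
  have rep_input {i v : ℕ} (hi : i < 5) (hv : reg (X.linkRegs n key.2 C₀ C₁ C R) i = v)
      (hlt : v < 2 ^ X.W n) : Rep (X.W n) (env T F n pp chal) (X.linkRegs n key.2 C₀ C₁ C R)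
      (X.W n + 1) (.reg i) v := Rep.reg (by rw [length_linkRegs]; lia) hv hlt
  have rep_N := rep_input (i := 0) (by simp) rfl range.N_lt
  have rep_unit (i) : Rep (X.W n) (env T F n pp chal) (X.linkRegs n key.2 C₀ C₁ C R)
      (X.W n + 1) (X.unitReg n i) (R i).val.val :=
    Rep.reg (by rw [length_linkRegs]; lia) (X.reg_unit_linkRegs ..)
      ((ZMod.val_lt _).trans range.N_lt)
  have rep_enc {m : ℕ} (hm : m < 2 ^ X.W n) (i) :=
    (rep_encExpr range.N_ne range.N4 (range.one_add_N_lt (by lia)) hm rep_N (rep_unit i)).mono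
      (X.le_budget (n := n) (by lia))
  refine ⟨rep_N.mono le_budget, (rep_input (i := 1) (by simp) rfl range.pdk).mono le_budget,
    fun w => X.rep_const (T.enc_lt (X.len_le n) _), fun w => X.rep_const (T.enc_lt (X.len_le n) _),
    fun s w => X.rep_const (X.fin_lt _), fun s w => X.rep_const (X.fin_lt _),
    fun s w => rep_enc (hm₁ s w) _, fun s w => ?_, fun s w => (rep_unit _).mono le_budget⟩
  simp only [linkInputs, inputsOf, Ciphers.replace]
  split_ifs
  · exact (rep_input (i := 4) (by simp) rfl (hC.trans range.sq_lt)).mono le_budget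
  · exact rep_enc (hm₂ s w) _

theorem out_linkProg (hW : 8 * n + 24 + S.len n ≤ X.W n)
    (hm₁ : ∀ s w, m₁ s w < 2 ^ X.W n) (hm₂ : ∀ s w, m₂ s w < 2 ^ X.W n)
    (hkey : key ∈ (keyDist S n X.c).support) (pp : T.Param n) (chal : ℕ → ℕ) (C₀ C₁ : ℕ) {C : ℕ}
    (hC : C < key.1 ^ 2) :
    (X.linkProg n m₁ m₂ x b m κ lab tag).out (env T F n pp chal) [key.1, key.2, C₀, C₁, C] =
      (unif (Randomizers key.1 (X.sz n))).bind fun R =>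
        X.play F n b m κ tag ((encryptAll m₁ m₂ key R).replace x C) pp lab := by
  have range := inRange_encryptAll m₁ m₂ hW hkey 1
  rw [linkProg, Program.out, Program.run_append,
    run_sampleUnits (N := key.1) _ range.N_ne range.N_lt, PMF.bind_map, PMF.map_bind,
    ← unif_bind_equiv (Equiv.arrowCongr (X.unitEquiv n) (Equiv.refl (ZMod key.1)ˣ))]
  congr 1
  funext R
  rw [← X.out_reduction ((inRange_encryptAll m₁ m₂ hW hkey R).replace x hC)
    (X.represents_linkInputs hW hm₁ hm₂ hkey pp chal C₀ C₁ hC R), length_linkRegs]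
  rfl

theorem cost_linkProg_le (hW : 8 * n + 24 + S.len n ≤ X.W n)
    (hm₁ : ∀ s w, m₁ s w < 2 ^ X.W n) (hm₂ : ∀ s w, m₂ s w < 2 ^ X.W n) :
    (X.linkProg n m₁ m₂ x b m κ lab tag).cost ≤
      3 * (2 * (X.W n + X.W n)) * (1 + X.W n) + X.bound n := by
  obtain ⟨pp, -⟩ := (T.setup n).support_nonempty
  obtain ⟨key, hkey⟩ := (keyDist S n X.c).support_nonempty
  have hC : 0 < key.1 ^ 2 := pow_pos (Nat.pos_of_ne_zero (keyDist_range hkey).1) 2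
  rw [linkProg, Program.cost_append]
  refine add_le_add ?_ (X.cost_reduction_le ((inRange_encryptAll m₁ m₂ hW hkey 1).replace x hC)
    (X.represents_linkInputs (F := default) hW hm₁ hm₂ hkey pp (fun _ => 0) 0 0 hC 1) _)
  have numUnits_le : X.numUnits n ≤ 3 * (2 * (X.W n + X.W n)) := by
    have servers : Fintype.card Server = 2 := rfl
    simp only [numUnits, Fintype.card_prod, Fintype.card_fin, servers]
    gcongr
    exact X.card_word_le n
  simp only [Program.cost, List.map_replicate, List.sum_replicate, Instr.cost, smul_eq_mul]
  gcongr

end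

end Setting

/-! ## Reduction to unlinkability -/

section LinkExp

variable {T : TPF} {F : KeyedFun} {S : KeySplit} {n : ℕ} {c : Server} {m₀ m₁ : ℕ} {A : Program}
  {f : T.Param n → ℕ × ℕ → ℕ → PMF Bool}

theorem linkExp_eq (h : ∀ pp, ∀ key ∈ (keyDist S n c).support, ∀ C₀ C₁ m r,
      A.out (env T F n pp fun _ => 0) [key.1, key.2, C₀, C₁, turEnc key.1 m r] =
        f pp key (turEnc key.1 m r)) :
    linkExp T F S n c m₀ m₁ A = (unif Bool).bind fun b =>
      ((T.setup n).bind fun pp => (keyDist S n c).bind fun key =>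
        (unif (ZMod key.1)ˣ).bind fun r =>
          f pp key (turEnc key.1 (if b then m₁ else m₀) r)).map (· == b) := by
  simp only [PMF.map_bind, PMF.bind_comm (unif Bool), keyDist, PMF.bind_bind, PMF.bind_map]
  refine congrArg _ (funext fun pp => bind_congr_of_mem_support _ fun pq hpq =>
    bind_congr_of_mem_support _ fun pdk hpdk => ?_)
  have hN := (keyDist_range (mem_support_keyDist (c := c) hpq hpdk)).1
  have out_challenge (b : Bool) (r₀ r₁ r : (ZMod (pq.1 * pq.2))ˣ) :
      A.out (env T F n pp fun _ => 0) [pq.1 * pq.2, pdk c, turEnc (pq.1 * pq.2) m₀ r₀,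
        turEnc (pq.1 * pq.2) m₁ r₁, turReEnc (pq.1 * pq.2) (if b then turEnc (pq.1 * pq.2) m₁ r₁
          else turEnc (pq.1 * pq.2) m₀ r₀) r] =
      f pp (pq.1 * pq.2, pdk c) (turReEnc (pq.1 * pq.2)
        (turEnc (pq.1 * pq.2) (if b then m₁ else m₀) (if b then r₁ else r₀)) r) := by
    cases b <;> simp [turReEnc_turEnc hN, h pp _ (mem_support_keyDist hpq hpdk)]
  change ((unif (ZMod (pq.1 * pq.2))ˣ).bind fun r₀ => (unif (ZMod (pq.1 * pq.2))ˣ).bind fun r₁ =>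
    (unif (ZMod (pq.1 * pq.2))ˣ).bind fun r => (unif Bool).bind fun b =>
      (A.out (env T F n pp fun _ => 0) [pq.1 * pq.2, pdk c, turEnc (pq.1 * pq.2) m₀ r₀,
        turEnc (pq.1 * pq.2) m₁ r₁, turReEnc (pq.1 * pq.2) (if b then turEnc (pq.1 * pq.2) m₁ r₁
          else turEnc (pq.1 * pq.2) m₀ r₀) r]).map (· == b)) = _
  simp only [out_challenge, PMF.bind_comm _ (unif Bool)]
  refine congrArg _ (funext fun b => ?_)
  have relabel (r₀ : (ZMod (pq.1 * pq.2))ˣ) :=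
    unif_bind_turReEnc hN (if b then m₁ else m₀) r₀ fun C =>
      (f pp (pq.1 * pq.2, pdk c) C).map (· == b)
  simp only [relabel, PMF.bind_const, Function.comp_apply, PMF.map_bind]

theorem prob_linkExp (h : ∀ pp, ∀ key ∈ (keyDist S n c).support, ∀ C₀ C₁ m r,
      A.out (env T F n pp fun _ => 0) [key.1, key.2, C₀, C₁, turEnc key.1 m r] =
        f pp key (turEnc key.1 m r)) :
    prob (linkExp T F S n c m₀ m₁ A) =
      (prob ((T.setup n).bind fun pp => (keyDist S n c).bind fun key =>
          (unif (ZMod key.1)ˣ).bind fun r => f pp key (turEnc key.1 m₁ r)) +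
        (1 - prob ((T.setup n).bind fun pp => (keyDist S n c).bind fun key =>
          (unif (ZMod key.1)ˣ).bind fun r => f pp key (turEnc key.1 m₀ r)))) / 2 := by
  rw [linkExp_eq h, prob_unif_bool_bind_map_beq]
  simp

end LinkExp

namespace Setting

variable {T : TPF} {F : KeyedFun} (X : Setting T) {S : KeySplit}

section

variable {n : ℕ} {m₁ m₂ μ μ' : Server → Word (X.sz n) → ℕ} {x : Server × Word (X.sz n)}

theorem prob_linkExp_linkProg (hW : 8 * n + 24 + S.len n ≤ X.W n)
    (hm₁ : ∀ s w, m₁ s w < 2 ^ X.W n) (hm₂ : ∀ s w, m₂ s w < 2 ^ X.W n)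
    (hμ : ∀ s w, (s, w) ≠ x → μ s w = m₂ s w) (hμ' : ∀ s w, (s, w) ≠ x → μ' s w = m₂ s w)
    (b : Bool) (m : Misc T n (X.sz n)) (κ : Fin (2 ^ n)) (lab : Lab T n (X.sz n))
    (tag : Tag n (X.sz n)) :
    prob (linkExp T F S n X.c (μ x.1 x.2) (μ' x.1 x.2) (X.linkProg n m₁ m₂ x b m κ lab tag)) =
      (prob ((T.setup n).bind fun pp => (cipherDist S n X.c m₁ μ').bind fun ck =>
          X.play F n b m κ tag ck pp lab) +
        (1 - prob ((T.setup n).bind fun pp => (cipherDist S n X.c m₁ μ).bind fun ck =>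
          X.play F n b m κ tag ck pp lab))) / 2 := by
  rw [prob_linkExp (f := fun pp key C => (unif (Randomizers key.1 (X.sz n))).bind fun R =>
      X.play F n b m κ tag ((encryptAll m₁ m₂ key R).replace x C) pp lab)
    fun pp key hkey C₀ C₁ _ _ => X.out_linkProg hW hm₁ hm₂ hkey pp _ C₀ C₁
      (turEnc_lt (keyDist_range hkey).1 _ _)]
  have resample {ν : Server → Word (X.sz n) → ℕ} (hν : ∀ s w, (s, w) ≠ x → ν s w = m₂ s w)
      (pp : T.Param n) := bind_replace_encryptAll (S := S) (n := n) (c := X.c) (m₁ := m₁) hν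
    fun ck => X.play F n b m κ tag ck pp lab
  simp only [resample hμ, resample hμ']

end

variable {m₁ m₂ m₂' : ∀ n, Server → Word (X.sz n) → ℕ}

theorem polyBounded_cost_linkProg (hW : ∀ n, 8 * n + 24 + S.len n ≤ X.W n)
    (hm₁ : ∀ n s w, m₁ n s w < 2 ^ X.W n) (hm₂ : ∀ n s w, m₂ n s w < 2 ^ X.W n)
    (x : ∀ n, Server × Word (X.sz n)) (b : ℕ → Bool) (m : ∀ n, Misc T n (X.sz n))
    (κ : ∀ n, Fin (2 ^ n)) (lab : ∀ n, Lab T n (X.sz n)) (tag : ∀ n, Tag n (X.sz n)) :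
    PolyBounded fun n =>
      (X.linkProg n (m₁ n) (m₂ n) (x n) (b n) (m n) (κ n) (lab n) (tag n)).cost :=
  ((((polyBounded_const 3).mul ((polyBounded_const 2).mul (X.W_poly.add X.W_poly))).mul
    ((polyBounded_const 1).add X.W_poly)).add X.polyBounded_bound).mono fun n =>
      X.cost_linkProg_le (hW n) (hm₁ n) (hm₂ n)

theorem indist_cipherDist (hS : TURUnlinkable T F S) (hW : ∀ n, 8 * n + 24 + S.len n ≤ X.W n)
    (L : ∀ n, PMF (Lab T n (X.sz n))) (Dt : ∀ n, Fin (2 ^ n) → PMF (Tag n (X.sz n)))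
    (hm₁ : ∀ n s w, m₁ n s w < 2 ^ X.W n) (hm₂ : ∀ n s w, m₂ n s w < 2 ^ X.W n)
    (hm₂' : ∀ n s w, m₂' n s w < 2 ^ X.W n) {x : ∀ n, Server × Word (X.sz n)}
    (hx : ∀ n s w, (s, w) ≠ x n → m₂' n s w = m₂ n s w) :
    Indist
      (fun n => X.game F n (fun _ => L n) (Dt n) (cipherDist S n X.c (m₁ n) (m₂ n)))
      (fun n => X.game F n (fun _ => L n) (Dt n) (cipherDist S n X.c (m₁ n) (m₂' n))) := by
  choose b m κ lab tag hle using fun n => X.exists_game_sub_le_ct F n (L n) (Dt n)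
    (cipherDist S n X.c (m₁ n) (m₂ n)) (cipherDist S n X.c (m₁ n) (m₂' n))
  let linker : Adversary := ⟨fun n =>
    X.linkProg n (m₁ n) (m₂ n) (x n) (b n) (m n) (κ n) (lab n) (tag n),
    X.polyBounded_cost_linkProg hW hm₁ hm₂ x b m κ lab tag⟩
  have size_poly {μ : ∀ n, Server → Word (X.sz n) → ℕ} (hμ : ∀ n s w, μ n s w < 2 ^ X.W n) :
      PolyBounded fun n => (μ n (x n).1 (x n).2).size :=
    X.W_poly.mono fun n => Nat.size_le.2 (hμ n _ _)
  -- unlinkability is one-sided, so the absolute value needs both orders of the plaintexts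
  obtain ⟨ε, hε, hle₁⟩ := hS X.c _ _ (size_poly hm₂) (size_poly hm₂') linker
  obtain ⟨ε', hε', hle₂⟩ := hS X.c _ _ (size_poly hm₂') (size_poly hm₂) linker
  refine ((hε.abs.add hε'.abs).const_mul 2).mono (fun _ => abs_nonneg _) fun n =>
    (hle n).trans ?_
  have le_ε := hle₁ n
  have le_ε' := hle₂ n
  rw [X.prob_linkExp_linkProg (hW n) (hm₁ n) (hm₂ n) (fun _ _ _ => rfl) (hx n)] at le_ε
  rw [X.prob_linkExp_linkProg (hW n) (hm₁ n) (hm₂ n) (hx n) fun _ _ _ => rfl] at le_ε'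
  rw [abs_sub_le_iff]
  constructor <;> linarith [le_abs_self (ε n), le_abs_self (ε' n), abs_nonneg (ε n),
    abs_nonneg (ε' n)]

end Setting

/-! ## The ideal game is symmetric in the two challenge entries -/

theorem bind_eq_bind_of_map_eq {α β : Type*} {p : PMF α} {φ : α → α} (h : p.map φ = p)
    {f g : α → PMF β} (hfg : ∀ a, f (φ a) = g a) : p.bind f = p.bind g := by
  conv_lhs => rw [← h, PMF.bind_map]
  exact congrArg _ (funext hfg)

section Permute

variable {sz : Kind → ℕ} (σ : ∀ k, Equiv.Perm (Fin (sz k)))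

/-- The permutation of all words given by a permutation of each index. -/
def permWord : Equiv.Perm (Word sz) := Equiv.sigmaCongrRight σ

/-- The leaves with the entries after the refresh by the honest server permuted. -/
def Leaves.permute {X : Type} (V : Leaves X sz) : Leaves X sz :=
  { V with hon := fun s w => V.hon s (permWord σ w) }

/-- The labels with those after the refresh by the honest server permuted. -/
def Lab.permute {T : TPF} {n : ℕ} (lab : Lab T n sz) : Lab T n sz :=
  (lab.1, fun w => lab.2 (permWord σ w))

/-- The tags with those after the refresh by the honest server permuted. -/
def Tag.permute {n : ℕ} (tag : Tag n sz) : Tag n sz := (tag.1, fun s w => tag.2 s (permWord σ w))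

/-- The ciphertexts with those after the refresh by the honest server permuted. -/
def Ciphers.permute (ck : Ciphers sz) : Ciphers sz :=
  { ck with ct₂ := fun s w => ck.ct₂ s (permWord σ w) }

/-- The permutations of the honest server that absorb `Leaves.permute`.  On the share of the honest
server they act after the permutations `πc` of the corrupted server, hence the conjugation. -/
def conjPerms (c : Server) (πc πd : Perms sz) : Perms sz := fun s k =>
  if s = c then (πd s k).trans (σ k)
  else (πd s k).trans ((πc s k).trans ((σ k).trans (πc s k).symm))

theorem conjPerms_injective (c : Server) (πc : Perms sz) :
    Function.Injective (conjPerms σ c πc) := by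
  intro πd πd' h
  funext s k
  ext j
  have apply_eq := DFunLike.congr_fun (congrFun (congrFun h s) k) j
  unfold conjPerms at apply_eq
  split_ifs at apply_eq <;> simpa [Fin.ext_iff] using apply_eq

section View

variable {X : Type} (c : Server) (cref : Triple X → X → Triple X) (lit : ℕ → X) (V : Leaves X sz)
  (πc πd : Perms sz)

theorem midList_permute :
    midList c cref (V.permute σ) πc πd = midList c cref V πc (conjPerms σ c πc πd) := by
  funext s k j
  unfold midList conjPerms
  split_ifs <;> rfl

theorem postList_permute :
    postList c cref (V.permute σ) πc πd = postList c cref V πc (conjPerms σ c πc πd) := by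
  funext s k j
  unfold postList conjPerms
  split_ifs
  · rfl
  · simp [Leaves.permute, permWord]

variable {σ} {tg : Target sz}

theorem Target.pos_conjPerms
    (h : ∀ b : Bool, σ tg.k (if b then tg.i₁ else tg.i₀) = if !b then tg.i₁ else tg.i₀)
    (b : Bool) : tg.pos c πc (conjPerms σ c πc πd) (!b) = tg.pos c πc πd b := by
  unfold Target.pos conjPerms
  rw [← h b]
  split_ifs <;> simp

theorem viewOf_permute
    (h : ∀ b : Bool, σ tg.k (if b then tg.i₁ else tg.i₀) = if !b then tg.i₁ else tg.i₀)
    (b : Bool) :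
    viewOf c cref lit (V.permute σ) πc πd tg b =
      viewOf c cref lit V πc (conjPerms σ c πc πd) tg (!b) := by
  simp only [viewOf, viewPart, midList_permute, postList_permute, Target.pos_conjPerms _ _ _ h]
  rfl

end View

theorem unif_map_lab_permute {T : TPF} {n : ℕ} :
    (unif (Lab T n sz)).map (Lab.permute σ) = unif (Lab T n sz) :=
  unif_map_equiv ((Equiv.refl _).prodCongr ((permWord σ).symm.arrowCongr (Equiv.refl _)))

theorem cipherDist_map_permute {S : KeySplit} {n : ℕ} {c : Server}
    {m₁ m₂ : Server → Word sz → ℕ} (hm : ∀ s w, m₂ s (permWord σ w) = m₂ s w) :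
    (cipherDist S n c m₁ m₂).map (Ciphers.permute σ) = cipherDist S n c m₁ m₂ := by
  let relabel (x : Fin 3 × Server × Word sz) : Fin 3 × Server × Word sz :=
    (x.1, x.2.1, if x.1 = 1 then permWord σ x.2.2 else x.2.2)
  have relabel_injective : Function.Injective relabel := by
    rintro ⟨j, s, w⟩ ⟨j', s', w'⟩ h
    obtain ⟨rfl, rfl, word_eq⟩ : j = j' ∧ s = s' ∧ _ := by
      simpa only [relabel, Prod.mk.injEq] using h
    split_ifs at word_eq
    exacts [by rw [(permWord σ).injective word_eq], by rw [word_eq]]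
  have permute_encryptAll (key) (R : Randomizers key.1 sz) :
      (encryptAll m₁ m₂ key R).permute σ = encryptAll m₁ m₂ key fun x => R (relabel x) := by
    simp [Ciphers.permute, encryptAll, relabel, hm]
  simp only [cipherDist, PMF.map_bind, PMF.map_comp]
  refine congrArg _ (funext fun key => ?_)
  conv_rhs => rw [← unif_map_comp (R := (ZMod key.1)ˣ) relabel relabel_injective, PMF.map_comp]
  exact congrArg (PMF.map · _) (funext (permute_encryptAll key))

end Permute

namespace Target

variable {sz : Kind → ℕ}

/-- The permutation of the words that exchanges the two entries the challenge is about. -/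
def swap (tg : Target sz) : ∀ k, Equiv.Perm (Fin (sz k)) :=
  Function.update 1 tg.k (Equiv.swap tg.i₀ tg.i₁)

theorem swap_apply (tg : Target sz) (b : Bool) :
    tg.swap tg.k (if b then tg.i₁ else tg.i₀) = if !b then tg.i₁ else tg.i₀ := by
  cases b <;> simp [swap]

theorem apply_permWord_swap (tg : Target sz) {α : Type*} {f : Word sz → α}
    (hf : f ⟨tg.k, tg.i₀⟩ = f ⟨tg.k, tg.i₁⟩) (w : Word sz) : f (permWord tg.swap w) = f w := by
  obtain ⟨k, i⟩ := w
  obtain rfl | hk := eq_or_ne k tg.k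
  · simp only [permWord, Equiv.sigmaCongrRight_apply, swap, Function.update_self]
    obtain rfl | h₀ := eq_or_ne i tg.i₀
    · rw [Equiv.swap_apply_left, hf]
    obtain rfl | h₁ := eq_or_ne i tg.i₁
    · rw [Equiv.swap_apply_right, hf]
    rw [Equiv.swap_apply_of_ne_of_ne h₀ h₁]
  · simp [permWord, swap, Function.update_of_ne hk]

end Target

namespace Setting

variable {T : TPF} {F : KeyedFun} (X : Setting T) {n : ℕ}

section

variable (σ : ∀ k, Equiv.Perm (Fin (X.sz n k)))

theorem tagIdeal_map_permute (κ : Fin (2 ^ n)) :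
    (X.tagIdeal F n κ).map (Tag.permute σ) = X.tagIdeal F n κ := by
  let relabel (x : (Server × Word (X.sz n)) × Fin (X.u n + 2)) :
      (Server × Word (X.sz n)) × Fin (X.u n + 2) :=
    ((x.1.1, if x.2 = Fin.last _ then permWord σ x.1.2 else x.1.2), x.2)
  have relabel_injective : Function.Injective relabel := by
    rintro ⟨⟨s, w⟩, j⟩ ⟨⟨s', w'⟩, j'⟩ h
    obtain ⟨⟨rfl, word_eq⟩, rfl⟩ : (s = s' ∧ _) ∧ j = j' := by
      simpa only [relabel, Prod.mk.injEq] using h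
    split_ifs at word_eq
    exacts [by rw [(permWord σ).injective word_eq], by rw [word_eq]]
  have permute_tapeTags (z : X.Tape n) :
      (X.tapeTags F n κ z).permute σ = X.tapeTags F n κ fun x => z (relabel x) := by
    simp [Tag.permute, tapeTags, relabel, Fin.castSucc_ne_last]
  rw [tagIdeal, PMF.map_comp]
  conv_rhs => rw [← unif_map_comp (R := Fin (2 ^ n)) relabel relabel_injective, PMF.map_comp]
  exact congrArg (PMF.map · _) (funext permute_tapeTags)

theorem unif_map_misc_conjPerms :
    (unif (Misc T n (X.sz n))).map (fun m => (m.1, m.2.1, conjPerms σ X.c m.2.1 m.2.2)) =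
      unif (Misc T n (X.sz n)) := by
  refine unif_map_equiv (Equiv.ofBijective _ (Finite.injective_iff_bijective.1 ?_))
  rintro ⟨x, πc, πd⟩ ⟨x', πc', πd'⟩ h
  obtain ⟨rfl, rfl, h⟩ : x = x' ∧ πc = πc' ∧ _ := by simpa only [Prod.mk.injEq] using h
  rw [conjPerms_injective σ X.c πc h]

end

theorem leaves_permute (σ : ∀ k, Equiv.Perm (Fin (X.sz n k))) (m : Misc T n (X.sz n))
    (κ : Fin (2 ^ n)) (lab : Lab T n (X.sz n)) (tag : Tag n (X.sz n)) (ck : Ciphers (X.sz n)) :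
    X.leaves n m κ (lab.permute σ) (tag.permute σ) (ck.permute σ) =
      (X.leaves n m κ lab tag ck).permute σ :=
  rfl

theorem play_permute_swap (b : Bool) (m : Misc T n (X.sz n)) (κ : Fin (2 ^ n))
    (tag : Tag n (X.sz n)) (ck : Ciphers (X.sz n)) (pp : T.Param n) (lab : Lab T n (X.sz n)) :
    X.play F n b m κ (tag.permute (X.tg n).swap) (ck.permute (X.tg n).swap) pp
        (lab.permute (X.tg n).swap) =
      X.play F n (!b) (m.1, m.2.1, conjPerms (X.tg n).swap X.c m.2.1 m.2.2) κ tag ck pp lab := by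
  unfold play
  rw [leaves_permute, viewOf_permute _ _ _ _ _ _ (X.tg n).swap_apply]
  rfl

theorem prob_game_ideal {S : KeySplit} {m₁ m₂ : Server → Word (X.sz n) → ℕ}
    (hm : ∀ s, m₂ s ⟨(X.tg n).k, (X.tg n).i₀⟩ = m₂ s ⟨(X.tg n).k, (X.tg n).i₁⟩) :
    prob (X.game F n (fun _ => unif (Lab T n (X.sz n))) (X.tagIdeal F n)
      (cipherDist S n X.c m₁ m₂)) = 1 / 2 := by
  let guess (b : Bool) (m : Misc T n (X.sz n)) : PMF Bool :=
    (unif (Fin (2 ^ n))).bind fun κ => (X.tagIdeal F n κ).bind fun tag =>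
      (cipherDist S n X.c m₁ m₂).bind fun ck => (T.setup n).bind fun pp =>
        (unif (Lab T n (X.sz n))).bind fun lab => X.play F n b m κ tag ck pp lab
  have guess_true (m) :
      guess true m = guess false (m.1, m.2.1, conjPerms (X.tg n).swap X.c m.2.1 m.2.2) := by
    refine congrArg (PMF.bind _) (funext fun κ => ?_)
    refine bind_eq_bind_of_map_eq (X.tagIdeal_map_permute (X.tg n).swap κ) fun tag => ?_
    refine bind_eq_bind_of_map_eq
      (cipherDist_map_permute _ fun s => (X.tg n).apply_permWord_swap (hm s)) fun ck => ?_
    refine congrArg (PMF.bind _) (funext fun pp => ?_)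
    exact bind_eq_bind_of_map_eq (unif_map_lab_permute _) fun lab =>
      X.play_permute_swap true m κ tag ck pp lab
  have game_eq : X.game F n (fun _ => unif (Lab T n (X.sz n))) (X.tagIdeal F n)
      (cipherDist S n X.c m₁ m₂) =
      (unif Bool).bind fun b => ((unif (Misc T n (X.sz n))).bind (guess b)).map (· == b) := by
    simp only [game, guess, PMF.map_bind]
  rw [game_eq, prob_unif_bool_bind_map_beq, funext guess_true,
    unif_bind_of_map (X.unif_map_misc_conjPerms (X.tg n).swap) (guess false)]
  ring

end Setting

/-! ## The view in the shuffle experiment -/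

namespace Server

theorem other_other (s : Server) : s.other.other = s := by cases s <;> rfl

theorem other_ne (s : Server) : s.other ≠ s := by cases s <;> simp [other]

theorem eq_or_eq_other (c s : Server) : s = c ∨ s = c.other := by
  cases c <;> cases s <;> simp [other]

end Server

/-- An entry with its components written as strings. -/
def Entry.toTriple {T : TPF} {n : ℕ} (e : Entry T n) : Triple ℕ :=
  ⟨T.enc n e.label, e.id, e.tag.val⟩

theorem listEntries_eq_flatTriples {T : TPF} {n l : ℕ} {L : Fin l → Entry T n}
    {L' : Fin l → Triple ℕ} (h : ∀ j, (L j).toTriple = L' j) : listEntries L = flatTriples L' := by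
  rw [← funext h]
  rfl

section View

variable {T : TPF} (F : KeyedFun) {n N : ℕ} {sz : Kind → ℕ} (c : Server) (pdk auth : ℕ)
  (r : Server → ShuffleParam T n) (pre : Server → ∀ k, Fin (sz k) → Entry T n)
  (coins : Server → Server → ∀ k, Coins N (sz k))

/-- The intermediate list of the share of `s`. -/
def midEntries (s : Server) (k : Kind) : Fin (sz k) → Entry T n :=
  pass F N (r s.other) (coins s s.other k) (pre s k)

/-- The final list of the share of `s`. -/
def postEntries (s : Server) (k : Kind) : Fin (sz k) → Entry T n :=
  pass F N (r s) (coins s s k) (midEntries F r pre coins s k)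

/-- The part of the view of the server `c` about the index `k` of the share of `s`. -/
def entriesPart (s : Server) (k : Kind) : List ℕ :=
  listEntries (pre s k) ++ listEntries (midEntries F r pre coins s k) ++
    listEntries (postEntries F r pre coins s k) ++ listCoins (coins s c k)

/-- The final position of the challenge entry. -/
def finalPos (tg : Target sz) (b : Bool) : Fin (sz tg.k) :=
  (coins tg.o tg.o tg.k).2.symm
    ((coins tg.o tg.o.other tg.k).2.symm (if b then tg.i₁ else tg.i₀))

/-- The view of the server `c`, written as in `shuffleExp`. -/
def serverView (tg : Target sz) (b : Bool) : List ℕ :=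
  [N, pdk, (r c).1.val.val, (r c).2.val, auth] ++
    entriesPart F c r pre coins .cs1 .pref ++ entriesPart F c r pre coins .cs1 .keyword ++
    entriesPart F c r pre coins .cs2 .pref ++ entriesPart F c r pre coins .cs2 .keyword ++
    (pre tg.o tg.k tg.i₀).toList ++ (pre tg.o tg.k tg.i₁).toList ++
    (postEntries F r pre coins tg.o tg.k (finalPos coins tg b)).toList ++
    [(finalPos coins tg b).val]

/-- The word `w` of the share of `s` after the refresh by the honest server, which comes second on
the share of that server. -/
def honestEntry (s : Server) (w : Word sz) : Entry T n :=
  if s = c then refresh F N (r c.other) (pre s w.1 w.2) ((coins s c.other w.1).1 w.2)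
  else refresh F N (r c.other) (refresh F N (r c) (pre s w.1 w.2) ((coins s c w.1).1 w.2))
    ((coins s c.other w.1).1 ((coins s c w.1).2.symm w.2))

/-- The leaves of the view of the server `c`. -/
def serverLeaves : Leaves ℕ sz where
  N := N
  pdk := pdk
  rho := (r c).1.val.val
  kap := (r c).2.val
  auth := auth
  pre s w := (pre s w.1 w.2).toTriple
  hon s w := (honestEntry F c r pre coins s w).toTriple
  coin s w := ((coins s c w.1).1 w.2).val.val

theorem toTriple_refresh (e : Entry T n) (g : (ZMod N)ˣ) :
    (refresh F N (r c) e g).toTriple =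
      refreshNat T F n (serverLeaves F c pdk auth r pre coins) e.toTriple g.val.val := by
  simp only [Entry.toTriple, refresh, refreshNat, serverLeaves, T.encPow_enc, prfNat_val,
    TPF.reEnc, turReEnc, turEnc, pow_zero, one_mul]

theorem toTriple_midEntries (s : Server) (k : Kind) (j : Fin (sz k)) :
    (midEntries F r pre coins s k j).toTriple =
      midList c (refreshNat T F n (serverLeaves F c pdk auth r pre coins))
        (serverLeaves F c pdk auth r pre coins) (fun s k => (coins s c k).2)
        (fun s k => (coins s c.other k).2) s k j := by
  unfold midList midEntries pass
  obtain rfl | rfl := Server.eq_or_eq_other c s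
  · simp only [if_true, serverLeaves, honestEntry]
  · simp only [if_neg c.other_ne, Server.other_other, toTriple_refresh F c pdk auth r pre coins]
    rfl

theorem toTriple_postEntries (s : Server) (k : Kind) (j : Fin (sz k)) :
    (postEntries F r pre coins s k j).toTriple =
      postList c (refreshNat T F n (serverLeaves F c pdk auth r pre coins))
        (serverLeaves F c pdk auth r pre coins) (fun s k => (coins s c k).2)
        (fun s k => (coins s c.other k).2) s k j := by
  unfold postList postEntries midEntries pass
  obtain rfl | rfl := Server.eq_or_eq_other c s
  · rw [if_pos rfl, toTriple_refresh F s pdk auth r pre coins]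
    simp only [serverLeaves, honestEntry, if_true]
  · simp only [if_neg c.other_ne, Server.other_other, serverLeaves, honestEntry,
      Equiv.symm_apply_apply]

theorem finalPos_eq_pos (tg : Target sz) (b : Bool) :
    finalPos coins tg b =
      tg.pos c (fun s k => (coins s c k).2) (fun s k => (coins s c.other k).2) b := by
  obtain ⟨o, k, i₀, i₁⟩ := tg
  unfold finalPos Target.pos
  obtain rfl | rfl := Server.eq_or_eq_other c o
  · rw [if_pos rfl]
  · simp only [if_neg c.other_ne, Server.other_other]

theorem entriesPart_eq_viewPart (s : Server) (k : Kind) :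
    entriesPart F c r pre coins s k =
      viewPart c (refreshNat T F n (serverLeaves F c pdk auth r pre coins)) id
        (serverLeaves F c pdk auth r pre coins) (fun s k => (coins s c k).2)
        (fun s k => (coins s c.other k).2) s k := by
  unfold entriesPart viewPart
  rw [listEntries_eq_flatTriples fun _ => rfl,
    listEntries_eq_flatTriples (toTriple_midEntries F c pdk auth r pre coins s k),
    listEntries_eq_flatTriples (toTriple_postEntries F c pdk auth r pre coins s k)]
  rfl

theorem serverView_eq_viewOf (tg : Target sz) (b : Bool) :
    serverView F c pdk auth r pre coins tg b =
      viewOf c (refreshNat T F n (serverLeaves F c pdk auth r pre coins)) id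
        (serverLeaves F c pdk auth r pre coins) (fun s k => (coins s c k).2)
        (fun s k => (coins s c.other k).2) tg b := by
  have toList_eq (e : Entry T n) : e.toList = e.toTriple.toList := rfl
  simp only [serverView, viewOf, entriesPart_eq_viewPart F c pdk auth, toList_eq,
    toTriple_postEntries F c pdk auth, finalPos_eq_pos c]
  rfl

end View

/-! ## Entries after several rounds -/

section Rounds

variable {T : TPF} (F : KeyedFun) {n N : ℕ} (pp : T.Param n)

/-- The form of all entries: a label under the key `K` and a ciphertext with randomizer `h`. -/
def stdEntry (K : T.Key n) (x m : ℕ) (h : (ZMod N)ˣ) (t : Fin (2 ^ n)) : Entry T n :=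
  ⟨T.rnd pp K x, turEnc N m h, t⟩

theorem TPF.reEnc_rnd_eq_rnd_mul (T : TPF) {n : ℕ} (pp : T.Param n) (K ρ : T.Key n) (x : ℕ) :
    T.reEnc (T.rnd pp K x) ρ = T.rnd pp (K * ρ) x := by
  rw [← T.reEnc_rnd pp K (K * ρ) x, TPF.recKeyGen, mul_div_cancel_left]

theorem refresh_stdEntry (hN : N ≠ 0) (r : ShuffleParam T n) (K : T.Key n) (x m : ℕ)
    (h g : (ZMod N)ˣ) (t : Fin (2 ^ n)) :
    refresh F N r (stdEntry pp K x m h t) g =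
      stdEntry pp (K * r.1) x m (h * g) (F n r.2 t.val) := by
  simp only [refresh, stdEntry, T.reEnc_rnd_eq_rnd_mul, turReEnc_turEnc hN]

theorem foldl_refresh_stdEntry (hN : N ≠ 0) (c : Server) (r : Server → ShuffleParam T n)
    (s : Server) (x m : ℕ) (l : List (Server → (ZMod N)ˣ)) (K : T.Key n) (h : (ZMod N)ˣ)
    (t : Fin (2 ^ n)) :
    l.foldl (fun e ρ => refresh F N (r s) (refresh F N (r s.other) e (ρ s.other)) (ρ s))
        (stdEntry pp K x m h t) =
      stdEntry pp (K * ((r c).1 * (r c.other).1) ^ l.length) x m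
        (h * (l.map fun ρ => ρ .cs1 * ρ .cs2).prod)
        (preTag c (fun y => F n (r c).2 y.val) (fun y => F n (r c.other).2 y.val)
          l.length s t) := by
  induction l generalizing K h t with
  | nil => simp [preTag]
  | cons ρ l ih =>
    rw [List.foldl_cons, refresh_stdEntry F pp hN, refresh_stdEntry F pp hN, ih]
    congr 1
    · rw [List.length_cons, pow_succ']
      obtain rfl | rfl := Server.eq_or_eq_other c s
      · simp only [mul_assoc, mul_left_comm, mul_comm]
      · simp only [Server.other_other, mul_assoc, mul_left_comm, mul_comm]
    · rw [List.map_cons, List.prod_cons]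
      cases s <;> simp only [Server.other, mul_assoc, mul_left_comm, mul_comm]
    · obtain rfl | rfl := Server.eq_or_eq_other c s
      · simp [preTag]
      · simp [preTag, Server.other_ne, Server.other_other]

/-- The product of all randomizers of an entry. -/
def histProd {N u : ℕ} : History N u →* (ZMod N)ˣ where
  toFun h := h.1 * (List.ofFn fun j => h.2 j .cs1 * h.2 j .cs2).prod
  map_one' := by simp
  map_mul' h h' := by
    simp only [List.prod_ofFn, Prod.fst_mul, Prod.snd_mul, Pi.mul_apply, Finset.prod_mul_distrib,
      mul_assoc, mul_left_comm]

theorem histProd_surjective {N u : ℕ} : Function.Surjective (histProd (N := N) (u := u)) :=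
  fun g => ⟨(g, 1), by simp [histProd]⟩

theorem currentEntry_eq_stdEntry (hN : N ≠ 0) (c : Server) (kM : T.Key n) (kT : Fin (2 ^ n))
    (r : Server → ShuffleParam T n) (s : Server) (x m : ℕ) {u : ℕ} (h : History N u) :
    currentEntry F pp N kM kT r s x m h =
      stdEntry pp (kM * ((r c).1 * (r c.other).1) ^ u) x m (histProd h)
        (preTag c (fun y => F n (r c).2 y.val) (fun y => F n (r c.other).2 y.val) u s
          (F n kT (Nat.pair s.num x))) := by
  have rounds := foldl_refresh_stdEntry F pp hN c r s x m (List.ofFn h.2) kM h.1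
    (F n kT (Nat.pair s.num x))
  rw [List.length_ofFn, List.map_ofFn] at rounds
  exact rounds

end Rounds

/-! ## Changing variables in the shuffle experiment -/

/-- The change of variables from the keys of the experiment (master key, client key, shuffle
parameters, tag key) to the keys of the games (exponent of `c` and authorization key, tag keys of
`c` and of the other server, tag key, keys of the labels after and before the refresh by the other
server), where `u` is the number of previous rounds. -/
def keysEquiv {K κ : Type} [CommGroup K] (c : Server) (u : ℕ) :
    K × K × (Server → K × κ) × κ ≃ (K × K) × κ × κ × κ × K × K where
  toFun := fun (kM, kU, r, kT) =>
    (((r c).1, kM / kU), (r c).2, (r c.other).2, kT,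
      kM * ((r c).1 * (r c.other).1) ^ u * (r c.other).1, kM * ((r c).1 * (r c.other).1) ^ u)
  invFun := fun ((ρ, a), κc, κd, kT, k₂, k₁) =>
    (k₁ / (ρ * (k₂ / k₁)) ^ u, k₁ / (ρ * (k₂ / k₁)) ^ u / a,
      fun s => if s = c then (ρ, κc) else (k₂ / k₁, κd), kT)
  left_inv := by
    rintro ⟨kM, kU, r, kT⟩
    have r_eq : (fun s => if s = c then ((r c).1, (r c).2) else ((r c.other).1, (r c.other).2)) =
        r := by
      funext s
      obtain rfl | rfl := Server.eq_or_eq_other c s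
      exacts [if_pos rfl, if_neg c.other_ne]
    simp [r_eq]
  right_inv := by
    rintro ⟨⟨ρ, a⟩, κc, κd, kT, k₂, k₁⟩
    simp [c.other_ne]

theorem unif_bind_keys {K κ : Type} {γ : Type*} [CommGroup K] [Finite K] [Finite κ] [Nonempty κ]
    (c : Server) (u : ℕ) (f : (K × K) × κ × κ × κ × K × K → PMF γ) :
    ((unif K).bind fun kM => (unif K).bind fun kU => (unif (Server → K × κ)).bind fun r =>
        (unif κ).bind fun kT => f (keysEquiv c u (kM, kU, r, kT))) =
      (unif (K × K)).bind fun ρa => (unif κ).bind fun κc => (unif κ).bind fun κd =>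
        (unif κ).bind fun kT => (unif K).bind fun k₂ => (unif K).bind fun k₁ =>
          f (ρa, κc, κd, kT, k₂, k₁) := by
  have change := unif_bind_equiv (keysEquiv c u) f
  rw [unif_prod_bind, unif_prod_bind] at change
  simp only [unif_prod_bind (α := K) (β := (Server → K × κ) × κ),
    unif_prod_bind (α := Server → K × κ), unif_prod_bind (α := κ),
    unif_prod_bind (α := K) (β := K)] at change
  rw [unif_prod_bind]
  exact change

section Randomizers

variable {N : ℕ} {sz : Kind → ℕ} (c : Server)

/-- The permutations of `c` and of the other server. -/
def permsOf (coins : Server → Server → ∀ k, Coins N (sz k)) : Perms sz × Perms sz :=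
  (fun s k => (coins s c k).2, fun s k => (coins s c.other k).2)

/-- The randomizers of the entries, given the ones before the round and the coins of the round. -/
def randomizers (R : Server × Word sz → (ZMod N)ˣ)
    (coins : Server → Server → ∀ k, Coins N (sz k)) : Randomizers N sz := fun x =>
  let s := x.2.1
  let k := x.2.2.1
  let i := x.2.2.2
  ![R x.2,
    R x.2 * if s = c then (coins s c.other k).1 i
      else (coins s c k).1 i * (coins s c.other k).1 ((coins s c k).2.symm i),
    (coins s c k).1 i] x.1

/-- The permutations and randomizers determine the randomizers before the round and the coins. -/
def randomizersEquiv : (Server × Word sz → (ZMod N)ˣ) × (Server → Server → ∀ k, Coins N (sz k)) ≃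
    (Perms sz × Perms sz) × Randomizers N sz where
  toFun p := (permsOf c p.2, randomizers c p.1 p.2)
  invFun q := (fun x => q.2 (0, x), fun s t k =>
    if t = c then (fun i => q.2 (2, s, ⟨k, i⟩), q.1.1 s k)
    else (fun i =>
      if s = c then q.2 (1, s, ⟨k, i⟩) / q.2 (0, s, ⟨k, i⟩)
      else q.2 (1, s, ⟨k, q.1.1 s k i⟩) /
        (q.2 (0, s, ⟨k, q.1.1 s k i⟩) * q.2 (2, s, ⟨k, q.1.1 s k i⟩)), q.1.2 s k))
  left_inv := by
    rintro ⟨R, coins⟩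
    refine Prod.ext rfl (funext fun s => funext fun t => funext fun k => ?_)
    obtain rfl | rfl := Server.eq_or_eq_other c t
    · simp [permsOf, randomizers]
    · obtain rfl | rfl := Server.eq_or_eq_other c s <;>
        simp [permsOf, randomizers, Server.other_ne]
  right_inv := by
    rintro ⟨π, R⟩
    refine Prod.ext (by simp [permsOf, c.other_ne]) (funext fun ⟨j, s, k, i⟩ => ?_)
    obtain rfl | rfl := Server.eq_or_eq_other c s <;>
      fin_cases j <;> simp [randomizers, Server.other_ne, ← mul_assoc]

theorem unif_bind_randomizers {u : ℕ} {γ : Type*}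
    (f : (Perms sz × Perms sz) → Randomizers N sz → PMF γ) :
    ((unif (Server → ∀ k, Fin (sz k) → History N u)).bind fun hist =>
        (unif (Server → Server → ∀ k, Coins N (sz k))).bind fun coins =>
          f (permsOf c coins)
            (randomizers c (fun x => histProd (hist x.1 x.2.1 x.2.2)) coins)) =
      (unif (Perms sz × Perms sz)).bind fun π => (unif (Randomizers N sz)).bind (f π) := by
  let prods : (Server → ∀ k, Fin (sz k) → History N u) →* (Server × Word sz → (ZMod N)ˣ) :=
    { toFun := fun hist x => histProd (hist x.1 x.2.1 x.2.2)
      map_one' := by funext x; simp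
      map_mul' := fun h h' => by funext x; simp }
  have prods_surjective : Function.Surjective prods := by
    intro R
    choose g hg using fun x => histProd_surjective (u := u) (R x)
    exact ⟨fun s k i => g (s, ⟨k, i⟩), funext hg⟩
  have change := unif_bind_equiv (randomizersEquiv c) fun q => f q.1 q.2
  rw [unif_prod_bind, unif_prod_bind] at change
  rw [← change]
  exact unif_bind_of_map (unif_map_hom prods prods_surjective) fun R =>
    (unif (Server → Server → ∀ k, Coins N (sz k))).bind fun coins =>
      f (permsOf c coins) (randomizers c R coins)

end Randomizers

namespace Setting

variable {T : TPF} (F : KeyedFun) (X : Setting T) (S : KeySplit) (n : ℕ)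

/-- The shuffle experiment for plaintexts `m`. -/
noncomputable def shuffleGame (m : Server → Word (X.sz n) → ℕ) : PMF Bool :=
  (T.setup n).bind fun pp => (unif (T.Key n)).bind fun kM => (unif (T.Key n)).bind fun kU =>
    (turSetup n).bind fun pq => (S.keyGen n pq.1 pq.2).bind fun pdk =>
    (unif (Server → ShuffleParam T n)).bind fun r => (unif (Fin (2 ^ n))).bind fun kT =>
    (unif (Server → ∀ k, Fin (X.sz n k) → History (pq.1 * pq.2) (X.u n))).bind fun hist =>
    (unif (Server → Server → ∀ k, Coins (pq.1 * pq.2) (X.sz n k))).bind fun coins =>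
    (unif Bool).bind fun b =>
      ((X.A.prog n).out (env T F n pp fun _ => 0)
        (serverView F X.c (pdk X.c) (T.recKeyGen kU kM).val.val r
          (fun s k i => currentEntry F pp (pq.1 * pq.2) kM kT r s (X.word n ⟨k, i⟩)
            (m s ⟨k, i⟩) (hist s k i)) coins (X.tg n) b)).map (· == b)

/-- The output of the adversary on the view with real labels and tags for the keys `key`, whose
components are listed in `keysEquiv`. -/
noncomputable def playKeys (b : Bool) (π : Perms (X.sz n) × Perms (X.sz n))
    (ck : Ciphers (X.sz n)) (pp : T.Param n)
    (key : (T.Key n × T.Key n) × Fin (2 ^ n) × Fin (2 ^ n) × Fin (2 ^ n) × T.Key n × T.Key n) :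
    PMF Bool :=
  let (ρa, κc, κd, kT, k₂, k₁) := key
  X.play F n b (ρa, π) κc
    (X.tagsOf n (fun x => F n κc x.val) (fun x => F n κd x.val) fun x => F n kT (X.tagInput n x))
    ck pp (fun w => T.rnd pp k₁ (X.word n w), fun w => T.rnd pp k₂ (X.word n w))

theorem encPow_enc_rnd (pp : T.Param n) (K ρ : T.Key n) (x : ℕ) :
    T.encPow n (T.enc n (T.rnd pp K x)) ρ.val.val = T.enc n (T.rnd pp (K * ρ) x) := by
  rw [T.encPow_enc, ← T.reEnc_rnd_eq_rnd_mul]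
  rfl

section ServerView

variable {N : ℕ} {m : Server → Word (X.sz n) → ℕ} {pp : T.Param n} {kM kU : T.Key n} {pdk : ℕ}
  {r : Server → ShuffleParam T n} {kT : Fin (2 ^ n)}
  {hist : Server → ∀ k, Fin (X.sz n k) → History N (X.u n)}
  {coins : Server → Server → ∀ k, Coins N (X.sz n k)}

theorem serverLeaves_currentEntry (hN : N ≠ 0) :
    serverLeaves F X.c pdk (T.recKeyGen kU kM).val.val r
        (fun s k i => currentEntry F pp N kM kT r s (X.word n ⟨k, i⟩) (m s ⟨k, i⟩) (hist s k i))
        coins =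
      X.leaves n (((r X.c).1, kM / kU), permsOf X.c coins) (r X.c).2
        (fun w => T.rnd pp (kM * ((r X.c).1 * (r X.c.other).1) ^ X.u n) (X.word n w), fun w =>
          T.rnd pp (kM * ((r X.c).1 * (r X.c.other).1) ^ X.u n * (r X.c.other).1) (X.word n w))
        (X.tagsOf n (fun x => F n (r X.c).2 x.val) (fun x => F n (r X.c.other).2 x.val)
          fun x => F n kT (X.tagInput n x))
        (encryptAll m m (N, pdk)
          (randomizers X.c (fun x => histProd (hist x.1 x.2.1 x.2.2)) coins)) := by
  simp only [serverLeaves, currentEntry_eq_stdEntry F pp hN X.c, honestEntry,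
    refresh_stdEntry F pp hN]
  unfold leaves Inputs.leaves inputsOf
  congr 1
  funext s w
  obtain hs | hs := X.c.eq_or_eq_other s
  · simp [hs, Entry.toTriple, stdEntry, tagsOf, honTag, encryptAll, randomizers, tagInput]
  · simp [hs, X.c.other_ne, Entry.toTriple, stdEntry, tagsOf, honTag, encryptAll, randomizers,
      tagInput, encPow_enc_rnd, mul_assoc, mul_comm, mul_left_comm]

theorem out_serverView (hN : N ≠ 0) (b : Bool) :
    (X.A.prog n).out (env T F n pp fun _ => 0)
        (serverView F X.c pdk (T.recKeyGen kU kM).val.val r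
          (fun s k i => currentEntry F pp N kM kT r s (X.word n ⟨k, i⟩)
            (m s ⟨k, i⟩) (hist s k i)) coins (X.tg n) b) =
      X.playKeys F n b (permsOf X.c coins)
        (encryptAll m m (N, pdk)
          (randomizers X.c (fun x => histProd (hist x.1 x.2.1 x.2.2)) coins)) pp
        (keysEquiv X.c (X.u n) (kM, kU, r, kT)) := by
  rw [serverView_eq_viewOf, X.serverLeaves_currentEntry F n hN]
  rfl

end ServerView

theorem bind_keyGen_comm {α β : Type*} (p : PMF α) (pq : ℕ × ℕ) (f : α → (Server → ℕ) → PMF β) :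
    (p.bind fun a => (S.keyGen n pq.1 pq.2).bind fun d => f a d) =
      (S.keyGen n pq.1 pq.2).bind fun d => p.bind fun a => f a d :=
  PMF.bind_comm _ _ _

theorem shuffleGame_eq_bind_playKeys (m : Server → Word (X.sz n) → ℕ) :
    X.shuffleGame F S n m =
      (turSetup n).bind fun pq => (S.keyGen n pq.1 pq.2).bind fun pdk => (T.setup n).bind fun pp =>
        (unif Bool).bind fun b => (unif (Perms (X.sz n) × Perms (X.sz n))).bind fun π =>
        (unif (Randomizers (pq.1 * pq.2) (X.sz n))).bind fun R =>
        (unif (T.Key n × T.Key n)).bind fun ρa => (unif (Fin (2 ^ n))).bind fun κc =>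
        (unif (Fin (2 ^ n))).bind fun κd => (unif (Fin (2 ^ n))).bind fun kT =>
        (unif (T.Key n)).bind fun k₂ => (unif (T.Key n)).bind fun k₁ =>
          (X.playKeys F n b π (encryptAll m m (pq.1 * pq.2, pdk X.c) R) pp
            (ρa, κc, κd, kT, k₂, k₁)).map (· == b) := by
  simp only [shuffleGame]
  simp only [PMF.bind_comm _ (unif Bool)]
  simp only [PMF.bind_comm _ (T.setup n)]
  simp only [PMF.bind_comm _ (turSetup n)]
  simp only [bind_keyGen_comm S n]
  refine bind_congr_of_mem_support _ fun pq hpq => congrArg (PMF.bind _) (funext fun pdk =>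
    congrArg (PMF.bind _) (funext fun pp => congrArg (PMF.bind _) (funext fun b => ?_)))
  obtain ⟨hp, hq, -⟩ := lt_two_pow_of_mem_support_turSetup hpq
  simp only [X.out_serverView F n (mul_ne_zero hp hq)]
  simp only [PMF.bind_comm _ (unif (Server → Server → ∀ k, Coins (pq.1 * pq.2) (X.sz n k)))]
  simp only [PMF.bind_comm _
    (unif (Server → ∀ k, Fin (X.sz n k) → History (pq.1 * pq.2) (X.u n)))]
  have change_keys (π) (R : Randomizers (pq.1 * pq.2) (X.sz n)) :=
    unif_bind_keys X.c (X.u n) fun key => (X.playKeys F n b π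
      (encryptAll m m (pq.1 * pq.2, pdk X.c) R) pp key).map (· == b)
  simp only [change_keys]
  rw [← unif_bind_randomizers (u := X.u n) X.c]

theorem shuffleGame_eq_game (m : Server → Word (X.sz n) → ℕ) :
    X.shuffleGame F S n m = X.game F n (X.labReal n) (X.tagReal F n) (cipherDist S n X.c m m) := by
  rw [shuffleGame_eq_bind_playKeys]
  simp only [game, labReal, tagReal, cipherDist, keyDist, PMF.bind_bind, PMF.bind_map,
    Function.comp_def, unif_prod_bind (α := T.Key n × T.Key n)]
  simp only [PMF.bind_comm _ (unif Bool)]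
  simp only [PMF.bind_comm _ (T.setup n)]
  simp only [PMF.bind_comm _ (turSetup n)]
  simp only [bind_keyGen_comm S n]
  refine congrArg (PMF.bind _) (funext fun pq => congrArg (PMF.bind _) (funext fun pdk =>
    congrArg (PMF.bind _) (funext fun pp => congrArg (PMF.bind _) (funext fun b => ?_))))
  simp only [PMF.bind_comm _ (unif (Randomizers (pq.1 * pq.2) (X.sz n)))]
  simp only [PMF.bind_comm _ (unif (Perms (X.sz n) × Perms (X.sz n)))]
  rfl

end Setting

/-! ## The hybrid argument -/

namespace Setting

variable {T : TPF}

section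

variable {F : KeyedFun} (X : Setting T) {S : KeySplit}

theorem indist_game_real_ideal (hT : TPFSecure T F) (hF : FSecure T F)
    (hW : ∀ n, 8 * n + 24 + S.len n ≤ X.W n) (m₁ m₂ : ∀ n, Server → Word (X.sz n) → ℕ) :
    Indist (fun n => X.game F n (X.labReal n) (X.tagReal F n)
        (cipherDist S n X.c (m₁ n) (m₂ n)))
      (fun n => X.game F n (fun _ => unif (Lab T n (X.sz n))) (X.tagIdeal F n)
        (cipherDist S n X.c (m₁ n) (m₂ n))) := by
  have hDk n := inRange_cipherDist (c := X.c) (m₁ n) (m₂ n) (hW n)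
  exact (X.indist_labReal_labMid hT _ hDk).trans <|
    (X.indist_labMid_labIdeal hT _ hDk).trans <|
    (X.indist_tagReal_tagInit hF _ hDk).trans <|
    (X.indist_tagInit_tagFun hF _ hDk).trans <|
    X.indist_tagFun_tagIdeal hF _ _

theorem exists_indist_cipherDist_eq (hS : TURUnlinkable T F S)
    (hW : ∀ n, 8 * n + 24 + S.len n ≤ X.W n)
    (L : ∀ n, PMF (Lab T n (X.sz n))) (Dt : ∀ n, Fin (2 ^ n) → PMF (Tag n (X.sz n)))
    (m : ∀ n, Server → Word (X.sz n) → ℕ) (hm : ∀ n s w, m n s w < 2 ^ X.W n)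
    (w₀ w₁ : ∀ n, Word (X.sz n)) :
    ∃ m₂ : ∀ n, Server → Word (X.sz n) → ℕ, (∀ n s, m₂ n s (w₀ n) = m₂ n s (w₁ n)) ∧
      Indist
        (fun n => X.game F n (fun _ => L n) (Dt n) (cipherDist S n X.c (m n) (m n)))
        (fun n => X.game F n (fun _ => L n) (Dt n) (cipherDist S n X.c (m n) (m₂ n))) := by
  let m₁ : ∀ n, Server → Word (X.sz n) → ℕ := fun n s w =>
    if (s, w) = (.cs1, w₀ n) then m n s (w₁ n) else m n s w
  let m₂ : ∀ n, Server → Word (X.sz n) → ℕ := fun n s w =>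
    if (s, w) = (.cs2, w₀ n) then m₁ n s (w₁ n) else m₁ n s w
  have hm₁ n s w : m₁ n s w < 2 ^ X.W n := by
    simp only [m₁]
    split_ifs <;> exact hm _ _ _
  have hm₂ n s w : m₂ n s w < 2 ^ X.W n := by
    simp only [m₂]
    split_ifs <;> exact hm₁ _ _ _
  refine ⟨m₂, fun n s => ?_, ?_⟩
  · cases s <;> simp [m₂, m₁]
  · exact (X.indist_cipherDist hS hW L Dt hm hm hm₁ (x := fun n => (.cs1, w₀ n))
      fun n s w h => if_neg h).trans <|
      X.indist_cipherDist hS hW L Dt hm hm₁ hm₂ (x := fun n => (.cs2, w₀ n))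
      fun n s w h => if_neg h

theorem negligible_prob_game_sub_half (hT : TPFSecure T F) (hF : FSecure T F)
    (hS : TURUnlinkable T F S) (hW : ∀ n, 8 * n + 24 + S.len n ≤ X.W n)
    (m : ∀ n, Server → Word (X.sz n) → ℕ) (hm : ∀ n s w, m n s w < 2 ^ X.W n) :
    Negligible fun n => |prob (X.game F n (X.labReal n) (X.tagReal F n)
      (cipherDist S n X.c (m n) (m n))) - 1 / 2| := by
  obtain ⟨m₂, hm₂, close⟩ := X.exists_indist_cipherDist_eq hS hW
    (fun n => unif (Lab T n (X.sz n))) (fun n => X.tagIdeal F n) m hm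
    (fun n => ⟨(X.tg n).k, (X.tg n).i₀⟩) fun n => ⟨(X.tg n).k, (X.tg n).i₁⟩
  have h := (X.indist_game_real_ideal hT hF hW m m).trans close
  simpa only [Indist, X.prob_game_ideal (hm₂ _)] using h

end

/-- The setting of a family of shuffle experiments, with registers wide enough for all the numbers
that occur. -/
def ofIndex (T : TPF) (S : KeySplit) (I : IndexFamily) (u : ℕ → ℕ) (hu : PolyBounded u)
    (c o : Server) (k : Kind) (i₀ i₁ : ∀ n, Fin ((I.index n).size k)) (A : Adversary) :
    Setting T where
  sz n := (I.index n).size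
  word n w := (I.index n).word w.1 w.2
  word_injective n := (I.index n).word_injective
  c := c
  tg n := ⟨o, k, i₀ n, i₁ n⟩
  A := A
  u := u
  u_poly := hu
  W n := T.len n + S.len n + 2 * I.wordLen n + 8 * n + (I.index n).size .pref +
    (I.index n).size .keyword + (I.index n).objects + 24
  W_poly := ((((((T.len_poly.add S.len_poly).add
    ((polyBounded_const 2).mul I.wordLen_poly)).add ((polyBounded_const 8).mul polyBounded_id)).add
    (I.size_poly .pref)).add (I.size_poly .keyword)).add I.objects_poly).add (polyBounded_const 24)
  len_le n := by omega
  n_le n := by omega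
  sz_le n k := by cases k <;> omega
  word_lt n w := (Nat.size_le.1 (I.word_size n w.1 w.2)).trans_le
    (Nat.pow_le_pow_right two_pos (by omega))
  pair_lt n s w := by
    have h₁ := Nat.size_le.1 (I.word_size n w.1 w.2)
    have h₂ : s.num ≤ 2 := by cases s <;> simp [Server.num]
    have h₃ : max s.num ((I.index n).word w.1 w.2) + 1 ≤ 2 ^ (I.wordLen n + 2) := by
      have : 1 ≤ 2 ^ I.wordLen n := Nat.one_le_two_pow
      rw [pow_add]
      omega
    refine (Nat.pair_lt_max_add_one_sq _ _).trans_le ((Nat.pow_le_pow_left h₃ 2).trans ?_)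
    rw [← pow_mul]
    exact Nat.pow_le_pow_right two_pos (by omega)

theorem shuffleExp_eq_shuffleGame (F : KeyedFun) (S : KeySplit) (n : ℕ) (I : IndexFamily)
    (u : ℕ → ℕ) (hu : PolyBounded u) (c o : Server) (k : Kind)
    (i₀ i₁ : ∀ n, Fin ((I.index n).size k)) (A : Adversary) :
    shuffleExp T F S n (I.index n) (u n) c o k (i₀ n) (i₁ n) (A.prog n) =
      (ofIndex T S I u hu c o k i₀ i₁ A).shuffleGame F S n
        fun s w => Nat.ofBits ((I.index n).bitmap s w.1 w.2) :=
  rfl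

end Setting

end Brasp

theorem theorem2 (T : Brasp.TPF) (F : Brasp.KeyedFun) (S : Brasp.KeySplit)
    (hT : Brasp.TPFSecure T F) (hF : Brasp.FSecure T F) (hS : Brasp.TURUnlinkable T F S) :
    Brasp.ShuffleIndistinguishable T F S := by
  intro I u hu c o k i₀ i₁ A
  let X := Brasp.Setting.ofIndex T S I u hu c o k i₀ i₁ A
  have h := X.negligible_prob_game_sub_half hT hF hS
    (fun n => by simp only [X, Brasp.Setting.ofIndex]; lia)
    (fun n s w => Nat.ofBits ((I.index n).bitmap s w.1 w.2)) fun n s w =>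
      (Nat.ofBits_lt_two_pow _).trans_le (Nat.pow_le_pow_right two_pos
        (by simp only [X, Brasp.Setting.ofIndex]; lia))
  refine ⟨_, h, fun n => ?_⟩
  rw [Brasp.Setting.shuffleExp_eq_shuffleGame F S n I u hu c o k i₀ i₁ A,
    Brasp.Setting.shuffleGame_eq_game]
  exact sub_le_iff_le_add'.1 (le_abs_self _)
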